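/- Let $n \ge 3$ be an integer and let $\max\left(1, \frac{2n}{n+4}\right) \le p \le \frac{2n+2}{n+5}$ with $(n,p) \ne (4,1)$. There is a constant $C_{n,p}$, depending only on $n$ and $p$, such that the following holds. For a Schwartz function $\varphi$ on $\mathbb{R}^n$ write $\hat\varphi(\xi) = \int_{\mathbb{R}^n} e^{-i\xi\cdot x}\varphi(x)\,dx$. Let $f \in L^p(\mathbb{R}^n)$ be complex-valued, and suppose that $\hat f$ vanishes on the unit sphere in the $L^2$-trace sense, i.e. there are Schwartz functions $\varphi_k$ with $\varphi_k \to f$ in $L^p(\mathbb{R}^n)$ and $\hat\varphi_k|_{\mathbb{S}^{n-1}} \to 0$ in $L^2(\mathbb{S}^{n-1})$ (with respect to surface measure). Then there exists a unique $u \in L^2(\mathbb{R}^n)$ such that $(-\Delta - 1)u = f$ in the sense of tempered distributions. Furthermore, $\|u\|_{L^2(\mathbb{R}^n)} \le C_{n,p}\|f\|_{L^p(\mathbb{R}^n)}$. -/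

import Mathlib

open MeasureTheory Filter Topology
open scoped ENNReal SchwartzMap Laplacian

noncomputable section

namespace Helmholtz

/-- Euclidean space `ℝⁿ`. -/
abbrev Space (n : ℕ) : Type := EuclideanSpace ℝ (Fin n)

/-- The unit sphere `𝕊ⁿ⁻¹` of `ℝⁿ`. -/
abbrev UnitSphere (n : ℕ) : Type := Metric.sphere (0 : Space n) 1

/-- Surface measure on the unit sphere. -/
abbrev surfaceMeasure (n : ℕ) : Measure (UnitSphere n) :=
  (volume : Measure (Space n)).toSphere

/-- The Fourier transform `φ̂(ξ) = ∫ e^{-i ξ·x} φ(x) dx` of a Schwartz function. The frequency `ξ` is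
not rescaled by `2π`, so that `-Δ` has symbol `|ξ|²`. -/
def fourier {n : ℕ} (φ : 𝓢(Space n, ℂ)) (ξ : Space n) : ℂ :=
  ∫ x : Space n, Complex.exp (-Complex.I * (inner ℝ ξ x : ℝ)) * φ x

/-- `g` is an `L²`-trace of `f̂` on the unit sphere, for `f ∈ Lᵖ(ℝⁿ)`: some Schwartz functions `φ_k`
converge to `f` in `Lᵖ` while the restrictions of `φ̂_k` to the sphere converge to `g` in
`L²(𝕊ⁿ⁻¹)`. That is, `(f, g)` lies in the closure of the graph of the restriction map
`φ ↦ φ̂|_{𝕊ⁿ⁻¹}` defined on Schwartz functions. -/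
def HasSphereTrace {n : ℕ} {p : ℝ≥0∞} [Fact (1 ≤ p)]
    (f : Lp ℂ p (volume : Measure (Space n))) (g : UnitSphere n → ℂ) : Prop :=
  MemLp g 2 (surfaceMeasure n) ∧
    ∃ φ : ℕ → 𝓢(Space n, ℂ),
      Tendsto (fun k => (φ k).toLp p (volume : Measure (Space n))) atTop (𝓝 f) ∧
      Tendsto (fun k => eLpNorm (fun ω : UnitSphere n => fourier (φ k) (ω : Space n) - g ω) 2
        (surfaceMeasure n)) atTop (𝓝 0)

/-- `f̂` vanishes on the unit sphere in the `L²`-trace sense. -/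
def FourierVanishesOnSphere {n : ℕ} {p : ℝ≥0∞} [Fact (1 ≤ p)]
    (f : Lp ℂ p (volume : Measure (Space n))) : Prop :=
  HasSphereTrace f (fun _ => 0)

/-- `u ∈ L²(ℝⁿ)` solves `(-Δ - 1) u = f` in the sense of (tempered) distributions. -/
def IsSolution {n : ℕ} {p : ℝ≥0∞} [Fact (1 ≤ p)]
    (u : Lp ℂ 2 (volume : Measure (Space n))) (f : Lp ℂ p (volume : Measure (Space n))) : Prop :=
  -(Δ (Lp.toTemperedDistribution u)) - Lp.toTemperedDistribution u = Lp.toTemperedDistribution f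

end Helmholtz

end

noncomputable section

namespace Helmholtz

open FourierTransform

/-! ### A one-dimensional oscillatory integral -/

/-! Write `symb ε z` = `ε + i(4π²|z|² - 1)` for the regularised symbol times `i`. The heart is a
bound, uniform in `0 < ε ≤ 1`, for the form `∫ symb⁻² |𝓕 φ|²` by a multiple of `‖φ‖_p²`
(`exists_norm_powForm_two_le`). It needs no vanishing on the sphere, because the integrand
oscillates and no absolute value is taken inside.

It comes from Stein interpolation in the family `symb^(-s)`. On `Re s = 0` Plancherel gives `L² →
L²`. On `Re s = b` with `n/2 ≤ b ≤ (n+1)/2` the kernel is bounded, giving `L¹ → L^∞`: by the Gamma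
integral and the explicit Schrödinger kernel, `Γ(s)` times the kernel is a constant times `∫ t^(w-1)
exp((i-ε)t + iρ²/t) dt`, with `w = s - n/2` and `ρ = |x-y|/2`. This one-dimensional integral is
estimated by integration by parts, with a factor `w` to absorb the divergence at `w = 0`. The
exponent reached at `s = 2` satisfies `b = 2p/(2-p)`, and the two limits on `b` are exactly the two
limits on `p`.

Absolute values are recovered by integrating in `ε`. The derivative of `∫ symb⁻¹ |𝓕 φ|²` is minus
the form just bounded, so this resolvent form is Lipschitz in `ε`. Its real part is a Poisson
integral, equal to `ε ∫ |𝓕 φ|²/|symb|²`, whose limit as `ε → 0` is controlled by the `L²` norm of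
the trace on the sphere. Dividing by `ε` bounds `∫ |𝓕 φ|²/|symb|²` by `A + (π/ε)‖trace‖²`
(`integral_norm_fourier_sq_div_le`).

Cauchy-Schwarz then bounds the pairing of `φ` with a test function `ψ`. Letting the approximating
sequence converge first, so that the trace disappears, and `ε → 0` afterwards leaves `|f(ψ)| ≤ √A
‖f‖_p ‖(-Δ-1)ψ‖₂`. Since `(-Δ-1)` has dense range in `L²`, extension by density and the Riesz
theorem give the solution, its uniqueness and its bound. -/

theorem norm_integral_le_of_hasDerivAt_add {c d : ℝ} (hcd : c ≤ d) {H X Y : ℝ → ℂ} {G g : ℝ → ℝ}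
    (hH : ∀ t ∈ Set.Icc c d, HasDerivAt H (X t + Y t) t)
    (hX : ContinuousOn X (Set.Icc c d)) (hY : ContinuousOn Y (Set.Icc c d))
    (hYg : ∀ t ∈ Set.Icc c d, ‖Y t‖ ≤ g t) (hg : ContinuousOn g (Set.Icc c d))
    (hG : ∀ t ∈ Set.Icc c d, HasDerivAt G (g t) t) :
    ‖∫ t in c..d, X t‖ ≤ ‖H c‖ + ‖H d‖ + (G d - G c) := by
  rw [← Set.uIcc_of_le hcd] at hX hY hg hH hG
  have iX : IntervalIntegrable X volume c d := hX.intervalIntegrable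
  have iY : IntervalIntegrable Y volume c d := hY.intervalIntegrable
  have ig : IntervalIntegrable g volume c d := hg.intervalIntegrable
  have h1 := intervalIntegral.integral_eq_sub_of_hasDerivAt hH (iX.add iY)
  have h2 := intervalIntegral.integral_eq_sub_of_hasDerivAt hG ig
  rw [intervalIntegral.integral_add iX iY] at h1
  have h3 : ‖∫ t in c..d, Y t‖ ≤ ∫ t in c..d, g t :=
    intervalIntegral.norm_integral_le_of_norm_le hcd
      (ae_of_all _ fun t ht => hYg t (Set.Ioc_subset_Icc_self ht)) ig
  have h4 : ∫ t in c..d, X t = H d - H c - ∫ t in c..d, Y t := by rw [← h1]; ring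
  rw [h4, ← h2]
  calc _ ≤ ‖H d‖ + ‖H c‖ + ‖∫ t in c..d, Y t‖ :=
        (norm_sub_le _ _).trans (by gcongr; exact norm_sub_le _ _)
    _ ≤ _ := by linarith

/-- The oscillating factor `exp ((i - ε) t + i ρ² / t)` of the resolvent kernel. -/
def osc (ε ρ t : ℝ) : ℂ := Complex.exp ((Complex.I - ε) * t + Complex.I * ρ ^ 2 / t)

theorem norm_osc (ε ρ t : ℝ) : ‖osc ε ρ t‖ = Real.exp (-ε * t) := by
  rw [osc, Complex.norm_exp]
  congr 1
  have : (Complex.I * (ρ : ℂ) ^ 2 / t) = ((ρ ^ 2 / t : ℝ) : ℂ) * Complex.I := by push_cast; ring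
  rw [this, Complex.add_re, Complex.re_ofReal_mul, Complex.I_re, mul_zero]
  simp

theorem norm_osc_le_one {ε : ℝ} (hε : 0 < ε) (ρ : ℝ) {t : ℝ} (ht : 0 < t) : ‖osc ε ρ t‖ ≤ 1 := by
  rw [norm_osc]
  apply Real.exp_le_one_iff.2
  nlinarith

theorem hasDerivAt_osc (ε ρ : ℝ) {t : ℝ} (ht : 0 < t) :
    HasDerivAt (osc ε ρ) (((Complex.I - ε) - Complex.I * ρ ^ 2 / t ^ 2) * osc ε ρ t) t := by
  have hd : HasDerivAt (fun t : ℝ => (t : ℂ)) 1 t := Complex.ofRealCLM.hasDerivAt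
  have ht' : (t : ℂ) ≠ 0 := by exact_mod_cast ht.ne'
  have h := ((hd.const_mul (Complex.I - ε)).add
    ((hasDerivAt_const t (Complex.I * (ρ : ℂ) ^ 2)).div hd ht')).cexp
  refine h.congr_deriv ?_
  simp only [osc, Pi.add_apply, Pi.div_apply]
  field_simp
  ring

theorem hasDerivAt_ofReal_cpow_real (w : ℂ) {t : ℝ} (ht : 0 < t) :
    HasDerivAt (fun t : ℝ => (t : ℂ) ^ w) (w * (t : ℂ) ^ (w - 1)) t := by
  have := ((hasDerivAt_id (t : ℂ)).cpow_const (c := w) (Or.inl (by simpa using ht))).comp_ofReal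
  simpa using this

theorem norm_ofReal_cpow_le {w : ℂ} (h0 : 0 ≤ w.re) (h1 : w.re ≤ 1 / 2) {t : ℝ} (ht : 0 < t) :
    ‖(t : ℂ) ^ w‖ ≤ 1 + √t := by
  rw [Complex.norm_cpow_eq_rpow_re_of_pos ht]
  rcases le_total t 1 with h | h
  · have := Real.rpow_le_one ht.le h h0
    linarith [Real.sqrt_nonneg t]
  · have := Real.rpow_le_rpow_of_exponent_le h h1
    rw [← Real.sqrt_eq_rpow] at this
    linarith

theorem continuousOn_osc (ε ρ : ℝ) {c d : ℝ} (hc : 0 < c) :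
    ContinuousOn (osc ε ρ) (Set.Icc c d) := fun _ ht =>
  (hasDerivAt_osc ε ρ (hc.trans_le ht.1)).continuousAt.continuousWithinAt

theorem continuousOn_ofReal_cpow (w : ℂ) {c d : ℝ} (hc : 0 < c) :
    ContinuousOn (fun t : ℝ => (t : ℂ) ^ w) (Set.Icc c d) := fun _ ht =>
  (hasDerivAt_ofReal_cpow_real w (hc.trans_le ht.1)).continuousAt.continuousWithinAt

/-- Integration by parts against the full phase, away from its stationary point `t = ρ`. -/
theorem norm_integral_osc_le_of_far {w : ℂ} (h0 : 0 ≤ w.re) (h1 : w.re ≤ 1 / 2) {ε ρ : ℝ}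
    (hε : 0 < ε) (hε1 : ε ≤ 1) (hρ : 0 ≤ ρ) {c d : ℝ} (hc : 0 < c) (hcd : c ≤ d) (σ : ℝ)
    (hσ : σ = 1 ∨ σ = -1)
    (hfar : ∀ t ∈ Set.Icc c d, 1 ≤ σ * (t - ρ) ∧ √ρ ≤ σ * (t - ρ)) :
    ‖∫ t in c..d, (t : ℂ) ^ (w - 1) * osc ε ρ t‖ ≤ 6 + 4 * (‖w‖ + 5) := by
  have hσ2 : σ * σ = 1 := by rcases hσ with rfl | rfl <;> norm_num
  -- `Q t / t²` is the logarithmic derivative of `osc ε ρ`, so `t^(w+1) / Q · osc` is the natural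
  -- primitive to try.
  set Q : ℝ → ℂ := fun t => (Complex.I - ε) * t ^ 2 - Complex.I * ρ ^ 2 with hQ
  have hQim : ∀ t : ℝ, (Q t).im = t ^ 2 - ρ ^ 2 := by
    intro t
    have : Q t = ((-(ε * t ^ 2) : ℝ) : ℂ) + ((t ^ 2 - ρ ^ 2 : ℝ) : ℂ) * Complex.I := by
      simp only [hQ]; push_cast; ring
    rw [this]; simp [-Complex.ofReal_neg, -Complex.ofReal_mul, -Complex.ofReal_pow, -Complex.ofReal_sub]
  -- lower bound for `Q`
  have hQlow : ∀ t ∈ Set.Icc c d, σ * (t - ρ) * (t + ρ) ≤ ‖Q t‖ := by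
    intro t ht
    refine le_trans ?_ (Complex.abs_im_le_norm (Q t))
    rw [hQim]
    have : σ * (t - ρ) * (t + ρ) = σ * (t ^ 2 - ρ ^ 2) := by ring
    rw [this]
    rcases hσ with rfl | rfl
    · rw [one_mul]; exact le_abs_self _
    · rw [neg_one_mul]; exact neg_le_abs _
  have hpos : ∀ t ∈ Set.Icc c d, 0 < t := fun t ht => hc.trans_le ht.1
  have hQpos : ∀ t ∈ Set.Icc c d, 0 < ‖Q t‖ := fun t ht => by
    refine lt_of_lt_of_le ?_ (hQlow t ht)
    have := (hfar t ht).1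
    have := hpos t ht
    positivity
  have hQne : ∀ t ∈ Set.Icc c d, Q t ≠ 0 := fun t ht => norm_pos_iff.1 (hQpos t ht)
  have hQd : ∀ t : ℝ, HasDerivAt Q (2 * (Complex.I - ε) * t) t := by
    intro t
    have hd : HasDerivAt (fun t : ℝ => (t : ℂ)) 1 t := Complex.ofRealCLM.hasDerivAt
    refine (((hd.pow 2).const_mul (Complex.I - (ε : ℂ))).sub_const _).congr_deriv ?_
    simp; ring
  have hQc : Continuous Q := continuous_iff_continuousAt.2 fun t => (hQd t).continuousAt
  set Y : ℝ → ℂ := fun t =>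
    ((w + 1) * (t : ℂ) ^ w * Q t - (t : ℂ) ^ (w + 1) * (2 * (Complex.I - ε) * t)) / Q t ^ 2 * osc ε ρ t
    with hY
  have hI : ‖Complex.I - (ε : ℂ)‖ ≤ 2 := by
    refine (norm_sub_le _ _).trans ?_
    rw [Complex.norm_I, Complex.norm_real, Real.norm_of_nonneg hε.le]; linarith
  -- growth of `t ^ w` in terms of the distance to `ρ`
  have hgrow : ∀ t ∈ Set.Icc c d, ‖(t : ℂ) ^ w‖ ≤ 1 + √ρ + √(σ * (t - ρ)) := by
    intro t ht
    refine (norm_ofReal_cpow_le h0 h1 (hpos t ht)).trans ?_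
    have hu := (hfar t ht).1
    have : √t ≤ √ρ + √(σ * (t - ρ)) := by
      rw [Real.sqrt_le_left (by positivity)]
      have e1 := Real.sq_sqrt hρ
      have e2 := Real.sq_sqrt (show 0 ≤ σ * (t - ρ) by linarith)
      have e3 : t ≤ ρ + σ * (t - ρ) := by
        rcases hσ with rfl | rfl <;> linarith
      nlinarith [Real.sqrt_nonneg ρ, Real.sqrt_nonneg (σ * (t - ρ)),
        mul_nonneg (Real.sqrt_nonneg ρ) (Real.sqrt_nonneg (σ * (t - ρ)))]
    linarith
  have hK : 0 ≤ ‖w‖ + 5 := by positivity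
  -- With `u = |t - ρ|`, the bounds `|Q| ≥ u²` and `|Q| ≥ u t` reduce the error term to `|t^w| /
  -- u²`. The function `G` is an explicit antiderivative of this majorant, bounded because `u ≥
  -- max(1, √ρ)`.
  set g : ℝ → ℝ := fun t => (‖w‖ + 5) * ((1 + √ρ) / (σ * (t - ρ)) ^ 2 +
    √(σ * (t - ρ)) / (σ * (t - ρ)) ^ 2) with hg
  set G : ℝ → ℝ := fun t => (‖w‖ + 5) * (-σ * ((1 + √ρ) / (σ * (t - ρ)) +
    2 / √(σ * (t - ρ)))) with hG
  have key := norm_integral_le_of_hasDerivAt_add hcd (H := fun t => (t : ℂ) ^ (w + 1) / Q t * osc ε ρ t)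
    (X := fun t => (t : ℂ) ^ (w - 1) * osc ε ρ t) (Y := Y) (G := G) (g := g) ?_ ?_ ?_ ?_ ?_ ?_
  · refine key.trans ?_
    have hb : ∀ t ∈ Set.Icc c d, ‖(t : ℂ) ^ (w + 1) / Q t * osc ε ρ t‖ ≤ 3 := by
      intro t ht
      have ht0 := hpos t ht
      obtain ⟨hu, hu2⟩ := hfar t ht
      rw [norm_mul, norm_div, Complex.cpow_add _ _ (by exact_mod_cast ht0.ne'), Complex.cpow_one,
        norm_mul, Complex.norm_real, Real.norm_of_nonneg ht0.le]
      have h2 : ‖(t : ℂ) ^ w‖ * t / ‖Q t‖ ≤ 3 := by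
        rw [div_le_iff₀ (hQpos t ht)]
        have hs : √(σ * (t - ρ)) ≤ σ * (t - ρ) := by
          rw [Real.sqrt_le_left (by linarith)]; nlinarith
        calc ‖(t : ℂ) ^ w‖ * t ≤ (1 + √ρ + √(σ * (t - ρ))) * (t + ρ) := by
              gcongr
              · exact hgrow t ht
              · linarith
          _ ≤ 3 * (σ * (t - ρ) * (t + ρ)) := by
              rw [← mul_assoc]; gcongr; linarith
          _ ≤ 3 * ‖Q t‖ := by gcongr; exact hQlow t ht
      calc ‖(t : ℂ) ^ w‖ * t / ‖Q t‖ * ‖osc ε ρ t‖ ≤ 3 * 1 := by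
            gcongr; exact norm_osc_le_one hε ρ ht0
        _ = 3 := by norm_num
    have hGb : ∀ t ∈ Set.Icc c d, 0 ≤ (1 + √ρ) / (σ * (t - ρ)) + 2 / √(σ * (t - ρ)) ∧
        (1 + √ρ) / (σ * (t - ρ)) + 2 / √(σ * (t - ρ)) ≤ 4 := by
      intro t ht
      obtain ⟨hu, hu2⟩ := hfar t ht
      have hs1 : 1 ≤ √(σ * (t - ρ)) := by rw [Real.one_le_sqrt]; exact hu
      constructor
      · positivity
      · have a1 : (1 + √ρ) / (σ * (t - ρ)) ≤ 2 := by rw [div_le_iff₀ (by linarith)]; linarith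
        have a2 : 2 / √(σ * (t - ρ)) ≤ 2 := by rw [div_le_iff₀ (by linarith)]; linarith
        linarith
    have hc' := hb c ⟨le_rfl, hcd⟩
    have hd' := hb d ⟨hcd, le_rfl⟩
    have hGc := hGb c ⟨le_rfl, hcd⟩
    have hGd := hGb d ⟨hcd, le_rfl⟩
    have : G d - G c ≤ 4 * (‖w‖ + 5) := by
      have e : G d - G c = (‖w‖ + 5) * (-σ * ((1 + √ρ) / (σ * (d - ρ)) + 2 / √(σ * (d - ρ)))
          - -σ * ((1 + √ρ) / (σ * (c - ρ)) + 2 / √(σ * (c - ρ)))) := by simp only [hG]; ring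
      rw [e, mul_comm]
      gcongr
      generalize (1 + √ρ) / (σ * (d - ρ)) + 2 / √(σ * (d - ρ)) = x at *
      generalize (1 + √ρ) / (σ * (c - ρ)) + 2 / √(σ * (c - ρ)) = y at *
      rcases hσ with rfl | rfl <;> linarith [hGc.1, hGc.2, hGd.1, hGd.2]
    linarith
  · intro t ht
    have ht0 := hpos t ht
    have ht' : (t : ℂ) ≠ 0 := by exact_mod_cast ht0.ne'
    have h := ((hasDerivAt_ofReal_cpow_real (w + 1) ht0).div (hQd t) (hQne t ht)).mul
      (hasDerivAt_osc ε ρ ht0)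
    refine h.congr_deriv ?_
    have hq : (Complex.I - (ε : ℂ)) - Complex.I * ρ ^ 2 / t ^ 2 = Q t / t ^ 2 := by
      simp only [hQ]; field_simp
    have e1 : (t : ℂ) ^ (w + 1) = (t : ℂ) ^ (w - 1) * t ^ 2 := by
      rw [← Complex.cpow_natCast, ← Complex.cpow_add _ _ ht']
      congr 1; push_cast; ring
    rw [hq]
    simp only [hY, Pi.div_apply, add_sub_cancel_right]
    have := hQne t ht
    rw [e1]
    field_simp
    ring
  · exact (continuousOn_ofReal_cpow _ hc).mul (continuousOn_osc _ _ hc)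
  · refine ContinuousOn.mul (ContinuousOn.div ?_ (hQc.continuousOn.pow 2) ?_) (continuousOn_osc _ _ hc)
    · exact ((continuousOn_const.mul (continuousOn_ofReal_cpow _ hc)).mul hQc.continuousOn).sub
        ((continuousOn_ofReal_cpow _ hc).mul (by fun_prop))
    · exact fun t ht => pow_ne_zero _ (hQne t ht)
  · intro t ht
    have ht0 := hpos t ht
    have ht' : (t : ℂ) ≠ 0 := by exact_mod_cast ht0.ne'
    obtain ⟨hu, hu2⟩ := hfar t ht
    have hQp := hQpos t ht
    have hQl := hQlow t ht
    have hY' : ‖Y t‖ ≤ ((‖w‖ + 1) * ‖(t : ℂ) ^ w‖ / ‖Q t‖ + ‖(t : ℂ) ^ w‖ * 4 * t ^ 2 / ‖Q t‖ ^ 2) := by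
      have e : Y t = ((w + 1) * (t : ℂ) ^ w / Q t
          - (t : ℂ) ^ w * (2 * (Complex.I - ε)) * t ^ 2 / Q t ^ 2) * osc ε ρ t := by
        simp only [hY]
        rw [Complex.cpow_add _ _ ht', Complex.cpow_one]
        have := hQne t ht
        field_simp
      rw [e, norm_mul]
      refine (mul_le_of_le_one_right (norm_nonneg _) (norm_osc_le_one hε ρ ht0)).trans ?_
      refine (norm_sub_le _ _).trans ?_
      simp only [norm_mul, norm_div, norm_pow, Complex.norm_real, Real.norm_of_nonneg ht0.le]
      gcongr
      · exact (norm_add_le _ _).trans (by simp)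
      · calc _ ≤ ‖(2 : ℂ)‖ * 2 := by gcongr
          _ = 4 := by norm_num
    refine hY'.trans ?_
    set u := σ * (t - ρ) with hu_def
    have hut : u ≤ t + ρ := by rcases hσ with h | h <;> simp only [hu_def, h] <;> linarith
    have b1 : u ^ 2 ≤ ‖Q t‖ := le_trans (by nlinarith) hQl
    have b2 : u ^ 2 * t ^ 2 ≤ ‖Q t‖ ^ 2 := by
      rw [← mul_pow]
      gcongr
      exact le_trans (by nlinarith) hQl
    have hn := norm_nonneg ((t : ℂ) ^ w)
    calc _ ≤ (‖w‖ + 1) * ‖(t : ℂ) ^ w‖ / u ^ 2 + ‖(t : ℂ) ^ w‖ * 4 / u ^ 2 := by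
          gcongr ?_ + ?_
          · gcongr
          · rw [div_le_div_iff₀ (by positivity) (by positivity)]
            nlinarith
      _ = (‖w‖ + 5) * (‖(t : ℂ) ^ w‖ / u ^ 2) := by ring
      _ ≤ g t := by
          simp only [hg, ← hu_def]
          rw [← add_div]
          gcongr
          exact hgrow t ht
  · have hne : ∀ t ∈ Set.Icc c d, (σ * (t - ρ)) ^ 2 ≠ 0 := fun t ht => by
      have := (hfar t ht).1; positivity
    refine ContinuousOn.mul continuousOn_const (ContinuousOn.add ?_ ?_)
    · exact ContinuousOn.div (by fun_prop) (by fun_prop) hne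
    · exact ContinuousOn.div (by fun_prop) (by fun_prop) hne
  · intro t ht
    obtain ⟨hu, hu2⟩ := hfar t ht
    have hup : 0 < σ * (t - ρ) := by linarith
    have hd : HasDerivAt (fun t => σ * (t - ρ)) σ t := by
      simpa using ((hasDerivAt_id t).sub_const ρ).const_mul σ
    have hs : 0 < √(σ * (t - ρ)) := Real.sqrt_pos.2 hup
    have h := ((((hasDerivAt_const t (1 + √ρ)).div hd hup.ne').add
      ((hasDerivAt_const t (2 : ℝ)).div (hd.sqrt hup.ne') hs.ne')).const_mul (-σ)).const_mul (‖w‖ + 5)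
    refine h.congr_deriv ?_
    simp only [hg]
    congr 1
    have hss : √(σ * (t - ρ)) ^ 2 = σ * (t - ρ) := Real.sq_sqrt hup.le
    generalize √(σ * (t - ρ)) = s at *
    rw [← hss]
    field_simp
    linear_combination (s + 1 + √ρ) * hσ2

theorem norm_I_sub_le {ε : ℝ} (hε : 0 < ε) (hε1 : ε ≤ 1) : ‖Complex.I - (ε : ℂ)‖ ≤ 2 := by
  refine (norm_sub_le _ _).trans ?_
  rw [Complex.norm_I, Complex.norm_real, Real.norm_of_nonneg hε.le]; linarith

theorem norm_ofReal_cpow_le_four {w : ℂ} (h0 : 0 ≤ w.re) (h1 : w.re ≤ 1 / 2) {t : ℝ} (ht : 0 < t)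
    (ht6 : t ≤ 6) : ‖(t : ℂ) ^ w‖ ≤ 4 := by
  have := norm_ofReal_cpow_le h0 h1 ht
  have h : √t ≤ 3 := by rw [Real.sqrt_le_left (by norm_num)]; linarith
  linarith

/-- Integration by parts using that `t ^ w` has derivative `w t ^ (w - 1)`, where the phase
varies slowly. -/
theorem norm_mul_integral_osc_le_of_mid {w : ℂ} (h0 : 0 ≤ w.re) (h1 : w.re ≤ 1 / 2) {ε ρ : ℝ}
    (hε : 0 < ε) (hε1 : ε ≤ 1) {c d : ℝ} (hc : 0 < c) (hcd : c ≤ d) (hcρ : ρ ^ 2 ≤ c)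
    (hd : d ≤ 6) :
    ‖w * ∫ t in c..d, (t : ℂ) ^ (w - 1) * osc ε ρ t‖ ≤ 60 := by
  have hpos : ∀ t ∈ Set.Icc c d, 0 < t := fun t ht => hc.trans_le ht.1
  have key := norm_integral_le_of_hasDerivAt_add hcd (H := fun t => (t : ℂ) ^ w * osc ε ρ t)
    (X := fun t => w * (t : ℂ) ^ (w - 1) * osc ε ρ t)
    (Y := fun t => (t : ℂ) ^ w * (((Complex.I - ε) - Complex.I * ρ ^ 2 / t ^ 2) * osc ε ρ t))
    (G := fun t => 4 * (2 * t - ρ ^ 2 / t)) (g := fun t => 4 * (2 + ρ ^ 2 / t ^ 2)) ?_ ?_ ?_ ?_ ?_ ?_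
  · have e : w * ∫ t in c..d, (t : ℂ) ^ (w - 1) * osc ε ρ t =
        ∫ t in c..d, w * (t : ℂ) ^ (w - 1) * osc ε ρ t := by
      rw [← intervalIntegral.integral_const_mul]; simp only [mul_assoc]
    rw [e]
    refine key.trans ?_
    have hb : ∀ t ∈ Set.Icc c d, ‖(t : ℂ) ^ w * osc ε ρ t‖ ≤ 4 := by
      intro t ht
      rw [norm_mul]
      exact (mul_le_of_le_one_right (norm_nonneg _) (norm_osc_le_one hε ρ (hpos t ht))).trans
        (norm_ofReal_cpow_le_four h0 h1 (hpos t ht) (ht.2.trans hd))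
    have hc' := hb c ⟨le_rfl, hcd⟩
    have hd' := hb d ⟨hcd, le_rfl⟩
    have h1 : ρ ^ 2 / c ≤ 1 := by rw [div_le_one hc]; exact hcρ
    have h2 : 0 ≤ ρ ^ 2 / d := by have := hc.trans_le hcd; positivity
    linarith
  · intro t ht
    have := (hasDerivAt_ofReal_cpow_real w (hpos t ht)).mul (hasDerivAt_osc ε ρ (hpos t ht))
    exact this
  · exact (continuousOn_const.mul (continuousOn_ofReal_cpow _ hc)).mul (continuousOn_osc _ _ hc)
  · refine (continuousOn_ofReal_cpow _ hc).mul (ContinuousOn.mul ?_ (continuousOn_osc _ _ hc))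
    refine continuousOn_const.sub (ContinuousOn.div (by fun_prop) (by fun_prop) fun t ht => ?_)
    have := hpos t ht
    exact pow_ne_zero _ (by exact_mod_cast this.ne')
  · intro t ht
    have ht0 := hpos t ht
    rw [norm_mul, norm_mul]
    have := norm_ofReal_cpow_le_four h0 h1 ht0 (ht.2.trans hd)
    have h2 := norm_osc_le_one hε ρ ht0
    have h3 : ‖(Complex.I - (ε : ℂ)) - Complex.I * ρ ^ 2 / t ^ 2‖ ≤ 2 + ρ ^ 2 / t ^ 2 := by
      refine (norm_sub_le _ _).trans (add_le_add (norm_I_sub_le hε hε1) (le_of_eq ?_))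
      simp
    calc _ ≤ 4 * ((2 + ρ ^ 2 / t ^ 2) * 1) := by gcongr
      _ = _ := by ring
  · refine continuousOn_const.mul (continuousOn_const.add
      (ContinuousOn.div (by fun_prop) (by fun_prop) fun t ht => ?_))
    have := hpos t ht
    positivity
  · intro t ht
    have ht0 := hpos t ht
    have := (((hasDerivAt_id t).const_mul 2).sub
      ((hasDerivAt_const t (ρ ^ 2)).div (hasDerivAt_id t) ht0.ne')).const_mul 4
    refine this.congr_deriv ?_
    simp only [id]
    field_simp
    ring

/-- Integration by parts against `exp (i ρ² / t)` near the origin. -/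
theorem norm_integral_osc_le_of_near {w : ℂ} (h0 : 0 ≤ w.re) (h1 : w.re ≤ 1 / 2) {ε ρ : ℝ}
    (hε : 0 < ε) (hε1 : ε ≤ 1) {c d : ℝ} (hc : 0 < c) (hcd : c ≤ d) (hdρ : d ≤ ρ ^ 2)
    (hd : d ≤ 6) :
    ‖∫ t in c..d, (t : ℂ) ^ (w - 1) * osc ε ρ t‖ ≤ 60 + 4 * ‖w‖ := by
  have hpos : ∀ t ∈ Set.Icc c d, 0 < t := fun t ht => hc.trans_le ht.1
  have hρ2 : 0 < ρ ^ 2 := (hc.trans_le hcd).trans_le hdρ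
  have hρ : (ρ : ℂ) ≠ 0 := by
    intro h
    rw [Complex.ofReal_eq_zero] at h
    simp [h] at hρ2
  set k : ℂ := (-(Complex.I * (ρ : ℂ) ^ 2))⁻¹ with hk
  have hkn : ‖k‖ = 1 / ρ ^ 2 := by simp [hk]
  have key := norm_integral_le_of_hasDerivAt_add hcd
    (H := fun t => k * (t : ℂ) ^ (w + 1) * osc ε ρ t)
    (X := fun t => (t : ℂ) ^ (w - 1) * osc ε ρ t)
    (Y := fun t => k * ((w + 1) * (t : ℂ) ^ w + (Complex.I - ε) * (t : ℂ) ^ (w + 1)) * osc ε ρ t)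
    (G := fun t => 4 * (‖w‖ + 13) / ρ ^ 2 * t) (g := fun t => 4 * (‖w‖ + 13) / ρ ^ 2) ?_ ?_ ?_ ?_ ?_ ?_
  · refine key.trans ?_
    have hb : ∀ t ∈ Set.Icc c d, ‖k * (t : ℂ) ^ (w + 1) * osc ε ρ t‖ ≤ 4 := by
      intro t ht
      have ht0 := hpos t ht
      rw [norm_mul, norm_mul, hkn, Complex.cpow_add _ _ (by exact_mod_cast ht0.ne'),
        Complex.cpow_one, norm_mul, Complex.norm_real, Real.norm_of_nonneg ht0.le]
      refine (mul_le_of_le_one_right (by positivity) (norm_osc_le_one hε ρ ht0)).trans ?_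
      have := norm_ofReal_cpow_le_four h0 h1 ht0 (ht.2.trans hd)
      rw [one_div, inv_mul_le_iff₀ hρ2, mul_comm]
      exact mul_le_mul (ht.2.trans hdρ) this (norm_nonneg _) hρ2.le
    have hc' := hb c ⟨le_rfl, hcd⟩
    have hd' := hb d ⟨hcd, le_rfl⟩
    have : 4 * (‖w‖ + 13) / ρ ^ 2 * d - 4 * (‖w‖ + 13) / ρ ^ 2 * c ≤ 4 * (‖w‖ + 13) := by
      rw [← mul_sub, div_mul_eq_mul_div, div_le_iff₀ hρ2]
      gcongr
      linarith
    linarith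
  · intro t ht
    have ht0 := hpos t ht
    have ht' : (t : ℂ) ≠ 0 := by exact_mod_cast ht0.ne'
    have := ((hasDerivAt_ofReal_cpow_real (w + 1) ht0).const_mul k).mul (hasDerivAt_osc ε ρ ht0)
    refine this.congr_deriv ?_
    have e1 : (t : ℂ) ^ (w + 1) = (t : ℂ) ^ (w - 1) * t ^ 2 := by
      rw [← Complex.cpow_natCast, ← Complex.cpow_add _ _ ht']
      congr 1; push_cast; ring
    rw [add_sub_cancel_right, hk, e1]
    have := Complex.I_ne_zero
    field_simp
    ring
  · exact (continuousOn_ofReal_cpow _ hc).mul (continuousOn_osc _ _ hc)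
  · exact (continuousOn_const.mul ((continuousOn_const.mul (continuousOn_ofReal_cpow _ hc)).add
      (continuousOn_const.mul (continuousOn_ofReal_cpow _ hc)))).mul (continuousOn_osc _ _ hc)
  · intro t ht
    have ht0 := hpos t ht
    rw [norm_mul, norm_mul, hkn]
    refine (mul_le_of_le_one_right (by positivity) (norm_osc_le_one hε ρ ht0)).trans ?_
    rw [one_div_mul_eq_div]
    gcongr
    have h4 := norm_ofReal_cpow_le_four h0 h1 ht0 (ht.2.trans hd)
    have hI := norm_I_sub_le hε hε1
    have ht6 := ht.2.trans hd
    have hw : ‖w + 1‖ ≤ ‖w‖ + 1 := (norm_add_le _ _).trans (by simp)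
    calc _ ≤ ‖w + 1‖ * ‖(t : ℂ) ^ w‖ + ‖Complex.I - (ε : ℂ)‖ * (‖(t : ℂ) ^ w‖ * t) := by
          refine (norm_add_le _ _).trans (le_of_eq ?_)
          rw [norm_mul, norm_mul, Complex.cpow_add _ _ (by exact_mod_cast ht0.ne'), Complex.cpow_one,
            norm_mul, Complex.norm_real, Real.norm_of_nonneg ht0.le]
      _ ≤ (‖w‖ + 1) * 4 + 2 * (4 * 6) := by gcongr
      _ = 4 * (‖w‖ + 13) := by ring
  · exact continuousOn_const
  · intro t _
    simpa using (hasDerivAt_id t).const_mul (4 * (‖w‖ + 13) / ρ ^ 2)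

theorem integrableOn_cpow_mul_osc {w : ℂ} (h0 : 0 < w.re) {ε : ℝ} (hε : 0 < ε) (ρ : ℝ) :
    IntegrableOn (fun t : ℝ => (t : ℂ) ^ (w - 1) * osc ε ρ t) (Set.Ioi 0) := by
  have h := integrableOn_rpow_mul_exp_neg_mul_rpow (p := 1) (s := w.re - 1) (b := ε)
    (by linarith) one_pos hε
  refine Integrable.mono' h ?_ ?_
  · refine ContinuousOn.aestronglyMeasurable (fun t ht => ?_) measurableSet_Ioi
    exact (((hasDerivAt_ofReal_cpow_real (w - 1) ht).continuousAt).mul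
      (hasDerivAt_osc ε ρ ht).continuousAt).continuousWithinAt
  · filter_upwards [ae_restrict_mem measurableSet_Ioi] with t ht
    rw [norm_mul, norm_osc, Complex.norm_cpow_eq_rpow_re_of_pos ht, Real.rpow_one]
    simp

/-- The phase `t + ρ²/t` is stationary only at `t = ρ`, within a window of width about `√ρ`. That
window contributes about `ρ^(Re w - 1) √ρ`, which stays bounded for large `ρ` because `Re w ≤ 1/2`.
For small `ρ` the danger is `t^(w-1)` near the origin: the factor `w` turns it into an exact
derivative for `t ≥ ρ²`, and below `ρ²` the oscillation of `exp(iρ²/t)` takes over. -/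
theorem norm_mul_integral_Ioi_osc_le {w : ℂ} (h0 : 0 < w.re) (h1 : w.re ≤ 1 / 2) {ε ρ : ℝ}
    (hε : 0 < ε) (hε1 : ε ≤ 1) (hρ : 0 ≤ ρ) :
    ‖w * ∫ t in Set.Ioi (0 : ℝ), (t : ℂ) ^ (w - 1) * osc ε ρ t‖ ≤ 200 * (1 + ‖w‖) ^ 2 := by
  set f : ℝ → ℂ := fun t => (t : ℂ) ^ (w - 1) * osc ε ρ t with hf
  have hint : IntegrableOn f (Set.Ioi 0) := integrableOn_cpow_mul_osc h0 hε ρ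
  have hii : ∀ {c d : ℝ}, 0 ≤ c → 0 ≤ d → IntervalIntegrable f volume c d := by
    intro c d hc hd
    rw [intervalIntegrable_iff]
    exact hint.mono_set fun x hx => (le_min hc hd).trans_lt hx.1
  -- it suffices to bound the integral over large compact intervals
  suffices hs : ∃ c₀ > 0, ∃ d₀ : ℝ, ∀ c d : ℝ, 0 < c → c ≤ c₀ → d₀ ≤ d →
      ‖w * ∫ t in c..d, f t‖ ≤ 200 * (1 + ‖w‖) ^ 2 by
    obtain ⟨c₀, hc₀, d₀, hb⟩ := hs
    have hcov : AECover (volume.restrict (Set.Ioi (0 : ℝ))) atTop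
        fun k : ℕ => Set.Ioi (1 / ((k : ℝ) + 1)) ∩ Set.Iic (k : ℝ) :=
      (aecover_Ioi_of_Ioi tendsto_one_div_add_atTop_nhds_zero_nat).inter
        (aecover_Iic tendsto_natCast_atTop_atTop)
    have hlim := hcov.integral_tendsto_of_countably_generated hint
    refine le_of_tendsto ((hlim.const_mul w).norm) ?_
    filter_upwards [tendsto_one_div_add_atTop_nhds_zero_nat.eventually (gt_mem_nhds hc₀),
      tendsto_natCast_atTop_atTop.eventually_ge_atTop d₀, eventually_ge_atTop 1] with k hk1 hk2 hk3
    have hk4 : (1 : ℝ) ≤ k := by exact_mod_cast hk3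
    have hp : 0 < 1 / ((k : ℝ) + 1) := by positivity
    have hle : 1 / ((k : ℝ) + 1) ≤ k := by
      rw [div_le_iff₀ (by positivity)]; nlinarith
    have := hb (1 / ((k : ℝ) + 1)) k hp hk1.le hk2
    rw [intervalIntegral.integral_of_le hle] at this
    rw [Measure.restrict_restrict (measurableSet_Ioi.inter measurableSet_Iic)]
    have e : Set.Ioi (1 / ((k : ℝ) + 1)) ∩ Set.Iic (k : ℝ) ∩ Set.Ioi 0 =
        Set.Ioc (1 / ((k : ℝ) + 1)) k := by
      ext x
      simp only [Set.mem_inter_iff, Set.mem_Ioi, Set.mem_Iic, Set.mem_Ioc]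
      constructor
      · exact fun h => h.1
      · exact fun h => ⟨h, hp.trans h.1⟩
    rw [e]
    exact this
  have hwn := norm_nonneg w
  -- From `ρ = 4` on, the window `[ρ - √ρ, ρ + √ρ]` stays above both `1` and `ρ/2`.
  rcases le_or_gt 4 ρ with h4 | h4
  · have hs2 : 2 ≤ √ρ := by rw [Real.le_sqrt (by norm_num) hρ]; linarith
    have hsq := Real.sq_sqrt hρ
    have hlt : 1 ≤ ρ - √ρ := by nlinarith
    have hhalf : ρ / 2 ≤ ρ - √ρ := by nlinarith
    refine ⟨ρ - √ρ, by linarith, ρ + √ρ, fun c d hc hcc hdd => ?_⟩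
    have b1 := norm_integral_osc_le_of_far h0.le h1 hε hε1 hρ hc hcc (-1) (Or.inr rfl)
      (fun t ht => ⟨by linarith [ht.2], by linarith [ht.2]⟩)
    have b3 := norm_integral_osc_le_of_far h0.le h1 hε hε1 hρ (by linarith) hdd 1 (Or.inl rfl)
      (fun t ht => ⟨by linarith [ht.1], by linarith [ht.1]⟩)
    -- No cancellation is available here: the length `2√ρ` is multiplied by the bound `t^(-1/2) ≤
    -- 2/√ρ`.
    have b2 : ‖∫ t in (ρ - √ρ)..(ρ + √ρ), f t‖ ≤ 4 := by
      have := intervalIntegral.norm_integral_le_of_norm_le_const (a := ρ - √ρ) (b := ρ + √ρ)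
        (f := f) (C := 2 / √ρ) ?_
      · refine this.trans ?_
        rw [show ρ + √ρ - (ρ - √ρ) = 2 * √ρ by ring, abs_of_nonneg (by linarith)]
        rw [div_mul_eq_mul_div, div_le_iff₀ (by linarith)]
        linarith
      · intro t ht
        rw [Set.uIoc_of_le (by linarith)] at ht
        have ht1 : 1 ≤ t := hlt.trans ht.1.le
        have ht0 : 0 < t := by linarith
        rw [hf]
        simp only [norm_mul]
        refine (mul_le_of_le_one_right (norm_nonneg _) (norm_osc_le_one hε ρ ht0)).trans ?_
        rw [Complex.norm_cpow_eq_rpow_re_of_pos ht0]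
        calc t ^ (w - 1).re ≤ t ^ (-(1 / 2) : ℝ) :=
              Real.rpow_le_rpow_of_exponent_le ht1 (by simp; linarith)
          _ = 1 / √t := by rw [Real.rpow_neg ht0.le, Real.sqrt_eq_rpow, inv_eq_one_div]
          _ ≤ 2 / √ρ := by
              rw [div_le_div_iff₀ (Real.sqrt_pos.2 ht0) (by linarith), one_mul]
              rw [Real.sqrt_le_left (by positivity), mul_pow, Real.sq_sqrt ht0.le]
              linarith [ht.1]
    rw [← intervalIntegral.integral_add_adjacent_intervals (b := ρ - √ρ) (hii hc.le (by linarith))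
      (hii (by linarith) (by linarith)), ← intervalIntegral.integral_add_adjacent_intervals
      (a := ρ - √ρ) (b := ρ + √ρ) (hii (by linarith) (by linarith)) (hii (by linarith) (by linarith))]
    calc _ ≤ ‖w‖ * ((6 + 4 * (‖w‖ + 5)) + (4 + (6 + 4 * (‖w‖ + 5)))) := by
          rw [norm_mul]
          gcongr
          refine (norm_add_le _ _).trans (add_le_add b1 ((norm_add_le _ _).trans (add_le_add b2 b3)))
      _ ≤ _ := by nlinarith
  · set T := ρ + max 1 √ρ with hT
    have hs2 : √ρ ≤ 2 := by rw [Real.sqrt_le_left (by norm_num)]; linarith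
    have hT6 : T ≤ 6 := by
      have : max 1 √ρ ≤ 2 := max_le (by norm_num) hs2
      linarith
    have hm1 := le_max_left 1 √ρ
    have hm2 := le_max_right 1 √ρ
    have hT1 : 1 ≤ T := by linarith
    have tail : ∀ d, T ≤ d → ‖w * ∫ t in T..d, f t‖ ≤ ‖w‖ * (6 + 4 * (‖w‖ + 5)) := by
      intro d hd
      rw [norm_mul]
      gcongr
      exact norm_integral_osc_le_of_far h0.le h1 hε hε1 hρ (by linarith) hd 1 (Or.inl rfl)
        (fun t ht => ⟨by linarith [ht.1], by linarith [ht.1]⟩)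
    rcases hρ.eq_or_lt with h00 | hρpos
    · refine ⟨T, by linarith, T, fun c d hc hcc hdd => ?_⟩
      have b1 := norm_mul_integral_osc_le_of_mid (ρ := ρ) h0.le h1 hε hε1 hc hcc
        (by rw [← h00]; simpa using hc.le) hT6
      rw [← intervalIntegral.integral_add_adjacent_intervals (b := T) (hii hc.le (by linarith))
        (hii (by linarith) (by linarith)), mul_add]
      refine (norm_add_le _ _).trans ((add_le_add b1 (tail d hdd)).trans ?_)
      nlinarith
    -- At `t = ρ²` the derivative of `ρ²/t` has size `1/ρ²`, comparable with `1/t`, so the two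
    -- integrations by parts change roles there.
    · set m := min (ρ ^ 2) T with hm
      have hm0 : 0 < m := lt_min (by positivity) (by linarith)
      have hmT : m ≤ T := min_le_right _ _
      refine ⟨m, hm0, T, fun c d hc hcc hdd => ?_⟩
      have b1 := norm_integral_osc_le_of_near (ρ := ρ) h0.le h1 hε hε1 hc hcc (min_le_left _ _)
        (hmT.trans hT6)
      have b2 : ‖w * ∫ t in m..T, f t‖ ≤ 60 := by
        rcases le_total (ρ ^ 2) T with h | h
        · exact norm_mul_integral_osc_le_of_mid h0.le h1 hε hε1 hm0 hmT
            (by rw [hm, min_eq_left h]) hT6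
        · rw [hm, min_eq_right h, intervalIntegral.integral_same]; simp
      rw [← intervalIntegral.integral_add_adjacent_intervals (b := m) (hii hc.le (by linarith))
        (hii (by linarith) (by linarith)), ← intervalIntegral.integral_add_adjacent_intervals
        (a := m) (b := T) (hii (by linarith) (by linarith)) (hii (by linarith) (by linarith)), mul_add, mul_add]
      calc _ ≤ ‖w‖ * (60 + 4 * ‖w‖) + (60 + ‖w‖ * (6 + 4 * (‖w‖ + 5))) := by
            refine (norm_add_le _ _).trans (add_le_add ?_ ((norm_add_le _ _).trans
              (add_le_add b2 (tail d hdd))))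
            rw [norm_mul]
            gcongr
        _ ≤ _ := by nlinarith

/-! ### The Gamma integral with a complex parameter -/

theorem integrableOn_cpow_mul_exp {s : ℂ} (hs : 0 < s.re) {r : ℂ} (hr : 0 < r.re) :
    IntegrableOn (fun t : ℝ => (t : ℂ) ^ (s - 1) * Complex.exp (-(r * t))) (Set.Ioi 0) := by
  have h := integrableOn_rpow_mul_exp_neg_mul_rpow (p := 1) (s := s.re - 1) (b := r.re)
    (by linarith) one_pos hr
  refine Integrable.mono' h ?_ ?_
  · refine ContinuousOn.aestronglyMeasurable (fun t ht => ?_) measurableSet_Ioi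
    exact (((hasDerivAt_ofReal_cpow_real (s - 1) ht).continuousAt).mul
      (by fun_prop)).continuousWithinAt
  · filter_upwards [ae_restrict_mem measurableSet_Ioi] with t ht
    rw [norm_mul, Complex.norm_exp, Complex.norm_cpow_eq_rpow_re_of_pos ht, Real.rpow_one]
    simp

theorem differentiableOn_integral_cpow_mul_exp {s : ℂ} (hs : 0 < s.re) :
    DifferentiableOn ℂ (fun r : ℂ => ∫ t in Set.Ioi (0 : ℝ), (t : ℂ) ^ (s - 1) *
      Complex.exp (-(r * t))) {r | 0 < r.re} := by
  intro r₀ hr₀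
  have hr₀' : 0 < r₀.re := hr₀
  refine DifferentiableAt.differentiableWithinAt ?_
  have hη : 0 < r₀.re / 2 := by linarith
  have hball : ∀ r ∈ Metric.ball r₀ (r₀.re / 2), r₀.re / 2 ≤ r.re := by
    intro r hr
    have h1 := Complex.abs_re_le_norm (r - r₀)
    rw [Metric.mem_ball, dist_eq_norm] at hr
    rw [Complex.sub_re] at h1
    linarith [neg_abs_le (r.re - r₀.re)]
  have hmeas : ∀ r : ℂ, AEStronglyMeasurable (fun t : ℝ => (t : ℂ) ^ (s - 1) * Complex.exp (-(r * t)))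
      (volume.restrict (Set.Ioi 0)) := by
    intro r
    refine ContinuousOn.aestronglyMeasurable (fun t ht => ?_) measurableSet_Ioi
    exact (((hasDerivAt_ofReal_cpow_real (s - 1) ht).continuousAt).mul
      (by fun_prop)).continuousWithinAt
  have key := hasDerivAt_integral_of_dominated_loc_of_deriv_le
    (F := fun (r : ℂ) (t : ℝ) => (t : ℂ) ^ (s - 1) * Complex.exp (-(r * t)))
    (F' := fun (r : ℂ) (t : ℝ) => (t : ℂ) ^ (s - 1) * (Complex.exp (-(r * t)) * (-t)))
    (μ := volume.restrict (Set.Ioi 0)) (x₀ := r₀) (s := Metric.ball r₀ (r₀.re / 2))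
    (bound := fun t => t ^ s.re * Real.exp (-(r₀.re / 2) * t ^ (1 : ℝ)))
    (Metric.ball_mem_nhds _ hη) (Eventually.of_forall hmeas) (integrableOn_cpow_mul_exp hs hr₀) ?_ ?_ ?_ ?_
  · exact key.2.differentiableAt
  · refine ContinuousOn.aestronglyMeasurable (fun t ht => ?_) measurableSet_Ioi
    exact (((hasDerivAt_ofReal_cpow_real (s - 1) ht).continuousAt).mul
      (by fun_prop)).continuousWithinAt
  · filter_upwards [ae_restrict_mem measurableSet_Ioi] with t ht r hr
    have ht0 : 0 < t := ht
    rw [norm_mul, norm_mul, Complex.norm_exp, Complex.norm_cpow_eq_rpow_re_of_pos ht, Real.rpow_one,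
      norm_neg, Complex.norm_real, Real.norm_of_nonneg ht0.le]
    have e : t ^ s.re = t ^ (s - 1).re * t := by
      rw [← Real.rpow_add_one ht0.ne']; simp
    rw [e, mul_comm (Real.exp _) t, ← mul_assoc]
    gcongr
    have := hball r hr
    simp only [Complex.neg_re, Complex.mul_re, Complex.ofReal_re, Complex.ofReal_im, mul_zero, sub_zero]
    nlinarith
  · exact integrableOn_rpow_mul_exp_neg_mul_rpow (by linarith) one_pos hη
  · refine Eventually.of_forall fun t r _ => ?_
    have : HasDerivAt (fun r : ℂ => -(r * t)) (-t) r := by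
      exact (hasDerivAt_mul_const (t : ℂ)).fun_neg
    exact this.cexp.const_mul _

/-- Both sides are analytic in `r` on the right half-plane and agree for real `r > 0`; the identity
theorem at `1` does the rest. -/
theorem integral_cpow_mul_exp_eq {s : ℂ} (hs : 0 < s.re) {r : ℂ} (hr : 0 < r.re) :
    ∫ t in Set.Ioi (0 : ℝ), (t : ℂ) ^ (s - 1) * Complex.exp (-(r * t)) =
      Complex.Gamma s * r ^ (-s) := by
  have hopen : IsOpen {r : ℂ | 0 < r.re} := isOpen_lt continuous_const Complex.continuous_re
  have hconn : IsPreconnected {r : ℂ | 0 < r.re} := (convex_halfSpace_re_gt 0).isPreconnected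
  have h1 := (differentiableOn_integral_cpow_mul_exp hs).analyticOnNhd hopen
  have h2 : AnalyticOnNhd ℂ (fun r : ℂ => Complex.Gamma s * r ^ (-s)) {r : ℂ | 0 < r.re} := by
    refine DifferentiableOn.analyticOnNhd (fun r hr => ?_) hopen
    exact (((differentiableAt_id).cpow_const (Or.inl hr)).const_mul _).differentiableWithinAt
  refine h1.eqOn_of_preconnected_of_frequently_eq h2 hconn (z₀ := 1) (by simp) ?_ hr
  have hev : ∃ᶠ x : ℝ in 𝓝[≠] 1, 0 < x :=
    ((eventually_gt_nhds one_pos).filter_mono nhdsWithin_le_nhds).frequently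
  have ht : Tendsto (fun x : ℝ => (x : ℂ)) (𝓝[≠] 1) (𝓝[≠] 1) := by
    refine tendsto_nhdsWithin_iff.2 ⟨?_, ?_⟩
    · exact (Complex.continuous_ofReal.tendsto' 1 1 (by simp)).mono_left nhdsWithin_le_nhds
    · filter_upwards [self_mem_nhdsWithin] with x hx
      simpa using hx
  refine ht.frequently (hev.mono fun x hx => ?_)
  have := Complex.integral_cpow_mul_exp_neg_mul_Ioi hs hx
  rw [this, mul_comm, one_div, Complex.inv_cpow _ _ (by
    rw [Complex.arg_ofReal_of_nonneg hx.le]; exact Real.pi_pos.ne), Complex.cpow_neg]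

/-! ### Fourier transforms of functions in `L¹ ∩ L²` -/

theorem continuous_fourier_of_integrable {n : ℕ} {f : Space n → ℂ} (hf : Integrable f) :
    Continuous (𝓕 f) :=
  VectorFourier.fourierIntegral_continuous Real.continuous_fourierChar continuous_inner hf

theorem continuous_fourierInv_of_integrable {n : ℕ} {f : Space n → ℂ} (hf : Integrable f) :
    Continuous (𝓕⁻ f) := by
  have : 𝓕⁻ f = fun z => 𝓕 f (-z) := funext fun z => Real.fourierInv_eq_fourier_neg f z
  rw [this]
  exact (continuous_fourier_of_integrable hf).comp continuous_neg

theorem norm_fourier_le {n : ℕ} (f : Space n → ℂ) (z : Space n) : ‖𝓕 f z‖ ≤ ∫ x, ‖f x‖ :=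
  VectorFourier.norm_fourierIntegral_le_integral_norm _ _ _ _ _

theorem integral_fourier_mul_eq_flip {n : ℕ} {f g : Space n → ℂ} (hf : Integrable f)
    (hg : Integrable g) : ∫ z, 𝓕 f z * g z = ∫ x, f x * 𝓕 g x := by
  have := VectorFourier.integral_fourierIntegral_smul_eq_flip (L := innerₗ (Space n))
    Real.continuous_fourierChar continuous_inner hf hg
  simpa using! this

/-- For `f ∈ L¹ ∩ L²` the Fourier integral represents the `L²` Fourier transform. -/
theorem coeFn_fourier_toLp_ae_eq {n : ℕ} {f : Space n → ℂ} (hf : Integrable f)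
    (hf2 : MemLp f 2) : (𝓕 (hf2.toLp f) : Lp ℂ 2 (volume : Measure (Space n))) =ᵐ[volume] 𝓕 f := by
  refine ae_eq_of_integral_contDiff_smul_eq ((Lp.memLp _).locallyIntegrable (by norm_num))
    (continuous_fourier_of_integrable hf).locallyIntegrable ?_
  intro g g_smooth g_cpt
  have hg₁ : HasCompactSupport (Complex.ofRealCLM ∘ g) := g_cpt.comp_left rfl
  have hg₂ : ContDiff ℝ (⊤ : ℕ∞) (Complex.ofRealCLM ∘ g) := by fun_prop
  -- Testing against compactly supported smooth functions suffices: there the distributional and the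
  -- pointwise Fourier transform are compared by moving `𝓕` onto the test function.
  set ψ : 𝓢(Space n, ℂ) := hg₁.toSchwartzMap hg₂ with hψ
  have h1 : ∫ x, g x • (𝓕 (hf2.toLp f) : Lp ℂ 2 (volume : Measure (Space n))) x =
      Lp.toTemperedDistribution (𝓕 (hf2.toLp f)) ψ := by
    rw [Lp.toTemperedDistribution_apply]
    simp [hψ]
  rw [h1, ← Lp.fourier_toTemperedDistribution_eq, TemperedDistribution.fourier_apply,
    Lp.toTemperedDistribution_apply]
  have h2 : ∫ x, (𝓕 ψ) x • (hf2.toLp f) x = ∫ x, f x * 𝓕 (ψ : Space n → ℂ) x := by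
    refine integral_congr_ae ?_
    filter_upwards [hf2.coeFn_toLp] with x hx
    rw [hx, smul_eq_mul, mul_comm, SchwartzMap.fourier_coe]
  rw [h2, ← integral_fourier_mul_eq_flip hf ψ.integrable]
  refine integral_congr_ae (ae_of_all _ fun x => ?_)
  simp [hψ, mul_comm]

theorem memLp_fourier {n : ℕ} {f : Space n → ℂ} (hf : Integrable f) (hf2 : MemLp f 2) :
    MemLp (𝓕 f) 2 :=
  (memLp_congr_ae (coeFn_fourier_toLp_ae_eq hf hf2)).1 (Lp.memLp _)

theorem eLpNorm_fourier {n : ℕ} {f : Space n → ℂ} (hf : Integrable f) (hf2 : MemLp f 2) :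
    eLpNorm (𝓕 f) 2 volume = eLpNorm f 2 volume := by
  rw [← eLpNorm_congr_ae (coeFn_fourier_toLp_ae_eq hf hf2), ← Lp.enorm_def, ← ofReal_norm,
    Lp.norm_fourier_eq, ofReal_norm, Lp.enorm_def, eLpNorm_congr_ae hf2.coeFn_toLp]

theorem memLp_fourierInv {n : ℕ} {f : Space n → ℂ} (hf : Integrable f) (hf2 : MemLp f 2) :
    MemLp (𝓕⁻ f) 2 := by
  have : 𝓕⁻ f = 𝓕 f ∘ Neg.neg := funext fun z => Real.fourierInv_eq_fourier_neg f z
  rw [this]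
  exact (memLp_fourier hf hf2).comp_measurePreserving (Measure.measurePreserving_neg volume)

theorem eLpNorm_fourierInv {n : ℕ} {f : Space n → ℂ} (hf : Integrable f) (hf2 : MemLp f 2) :
    eLpNorm (𝓕⁻ f) 2 volume = eLpNorm f 2 volume := by
  have : 𝓕⁻ f = 𝓕 f ∘ Neg.neg := funext fun z => Real.fourierInv_eq_fourier_neg f z
  rw [this, eLpNorm_comp_measurePreserving (memLp_fourier hf hf2).1
    (Measure.measurePreserving_neg volume), eLpNorm_fourier hf hf2]

theorem integrable_fourier_mul_fourierInv {n : ℕ} {f k : Space n → ℂ} (hf : Integrable f)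
    (hf2 : MemLp f 2) (hk : Integrable k) (hk2 : MemLp k 2) :
    Integrable fun z => 𝓕 f z * 𝓕⁻ k z :=
  (memLp_fourier hf hf2).integrable_mul (memLp_fourierInv hk hk2)

theorem integral_norm_fourier_mul_fourierInv_le {n : ℕ} {f k : Space n → ℂ} (hf : Integrable f)
    (hf2 : MemLp f 2) (hk : Integrable k) (hk2 : MemLp k 2) :
    ∫ z, ‖𝓕 f z * 𝓕⁻ k z‖ ≤ (eLpNorm f 2 volume).toReal * (eLpNorm k 2 volume).toReal := by
  have h := eLpNorm_le_eLpNorm_mul_eLpNorm_of_nnnorm (p := 2) (q := 2) (r := 1)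
    (memLp_fourier hf hf2).1 (memLp_fourierInv hk hk2).1 (fun a b => a * b) 1
    (ae_of_all _ fun z => by simp)
  rw [eLpNorm_fourier hf hf2, eLpNorm_fourierInv hk hk2, ENNReal.coe_one, one_mul] at h
  rw [integral_norm_eq_lintegral_enorm (integrable_fourier_mul_fourierInv hf hf2 hk hk2).1,
    ← ENNReal.toReal_mul, ← eLpNorm_one_eq_lintegral_enorm]
  exact ENNReal.toReal_mono (ENNReal.mul_ne_top hf2.2.ne hk2.2.ne) h

/-- The multiplier with `Re b > 0` is itself integrable, so the Fourier transforms can be moved onto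
the Gaussian, whose transform is known; this gives the heat kernel with complex time. -/
theorem integral_gaussian_mul_fourier_mul_fourierInv {n : ℕ} {f k : Space n → ℂ}
    (hf : Integrable f) (hk : Integrable k) {b : ℂ} (hb : 0 < b.re) :
    ∫ z, Complex.exp (-b * ‖z‖ ^ 2) * (𝓕 f z * 𝓕⁻ k z) =
      (Real.pi / b) ^ ((n : ℂ) / 2) * ∫ q : Space n × Space n,
        f q.1 * k q.2 * Complex.exp (-Real.pi ^ 2 * ‖q.1 - q.2‖ ^ 2 / b) := by
  have hgauss : Integrable fun z : Space n => Complex.exp (-b * ‖z‖ ^ 2) := by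
    simpa using GaussianFourier.integrable_cexp_neg_mul_sq_norm_add hb 0 (0 : Space n)
  set h : Space n → ℂ := fun z => Complex.exp (-b * ‖z‖ ^ 2) * 𝓕⁻ k z with hh
  have hhi : Integrable h := by
    refine hgauss.mul_bdd (c := ∫ x, ‖k x‖) (continuous_fourierInv_of_integrable hk).aestronglyMeasurable ?_
    refine ae_of_all _ fun z => ?_
    rw [Real.fourierInv_eq_fourier_neg]
    exact norm_fourier_le k _
  have e1 : ∫ z, Complex.exp (-b * ‖z‖ ^ 2) * (𝓕 f z * 𝓕⁻ k z) = ∫ x, f x * 𝓕 h x := by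
    rw [← integral_fourier_mul_eq_flip hf hhi]
    refine integral_congr_ae (ae_of_all _ fun z => ?_)
    simp only [hh]; ring
  have e2 : ∀ x, 𝓕 h x = ∫ y, k y *
      ((Real.pi / b) ^ ((n : ℂ) / 2) * Complex.exp (-Real.pi ^ 2 * ‖x - y‖ ^ 2 / b)) := by
    intro x
    have hG : Integrable fun z : Space n =>
        Complex.exp (-b * ‖z‖ ^ 2 + 2 * Real.pi * Complex.I * inner ℝ x z) :=
      GaussianFourier.integrable_cexp_neg_mul_sq_norm_add hb _ x
    have := integral_fourier_mul_eq_flip hk hG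
    rw [Real.fourier_eq', ← integral_neg_eq_self]
    rw [show (∫ z, k z * 𝓕 (fun z : Space n =>
        Complex.exp (-b * ‖z‖ ^ 2 + 2 * Real.pi * Complex.I * inner ℝ x z)) z) = _ from
      integral_congr_ae (ae_of_all _ fun y => by
        simp only
        rw [fourier_gaussian_innerProductSpace' hb x y, finrank_euclideanSpace_fin])] at this
    rw [← this]
    refine integral_congr_ae (ae_of_all _ fun z => ?_)
    simp only [hh, norm_neg, Real.fourierInv_eq_fourier_neg, neg_neg, inner_neg_left, smul_eq_mul]
    rw [← mul_assoc, ← Complex.exp_add, mul_comm, real_inner_comm]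
    congr 2
    push_cast
    ring
  rw [e1]
  have hint : Integrable (fun q : Space n × Space n =>
      f q.1 * k q.2 * Complex.exp (-Real.pi ^ 2 * ‖q.1 - q.2‖ ^ 2 / b)) (volume.prod volume) := by
    refine (hf.mul_prod hk).mul_bdd (c := 1) ?_ ?_
    · exact Continuous.aestronglyMeasurable (by fun_prop)
    · refine ae_of_all _ fun q => ?_
      rw [Complex.norm_exp, Real.exp_le_one_iff]
      have : (-(Real.pi : ℂ) ^ 2 * ‖q.1 - q.2‖ ^ 2 / b) =
          ((-(Real.pi ^ 2 * ‖q.1 - q.2‖ ^ 2) : ℝ) : ℂ) * b⁻¹ := by push_cast; ring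
      rw [this, Complex.re_ofReal_mul, Complex.inv_re]
      have : 0 ≤ b.re / Complex.normSq b := div_nonneg hb.le (Complex.normSq_nonneg _)
      have h2 : 0 ≤ Real.pi ^ 2 * ‖q.1 - q.2‖ ^ 2 := by positivity
      nlinarith
  rw [Measure.volume_eq_prod, integral_prod _ hint, ← integral_const_mul]
  refine integral_congr_ae (ae_of_all _ fun x => ?_)
  simp only
  rw [e2 x, ← integral_const_mul, ← integral_const_mul]
  refine integral_congr_ae (ae_of_all _ fun y => ?_)
  simp only
  ring

/-- The Schrödinger propagator in the bilinear form `∫ 𝓕 f 𝓕⁻ k`. -/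
theorem integral_schrodinger_mul_fourier_mul_fourierInv {n : ℕ} {f k : Space n → ℂ}
    (hf : Integrable f) (hf2 : MemLp f 2) (hk : Integrable k) (hk2 : MemLp k 2) {τ : ℝ}
    (hτ : 0 < τ) :
    ∫ z, Complex.exp (-(Complex.I * τ) * ‖z‖ ^ 2) * (𝓕 f z * 𝓕⁻ k z) =
      (Real.pi / (Complex.I * τ)) ^ ((n : ℂ) / 2) * ∫ q : Space n × Space n,
        f q.1 * k q.2 * Complex.exp (-Real.pi ^ 2 * ‖q.1 - q.2‖ ^ 2 / (Complex.I * τ)) := by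
  -- The purely imaginary exponent is approached from the right half-plane. On both sides the
  -- exponentials have modulus at most `1`, so dominated convergence applies; the left side uses `f,
  -- k ∈ L²`, the right side `f, k ∈ L¹`.
  set b : ℕ → ℂ := fun j => ((1 / ((j : ℝ) + 1) : ℝ) : ℂ) + Complex.I * τ with hb
  have hbre : ∀ j, 0 < (b j).re := by
    intro j
    have : (b j).re = 1 / ((j : ℝ) + 1) := by simp [hb, -one_div, -Complex.ofReal_div, -Complex.ofReal_inv]
    rw [this]; positivity
  have hτ' : Complex.I * (τ : ℂ) ≠ 0 := mul_ne_zero Complex.I_ne_zero (by exact_mod_cast hτ.ne')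
  have hblim : Tendsto b atTop (𝓝 (Complex.I * τ)) := by
    have : Tendsto (fun j : ℕ => ((1 / ((j : ℝ) + 1) : ℝ) : ℂ)) atTop (𝓝 ((0 : ℝ) : ℂ)) :=
      (Complex.continuous_ofReal.tendsto 0).comp tendsto_one_div_add_atTop_nhds_zero_nat
    simpa [hb] using this.add_const (Complex.I * (τ : ℂ))
  have l1 : Tendsto (fun j => ∫ z, Complex.exp (-b j * ‖z‖ ^ 2) * (𝓕 f z * 𝓕⁻ k z)) atTop
      (𝓝 (∫ z, Complex.exp (-(Complex.I * τ) * ‖z‖ ^ 2) * (𝓕 f z * 𝓕⁻ k z))) := by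
    have hi := integrable_fourier_mul_fourierInv hf hf2 hk hk2
    refine tendsto_integral_of_dominated_convergence (fun z => ‖𝓕 f z * 𝓕⁻ k z‖) ?_ hi.norm ?_ ?_
    · exact fun j => (Continuous.aestronglyMeasurable (by fun_prop)).mul hi.1
    · refine fun j => ae_of_all _ fun z => ?_
      rw [norm_mul]
      refine mul_le_of_le_one_left (norm_nonneg _) ?_
      rw [Complex.norm_exp, Real.exp_le_one_iff]
      have : (-b j * (‖z‖ : ℂ) ^ 2) = ((‖z‖ ^ 2 : ℝ) : ℂ) * (-b j) := by push_cast; ring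
      rw [this, Complex.re_ofReal_mul, Complex.neg_re]
      have := hbre j
      nlinarith [sq_nonneg ‖z‖]
    · refine ae_of_all _ fun z => ?_
      exact (((Complex.continuous_exp.tendsto _).comp ((hblim.neg).mul_const _)).mul_const _)
  have l2 : Tendsto (fun j => (Real.pi / b j) ^ ((n : ℂ) / 2) * ∫ q : Space n × Space n,
        f q.1 * k q.2 * Complex.exp (-Real.pi ^ 2 * ‖q.1 - q.2‖ ^ 2 / b j)) atTop
      (𝓝 ((Real.pi / (Complex.I * τ)) ^ ((n : ℂ) / 2) * ∫ q : Space n × Space n,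
        f q.1 * k q.2 * Complex.exp (-Real.pi ^ 2 * ‖q.1 - q.2‖ ^ 2 / (Complex.I * τ)))) := by
    refine Tendsto.mul ?_ ?_
    · have hc : ContinuousAt (fun c : ℂ => ((Real.pi : ℂ) / c) ^ ((n : ℂ) / 2)) (Complex.I * τ) := by
        refine ContinuousAt.cpow (continuousAt_const.div continuousAt_id hτ') continuousAt_const ?_
        -- The base `π/(iτ)` lies on the negative imaginary axis, off the branch cut.
        right
        have : ((Real.pi : ℂ) / (Complex.I * τ)) = ((-(Real.pi / τ) : ℝ) : ℂ) * Complex.I := by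
          rw [div_mul_eq_div_div, Complex.div_I]
          push_cast; ring
        rw [this, Complex.im_ofReal_mul, Complex.I_im, mul_one]
        have := Real.pi_pos
        have : 0 < Real.pi / τ := by positivity
        linarith
      exact hc.tendsto.comp hblim
    · have hi : Integrable (fun q : Space n × Space n => f q.1 * k q.2) volume := hf.mul_prod hk
      refine tendsto_integral_of_dominated_convergence (fun q => ‖f q.1 * k q.2‖) ?_ hi.norm ?_ ?_
      · exact fun j => hi.1.mul (Continuous.aestronglyMeasurable (by fun_prop))
      · refine fun j => ae_of_all _ fun q => ?_
        rw [norm_mul]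
        refine mul_le_of_le_one_right (norm_nonneg _) ?_
        rw [Complex.norm_exp, Real.exp_le_one_iff]
        have : (-(Real.pi : ℂ) ^ 2 * ‖q.1 - q.2‖ ^ 2 / b j) =
            ((-(Real.pi ^ 2 * ‖q.1 - q.2‖ ^ 2) : ℝ) : ℂ) * (b j)⁻¹ := by push_cast; ring
        rw [this, Complex.re_ofReal_mul, Complex.inv_re]
        have : 0 ≤ (b j).re / Complex.normSq (b j) := div_nonneg (hbre j).le (Complex.normSq_nonneg _)
        have h2 : 0 ≤ Real.pi ^ 2 * ‖q.1 - q.2‖ ^ 2 := by positivity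
        nlinarith
      · refine ae_of_all _ fun q => ?_
        exact ((Complex.continuous_exp.tendsto _).comp (tendsto_const_nhds.div hblim hτ')).const_mul _
  refine tendsto_nhds_unique l1 (l2.congr fun j => ?_)
  rw [integral_gaussian_mul_fourier_mul_fourierInv hf hk (hbre j)]

/-! ### The kernel of complex powers of the resolvent -/

/-- The symbol `ε + i (|ξ|² - 1)`, in the frequency variable `z = ξ / 2π`. -/
def symb {n : ℕ} (ε : ℝ) (z : Space n) : ℂ := ε + Complex.I * (4 * Real.pi ^ 2 * ‖z‖ ^ 2 - 1)

theorem symb_re {n : ℕ} (ε : ℝ) (z : Space n) : (symb ε z).re = ε := by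
  have : symb ε z = (ε : ℂ) + ((4 * Real.pi ^ 2 * ‖z‖ ^ 2 - 1 : ℝ) : ℂ) * Complex.I := by
    simp only [symb]; push_cast; ring
  rw [this]; simp [-Complex.ofReal_sub, -Complex.ofReal_mul, -Complex.ofReal_pow]

theorem symb_im {n : ℕ} (ε : ℝ) (z : Space n) :
    (symb ε z).im = 4 * Real.pi ^ 2 * ‖z‖ ^ 2 - 1 := by
  have : symb ε z = (ε : ℂ) + ((4 * Real.pi ^ 2 * ‖z‖ ^ 2 - 1 : ℝ) : ℂ) * Complex.I := by
    simp only [symb]; push_cast; ring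
  rw [this]; simp [-Complex.ofReal_sub, -Complex.ofReal_mul, -Complex.ofReal_pow]

theorem continuous_symb {n : ℕ} (ε : ℝ) : Continuous (symb (n := n) ε) := by
  unfold symb; fun_prop

theorem symb_ne_zero {n : ℕ} {ε : ℝ} (hε : 0 < ε) (z : Space n) : symb ε z ≠ 0 := by
  intro h
  have := symb_re ε z
  rw [h] at this
  simp at this
  linarith

theorem continuous_symb_cpow {n : ℕ} {ε : ℝ} (hε : 0 < ε) (s : ℂ) :
    Continuous fun z : Space n => symb ε z ^ s := by
  refine continuous_iff_continuousAt.2 fun z => ?_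
  exact ContinuousAt.cpow (continuous_symb ε).continuousAt continuousAt_const
    (Or.inl (by rw [symb_re]; exact hε))

theorem integral_swap_of_bounded_kernel {α β : Type*} [MeasurableSpace α] [MeasurableSpace β]
    {μ : Measure α} {ν : Measure β} [SFinite μ] [SFinite ν] {u : α → ℂ} {v : β → ℂ}
    (hu : Integrable u μ) (hv : Integrable v ν) {m : α × β → ℂ}
    (hm : AEStronglyMeasurable m (μ.prod ν)) (hm1 : ∀ q, ‖m q‖ ≤ 1) :
    ∫ x, ∫ y, u x * v y * m (x, y) ∂ν ∂μ = ∫ y, ∫ x, u x * v y * m (x, y) ∂μ ∂ν := by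
  refine integral_integral_swap (f := fun x y => u x * v y * m (x, y)) ?_
  exact (hu.mul_prod hv).mul_bdd hm (ae_of_all _ hm1)

theorem mul_ofReal_cpow_of_pos (c : ℂ) {t : ℝ} (ht : 0 < t) (s : ℂ) :
    (c * t) ^ s = c ^ s * (t : ℂ) ^ s := by
  rcases eq_or_ne c 0 with rfl | hc
  · rcases eq_or_ne s 0 with rfl | hs
    · simp
    · simp [hs]
  · have ht' : (t : ℂ) ≠ 0 := by exact_mod_cast ht.ne'
    rw [Complex.cpow_def_of_ne_zero (mul_ne_zero hc ht'), Complex.cpow_def_of_ne_zero hc,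
      Complex.cpow_def_of_ne_zero ht', ← Complex.exp_add, Complex.log_mul_ofReal t ht c hc,
      Complex.ofReal_log ht.le]
    congr 1; ring

/-- `Γ(s) symb^(-s)` is `∫ t^(s-1) exp(-t symb) dt`, and `exp(-t symb)` is `exp((i-ε)t)` times the
Schrödinger propagator at time `4π²t`. Its kernel contributes `t^(-n/2)`; the strict inequality for
`Re s` makes the resulting power integrable at `t = 0`. -/
theorem Gamma_mul_integral_symb_cpow_eq {n : ℕ} {f k : Space n → ℂ} (hf : Integrable f)
    (hf2 : MemLp f 2) (hk : Integrable k) (hk2 : MemLp k 2) {ε : ℝ} (hε : 0 < ε) {s : ℂ}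
    (hs : (n : ℝ) / 2 < s.re) :
    Complex.Gamma s * ∫ z, symb ε z ^ (-s) * (𝓕 f z * 𝓕⁻ k z) =
      (Real.pi / (Complex.I * (4 * Real.pi ^ 2))) ^ ((n : ℂ) / 2) *
        ∫ q : Space n × Space n, f q.1 * k q.2 *
          ∫ t in Set.Ioi (0 : ℝ), (t : ℂ) ^ (s - n / 2 - 1) * osc ε (‖q.1 - q.2‖ / 2) t := by
  have hs0 : 0 < s.re := lt_of_le_of_lt (by positivity) hs
  have hw : 0 < (s - n / 2).re := by
    have : (s - n / 2).re = s.re - n / 2 := by simp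
    rw [this]; linarith
  set P : Space n → ℂ := fun z => 𝓕 f z * 𝓕⁻ k z with hP
  have hPi : Integrable P := integrable_fourier_mul_fourierInv hf hf2 hk hk2
  have hεre : 0 < ((ε : ℂ) - Complex.I).re := by simpa using hε
  set κ : ℂ := (Real.pi / (Complex.I * (4 * Real.pi ^ 2))) ^ ((n : ℂ) / 2) with hκ
  -- represent the power as a superposition of propagators
  have e1 : Complex.Gamma s * ∫ z, symb ε z ^ (-s) * P z =
      ∫ z, ∫ t in Set.Ioi (0 : ℝ), P z * ((t : ℂ) ^ (s - 1) * Complex.exp (-((ε - Complex.I) * t))) *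
        Complex.exp (-(Complex.I * (4 * Real.pi ^ 2 * t : ℝ)) * ‖z‖ ^ 2) := by
    rw [← integral_const_mul]
    refine integral_congr_ae (ae_of_all _ fun z => ?_)
    simp only
    rw [← mul_assoc, ← integral_cpow_mul_exp_eq hs0 (by rw [symb_re]; exact hε), mul_comm,
      ← integral_const_mul]
    refine integral_congr_ae (ae_of_all _ fun t => ?_)
    simp only
    rw [mul_assoc (P z), mul_assoc ((t : ℂ) ^ (s - 1)), ← Complex.exp_add]
    congr 3
    simp only [symb]; push_cast; ring
  -- evaluate the propagators
  have e2 : ∀ t ∈ Set.Ioi (0 : ℝ), (∫ z, P z * ((t : ℂ) ^ (s - 1) *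
      Complex.exp (-((ε - Complex.I) * t))) *
        Complex.exp (-(Complex.I * (4 * Real.pi ^ 2 * t : ℝ)) * ‖z‖ ^ 2)) =
      κ * ∫ q : Space n × Space n, f q.1 * k q.2 *
        ((t : ℂ) ^ (s - n / 2 - 1) * Complex.exp (-((ε - Complex.I) * t))) *
        Complex.exp (Complex.I * ((‖q.1 - q.2‖ / 2 : ℝ) : ℂ) ^ 2 / t) := by
    intro t ht
    have ht0 : 0 < t := ht
    have ht' : (t : ℂ) ≠ 0 := by exact_mod_cast ht0.ne'
    have hpi := Real.pi_pos
    have hpi' : (Real.pi : ℂ) ≠ 0 := by exact_mod_cast hpi.ne'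
    have hS := integral_schrodinger_mul_fourier_mul_fourierInv hf hf2 hk hk2
      (τ := 4 * Real.pi ^ 2 * t) (by positivity)
    calc _ = ((t : ℂ) ^ (s - 1) * Complex.exp (-((ε - Complex.I) * t))) *
          ∫ z, Complex.exp (-(Complex.I * (4 * Real.pi ^ 2 * t : ℝ)) * ‖z‖ ^ 2) * P z := by
          rw [← integral_const_mul]
          refine integral_congr_ae (ae_of_all _ fun z => ?_)
          simp only; ring
      _ = _ := by
          rw [hS]
          have c1 : ((Real.pi : ℂ) / (Complex.I * (4 * Real.pi ^ 2 * t : ℝ))) ^ ((n : ℂ) / 2) =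
              κ * (t : ℂ) ^ (-((n : ℂ) / 2)) := by
            have : ((Real.pi : ℂ) / (Complex.I * (4 * Real.pi ^ 2 * t : ℝ))) =
                (Real.pi / (Complex.I * (4 * Real.pi ^ 2))) * ((t⁻¹ : ℝ) : ℂ) := by
              push_cast
              have := Complex.I_ne_zero
              field_simp
            rw [this, mul_ofReal_cpow_of_pos _ (inv_pos.2 ht0), ← hκ, Complex.ofReal_inv,
              Complex.inv_cpow _ _ (by rw [Complex.arg_ofReal_of_nonneg ht0.le]; exact hpi.ne),
              Complex.cpow_neg]
          have c2 : (t : ℂ) ^ (s - n / 2 - 1) = (t : ℂ) ^ (s - 1) * (t : ℂ) ^ (-((n : ℂ) / 2)) := by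
            rw [← Complex.cpow_add _ _ ht']; congr 1; ring
          have c3 : ∀ q : Space n × Space n,
              -(Real.pi : ℂ) ^ 2 * ‖q.1 - q.2‖ ^ 2 / (Complex.I * (4 * Real.pi ^ 2 * t : ℝ)) =
              Complex.I * ((‖q.1 - q.2‖ / 2 : ℝ) : ℂ) ^ 2 / t := by
            intro q
            push_cast
            have := Complex.I_ne_zero
            have h2 := Complex.I_sq
            field_simp
            rw [h2]; ring
          simp_rw [c3]
          rw [c1, c2, ← mul_assoc, ← integral_const_mul, ← integral_const_mul]
          refine integral_congr_ae (ae_of_all _ fun q => ?_)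
          simp only; ring
  have e3 : ∀ q : Space n × Space n, f q.1 * k q.2 *
      (∫ t in Set.Ioi (0 : ℝ), (t : ℂ) ^ (s - n / 2 - 1) * osc ε (‖q.1 - q.2‖ / 2) t) =
      ∫ t in Set.Ioi (0 : ℝ), f q.1 * k q.2 *
        ((t : ℂ) ^ (s - n / 2 - 1) * Complex.exp (-((ε - Complex.I) * t))) *
        Complex.exp (Complex.I * ((‖q.1 - q.2‖ / 2 : ℝ) : ℂ) ^ 2 / t) := by
    intro q
    rw [← integral_const_mul]
    refine integral_congr_ae (ae_of_all _ fun t => ?_)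
    simp only [osc]
    rw [mul_assoc (f q.1 * k q.2) (_ * _), mul_assoc ((t : ℂ) ^ (s - n / 2 - 1)), ← Complex.exp_add]
    congr 4
    ring
  simp_rw [e3]
  -- Both exchanges are Fubini for an integrable product times a unimodular oscillating factor: once
  -- in frequency, once in space.
  have sw1 := integral_swap_of_bounded_kernel hPi (integrableOn_cpow_mul_exp hs0 hεre)
    (m := fun q : Space n × ℝ => Complex.exp (-(Complex.I * (4 * Real.pi ^ 2 * q.2 : ℝ)) * ‖q.1‖ ^ 2))
    (Continuous.aestronglyMeasurable (by fun_prop)) (fun q => by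
      have : -(Complex.I * (4 * Real.pi ^ 2 * q.2 : ℝ)) * (‖q.1‖ : ℂ) ^ 2 =
          ((-(4 * Real.pi ^ 2 * q.2 * ‖q.1‖ ^ 2) : ℝ) : ℂ) * Complex.I := by push_cast; ring
      rw [this, Complex.norm_exp_ofReal_mul_I])
  have sw2 := integral_swap_of_bounded_kernel (hf.mul_prod hk) (integrableOn_cpow_mul_exp hw hεre)
    (m := fun q : (Space n × Space n) × ℝ =>
      Complex.exp (Complex.I * ((‖q.1.1 - q.1.2‖ / 2 : ℝ) : ℂ) ^ 2 / q.2))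
    (Measurable.aestronglyMeasurable (by fun_prop)) (fun q => by
      have : Complex.I * ((‖q.1.1 - q.1.2‖ / 2 : ℝ) : ℂ) ^ 2 / q.2 =
          (((‖q.1.1 - q.1.2‖ / 2) ^ 2 / q.2 : ℝ) : ℂ) * Complex.I := by push_cast; ring
      rw [this, Complex.norm_exp_ofReal_mul_I])
  rw [e1, sw1, setIntegral_congr_fun measurableSet_Ioi e2, integral_const_mul]
  exact congrArg (κ * ·) sw2.symm

theorem norm_Gamma_mul_integral_symb_cpow_le {n : ℕ} {f k : Space n → ℂ} (hf : Integrable f)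
    (hf2 : MemLp f 2) (hk : Integrable k) (hk2 : MemLp k 2) {ε : ℝ} (hε : 0 < ε) (hε1 : ε ≤ 1)
    {s : ℂ} (hs : (n : ℝ) / 2 < s.re) (hs' : s.re ≤ (n + 1 : ℝ) / 2) :
    ‖(s - n / 2) * (Complex.Gamma s * ∫ z, symb ε z ^ (-s) * (𝓕 f z * 𝓕⁻ k z))‖ ≤
      200 * (1 + ‖s - n / 2‖) ^ 2 * ((∫ x, ‖f x‖) * ∫ x, ‖k x‖) := by
  have hwre : (s - n / 2).re = s.re - n / 2 := by simp
  rw [Gamma_mul_integral_symb_cpow_eq hf hf2 hk hk2 hε hs, mul_left_comm, norm_mul,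
    ← integral_const_mul]
  -- The base has modulus `1/(4π) < 1` and the exponent is real and nonnegative.
  have hκ : ‖((Real.pi : ℂ) / (Complex.I * (4 * Real.pi ^ 2))) ^ ((n : ℂ) / 2)‖ ≤ 1 := by
    have h1 : ((n : ℂ) / 2) = ((n / 2 : ℝ) : ℂ) := by push_cast; rfl
    have hpi := Real.pi_gt_three
    have h0 : ((Real.pi : ℂ) / (Complex.I * (4 * Real.pi ^ 2))) ≠ 0 := by
      have hpi' : (Real.pi : ℂ) ≠ 0 := by exact_mod_cast Real.pi_pos.ne'
      exact div_ne_zero hpi' (mul_ne_zero Complex.I_ne_zero (mul_ne_zero (by norm_num)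
        (pow_ne_zero _ hpi')))
    rw [h1, Complex.norm_cpow_of_ne_zero h0]
    simp only [Complex.ofReal_re, Complex.ofReal_im, mul_zero, Real.exp_zero, div_one]
    refine Real.rpow_le_one (norm_nonneg _) ?_ (by positivity)
    rw [norm_div, norm_mul, Complex.norm_I, norm_mul, norm_pow, Complex.norm_real,
      Real.norm_of_nonneg Real.pi_pos.le, one_mul, Complex.norm_ofNat, div_le_one (by positivity)]
    nlinarith
  refine (mul_le_of_le_one_left (norm_nonneg _) hκ).trans ?_
  have hfk : Integrable (fun q : Space n × Space n => f q.1 * k q.2) volume := hf.mul_prod hk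
  have hprod : ∫ q : Space n × Space n, ‖f q.1 * k q.2‖ = (∫ x, ‖f x‖) * ∫ x, ‖k x‖ := by
    simp_rw [norm_mul]
    exact integral_prod_mul (fun x => ‖f x‖) (fun x => ‖k x‖)
  rw [← hprod, ← integral_const_mul]
  refine norm_integral_le_of_norm_le (hfk.norm.const_mul _) (ae_of_all _ fun q => ?_)
  rw [mul_left_comm, norm_mul, mul_comm]
  gcongr
  exact norm_mul_integral_Ioi_osc_le (by rw [hwre]; linarith) (by rw [hwre]; linarith) hε hε1
    (by positivity)

/-- The bilinear form of the Fourier multiplier `(ε + i (|ξ|² - 1))⁻ˢ`. -/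
def powForm {n : ℕ} (ε : ℝ) (s : ℂ) (f k : Space n → ℂ) : ℂ :=
  ∫ z, symb ε z ^ (-s) * (𝓕 f z * 𝓕⁻ k z)

theorem norm_symb_ge {n : ℕ} (ε : ℝ) (z : Space n) : ε ≤ ‖symb ε z‖ := by
  have := Complex.re_le_norm (symb ε z)
  rwa [symb_re] at this

/-- The modulus of `symb` is at least `ε` and its argument is at most `π`, so an imaginary exponent
costs at most `exp(π |Im s|)`. At `Re s = 0` the power of `ε` disappears, which makes the left edge
of the interpolation uniform. -/
theorem norm_symb_cpow_le {n : ℕ} {ε : ℝ} (hε : 0 < ε) {s : ℂ} (hs : 0 ≤ s.re) (z : Space n) :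
    ‖symb ε z ^ (-s)‖ ≤ ε ^ (-s.re) * Real.exp (Real.pi * |s.im|) := by
  rw [Complex.norm_cpow_of_ne_zero (symb_ne_zero hε z), div_eq_mul_inv, ← Real.exp_neg]
  refine mul_le_mul ?_ ?_ (Real.exp_pos _).le (Real.rpow_nonneg hε.le _)
  · rw [Complex.neg_re]
    exact Real.rpow_le_rpow_of_nonpos hε (norm_symb_ge ε z) (by linarith)
  · apply Real.exp_le_exp.2
    rw [Complex.neg_im, mul_neg, neg_neg]
    calc _ ≤ |(symb ε z).arg * s.im| := le_abs_self _
      _ = |(symb ε z).arg| * |s.im| := abs_mul _ _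
      _ ≤ _ := by gcongr; exact Complex.abs_arg_le_pi _

theorem integrable_symb_cpow_mul {n : ℕ} {ε : ℝ} (hε : 0 < ε) {s : ℂ} (hs : 0 ≤ s.re)
    {P : Space n → ℂ} (hP : Integrable P) : Integrable fun z => symb ε z ^ (-s) * P z :=
  hP.bdd_mul (continuous_symb_cpow hε _).aestronglyMeasurable
    (ae_of_all _ (norm_symb_cpow_le hε hs))

theorem norm_powForm_le {n : ℕ} {ε : ℝ} (hε : 0 < ε) {s : ℂ} (hs : 0 ≤ s.re)
    {f k : Space n → ℂ} (hf : Integrable f) (hf2 : MemLp f 2) (hk : Integrable k)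
    (hk2 : MemLp k 2) :
    ‖powForm ε s f k‖ ≤ ε ^ (-s.re) * Real.exp (Real.pi * |s.im|) *
      ((eLpNorm f 2 volume).toReal * (eLpNorm k 2 volume).toReal) := by
  have hP := integrable_fourier_mul_fourierInv hf hf2 hk hk2
  calc ‖powForm ε s f k‖ ≤ ∫ z, ε ^ (-s.re) * Real.exp (Real.pi * |s.im|) * ‖𝓕 f z * 𝓕⁻ k z‖ := by
        refine norm_integral_le_of_norm_le (hP.norm.const_mul _) (ae_of_all _ fun z => ?_)
        rw [norm_mul]
        gcongr
        exact norm_symb_cpow_le hε hs z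
    _ ≤ _ := by
        rw [integral_const_mul]
        gcongr
        exact integral_norm_fourier_mul_fourierInv_le hf hf2 hk hk2

theorem continuousOn_integral_symb_cpow {n : ℕ} {ε : ℝ} (hε : 0 < ε) (hε1 : ε ≤ 1)
    {P : Space n → ℂ} (hP : Integrable P) :
    ContinuousOn (fun s : ℂ => ∫ z, symb ε z ^ (-s) * P z) {s | 0 ≤ s.re} := by
  intro s₀ hs₀
  refine continuousWithinAt_of_dominated
    (bound := fun z => ε ^ (-(s₀.re + 1)) * Real.exp (Real.pi * (|s₀.im| + 1)) * ‖P z‖) ?_ ?_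
    (hP.norm.const_mul _) ?_
  · filter_upwards [self_mem_nhdsWithin] with s hs
    exact (integrable_symb_cpow_mul hε hs hP).1
  · have hball : ∀ᶠ s in 𝓝[{s : ℂ | 0 ≤ s.re}] s₀, s ∈ Metric.ball s₀ 1 :=
      nhdsWithin_le_nhds (Metric.ball_mem_nhds _ one_pos)
    filter_upwards [self_mem_nhdsWithin, hball] with s hs hs1
    refine ae_of_all _ fun z => ?_
    rw [norm_mul]
    gcongr
    refine (norm_symb_cpow_le hε hs z).trans ?_
    rw [Metric.mem_ball, dist_eq_norm] at hs1
    have h1 := (Complex.abs_re_le_norm (s - s₀)).trans hs1.le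
    have h2 := (Complex.abs_im_le_norm (s - s₀)).trans hs1.le
    rw [Complex.sub_re] at h1
    rw [Complex.sub_im] at h2
    have h3 := (abs_sub_abs_le_abs_sub s.im s₀.im).trans h2
    refine mul_le_mul ?_ ?_ (Real.exp_pos _).le (Real.rpow_nonneg hε.le _)
    · exact Real.rpow_le_rpow_of_exponent_ge hε hε1 (by linarith [le_abs_self (s.re - s₀.re)])
    · gcongr; linarith
  · refine ae_of_all _ fun z => ?_
    refine ContinuousWithinAt.mul ?_ continuousWithinAt_const
    exact ((continuousAt_const_cpow (symb_ne_zero hε z)).comp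
      continuous_neg.continuousAt).continuousWithinAt

theorem differentiableOn_integral_symb_cpow {n : ℕ} {ε : ℝ} (hε : 0 < ε) (hε1 : ε ≤ 1)
    {P : Space n → ℂ} (hP : Integrable P) :
    DifferentiableOn ℂ (fun s : ℂ => ∫ z, symb ε z ^ (-s) * P z) {s | 0 < s.re} := by
  intro s₀ hs₀
  have hs₀' : 0 < s₀.re := hs₀
  refine DifferentiableAt.differentiableWithinAt ?_
  set R := s₀.re / 2 with hR
  have hRpos : 0 < R := by linarith
  set M := ε ^ (-(s₀.re + 2 * R)) * Real.exp (Real.pi * (|s₀.im| + 2 * R)) with hM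
  have hder : ∀ (z : Space n) (s : ℂ), HasDerivAt (fun s : ℂ => symb ε z ^ (-s))
      (symb ε z ^ (-s) * Complex.log (symb ε z) * (-1)) s := by
    intro z s
    exact (hasDerivAt_neg s).const_cpow (Or.inl (symb_ne_zero hε z))
  have hbd : ∀ (z : Space n), ∀ s ∈ Metric.ball s₀ R,
      ‖symb ε z ^ (-s) * Complex.log (symb ε z) * (-1)‖ ≤ M / R := by
    intro z s hs
    rw [← (hder z s).deriv]
    -- Cauchy's estimate on a circle of radius `R` replaces a direct bound on the logarithm of the
    -- symbol, which is unbounded in `z`. The circle stays within `2R = Re s₀` of `s₀`, so real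
    -- parts remain nonnegative.
    refine Complex.norm_deriv_le_of_forall_mem_sphere_norm_le hRpos ?_ ?_
    · have : Differentiable ℂ (fun s : ℂ => symb ε z ^ (-s)) := fun s =>
        (hder z s).differentiableAt
      exact this.diffContOnCl
    · intro s' hs'
      have hd : ‖s' - s₀‖ ≤ 2 * R := by
        rw [← dist_eq_norm]
        have := dist_triangle s' s s₀
        rw [Metric.mem_sphere] at hs'
        rw [Metric.mem_ball] at hs
        linarith
      have h1 := (Complex.abs_re_le_norm (s' - s₀)).trans hd
      have h2 := (Complex.abs_im_le_norm (s' - s₀)).trans hd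
      rw [Complex.sub_re] at h1
      rw [Complex.sub_im] at h2
      have h3 := (abs_sub_abs_le_abs_sub s'.im s₀.im).trans h2
      have h4 : 0 ≤ s'.re := by linarith [neg_abs_le (s'.re - s₀.re)]
      refine (norm_symb_cpow_le hε h4 z).trans ?_
      refine mul_le_mul ?_ ?_ (Real.exp_pos _).le (Real.rpow_nonneg hε.le _)
      · exact Real.rpow_le_rpow_of_exponent_ge hε hε1 (by linarith [le_abs_self (s'.re - s₀.re)])
      · gcongr; linarith
  have hlog : Measurable fun z : Space n => Complex.log (symb ε z) :=
    (continuous_symb ε).measurable.clog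
  have key := hasDerivAt_integral_of_dominated_loc_of_deriv_le
    (F := fun (s : ℂ) (z : Space n) => symb ε z ^ (-s) * P z)
    (F' := fun (s : ℂ) (z : Space n) => symb ε z ^ (-s) * Complex.log (symb ε z) * (-1) * P z)
    (μ := volume) (x₀ := s₀) (s := Metric.ball s₀ R) (bound := fun z => M / R * ‖P z‖)
    (Metric.ball_mem_nhds _ hRpos) ?_ (integrable_symb_cpow_mul hε hs₀'.le hP) ?_ ?_
    (hP.norm.const_mul _) ?_
  · exact key.2.differentiableAt
  · refine Eventually.of_forall fun s => ?_
    exact (continuous_symb_cpow hε _).aestronglyMeasurable.mul hP.1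
  · exact ((((continuous_symb_cpow hε _).measurable.mul hlog).mul_const
      _).aestronglyMeasurable).mul hP.1
  · refine ae_of_all _ fun z s hs => ?_
    rw [norm_mul]
    gcongr
    exact hbd z s hs
  · exact ae_of_all _ fun z s _ => (hder z s).mul_const _

/-- The edge `Re s = n/2`, where the `t`-integral no longer converges absolutely, is reached by
continuity from the right. It is needed when `p` is the lower limit `2n/(n+4)`. -/
theorem norm_mul_Gamma_mul_powForm_le {n : ℕ} (hn : 0 < n) {f k : Space n → ℂ} (hf : Integrable f)
    (hf2 : MemLp f 2) (hk : Integrable k) (hk2 : MemLp k 2) {ε : ℝ} (hε : 0 < ε) (hε1 : ε ≤ 1)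
    {s : ℂ} (hs : (n : ℝ) / 2 ≤ s.re) (hs' : s.re ≤ (n + 1 : ℝ) / 2) :
    ‖(s - n / 2) * (Complex.Gamma s * powForm ε s f k)‖ ≤
      200 * (1 + ‖s - n / 2‖) ^ 2 * ((∫ x, ‖f x‖) * ∫ x, ‖k x‖) := by
  rcases hs.lt_or_eq with h | h
  · exact norm_Gamma_mul_integral_symb_cpow_le hf hf2 hk hk2 hε hε1 h hs'
  have hn' : (0 : ℝ) < n := by exact_mod_cast hn
  have hs0 : 0 < s.re := by rw [← h]; positivity
  have hseq : Tendsto (fun j : ℕ => s + ((1 / ((j : ℝ) + 1) : ℝ) : ℂ)) atTop (𝓝 s) := by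
    have : Tendsto (fun j : ℕ => ((1 / ((j : ℝ) + 1) : ℝ) : ℂ)) atTop (𝓝 ((0 : ℝ) : ℂ)) :=
      (Complex.continuous_ofReal.tendsto 0).comp tendsto_one_div_add_atTop_nhds_zero_nat
    have h := this.const_add s
    rwa [Complex.ofReal_zero, add_zero] at h
  have hcG : ContinuousAt Complex.Gamma s := by
    refine (Complex.differentiableAt_Gamma s fun m hm => ?_).continuousAt
    rw [hm] at hs0
    simp at hs0
    linarith [(Nat.cast_nonneg m : (0 : ℝ) ≤ m)]
  have hcF : ContinuousAt (fun s => powForm ε s f k) s :=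
    ((differentiableOn_integral_symb_cpow hε hε1
      (integrable_fourier_mul_fourierInv hf hf2 hk hk2)).differentiableAt
      ((isOpen_lt continuous_const Complex.continuous_re).mem_nhds hs0)).continuousAt
  have hcL : ContinuousAt (fun s : ℂ => ‖(s - n / 2) * (Complex.Gamma s * powForm ε s f k)‖) s :=
    ((continuousAt_id.sub continuousAt_const).mul (hcG.mul hcF)).norm
  have hcR : ContinuousAt (fun s : ℂ => 200 * (1 + ‖s - n / 2‖) ^ 2 *
      ((∫ x, ‖f x‖) * ∫ x, ‖k x‖)) s := by fun_prop
  refine le_of_tendsto_of_tendsto (hcL.tendsto.comp hseq) (hcR.tendsto.comp hseq) ?_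
  filter_upwards [eventually_ge_atTop 1] with j hj
  have hj' : (1 : ℝ) ≤ j := by exact_mod_cast hj
  have hre : (s + ((1 / ((j : ℝ) + 1) : ℝ) : ℂ)).re = n / 2 + 1 / ((j : ℝ) + 1) := by
    rw [Complex.add_re, Complex.ofReal_re, h]
  have hp : 0 < 1 / ((j : ℝ) + 1) := by positivity
  -- Starting at `j = 1` keeps the shifted point inside `Re s ≤ (n+1)/2`.
  have hp2 : 1 / ((j : ℝ) + 1) ≤ 1 / 2 := by
    apply one_div_le_one_div_of_le <;> linarith
  exact norm_Gamma_mul_integral_symb_cpow_le hf hf2 hk hk2 hε hε1 (by rw [hre]; linarith)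
    (by rw [hre]; linarith)

theorem norm_Gamma_le_Gamma_re {s : ℂ} (hs : 0 < s.re) : ‖Complex.Gamma s‖ ≤ Real.Gamma s.re := by
  rw [Complex.Gamma_eq_integral hs, Real.Gamma_eq_integral hs, Complex.GammaIntegral]
  refine norm_integral_le_of_norm_le (Real.GammaIntegral_convergent hs) ?_
  filter_upwards [ae_restrict_mem measurableSet_Ioi] with x hx
  rw [norm_mul, Complex.norm_cpow_eq_rpow_re_of_pos hx, Complex.norm_real,
    Real.norm_of_nonneg (Real.exp_pos _).le]
  simp

/-! ### Complex interpolation -/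

/-- The Gaussian decay of `exp(s²)` on vertical lines beats both the growth `exp(π |Im s|)` and the
polynomial factors. The constant comes from `8x - x² ≤ 16`, using `π ≤ 4`. -/
theorem one_add_pow_mul_exp_le {x : ℝ} (hx : 0 ≤ x) {j : ℕ} (hj : j ≤ 4) :
    (1 + x) ^ j * Real.exp (Real.pi * x - x ^ 2) ≤ Real.exp 16 := by
  have h1 : (1 + x) ^ j ≤ Real.exp (4 * x) := by
    calc (1 + x) ^ j ≤ (1 + x) ^ 4 := pow_le_pow_right₀ (by linarith) hj
      _ ≤ (Real.exp x) ^ 4 := by gcongr; linarith [Real.add_one_le_exp x]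
      _ = Real.exp (4 * x) := by rw [← Real.exp_nat_mul]; norm_num
  calc _ ≤ Real.exp (4 * x) * Real.exp (Real.pi * x - x ^ 2) := by gcongr
    _ = Real.exp (4 * x + (Real.pi * x - x ^ 2)) := (Real.exp_add _ _).symm
    _ ≤ _ := by
      apply Real.exp_le_exp.2
      nlinarith [Real.pi_le_four, sq_nonneg (x - 4), mul_le_mul_of_nonneg_right Real.pi_le_four hx]

/-- The analytic family `c ↦ |c|^α sgn c`. -/
def powMap (α c : ℂ) : ℂ := c * (‖c‖ : ℂ) ^ (α - 1)

theorem powMap_zero (α : ℂ) : powMap α 0 = 0 := by simp [powMap]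

theorem powMap_one (c : ℂ) : powMap 1 c = c := by simp [powMap]

theorem norm_powMap {α : ℂ} (hα : 0 < α.re) (c : ℂ) : ‖powMap α c‖ = ‖c‖ ^ α.re := by
  rcases eq_or_ne c 0 with rfl | hc
  · rw [powMap_zero, norm_zero, Real.zero_rpow hα.ne']
  · have hc' := norm_pos_iff.2 hc
    rw [powMap, norm_mul, Complex.norm_cpow_eq_rpow_re_of_pos hc', Complex.sub_re, Complex.one_re,
      Real.rpow_sub_one hc'.ne']
    field_simp

theorem differentiable_powMap (c : ℂ) : Differentiable ℂ fun α => powMap α c := by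
  rcases eq_or_ne c 0 with rfl | hc
  · simp only [powMap_zero]; exact differentiable_const _
  · have hc' : (‖c‖ : ℂ) ≠ 0 := by exact_mod_cast (norm_pos_iff.2 hc).ne'
    unfold powMap
    exact ((differentiable_id.sub_const 1).const_cpow (Or.inl hc')).const_mul c

/-- The indicator of a level set. -/
def levelInd {n : ℕ} (f : SimpleFunc (Space n) ℂ) (c : ℂ) : Space n → ℂ :=
  (f ⁻¹' {c}).indicator fun _ => 1

/-- A simple function has finitely many values, so the deformed functions in the interpolation are
finite sums of fixed indicators with entire coefficients. Dropping the value `0` leaves only level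
sets of finite measure. -/
theorem comp_eq_sum_levelInd {n : ℕ} (f : SimpleFunc (Space n) ℂ) {g : ℂ → ℂ} (hg : g 0 = 0) :
    (fun x => g (f x)) = fun x => ∑ c ∈ f.range.filter (· ≠ 0), g c * levelInd f c x := by
  funext x
  rcases eq_or_ne (f x) 0 with h | h
  · rw [h, hg, Finset.sum_eq_zero]
    intro c hc
    have : f x ≠ c := by rw [h]; exact (Finset.mem_filter.1 hc).2.symm
    simp [levelInd, this]
  · rw [Finset.sum_eq_single (f x)]
    · simp [levelInd]
    · intro c _ hc
      simp [levelInd, hc.symm]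
    · intro hx
      exact absurd (Finset.mem_filter.2 ⟨f.mem_range_self x, h⟩) hx

theorem memLp_levelInd {n : ℕ} {f : SimpleFunc (Space n) ℂ} (hf : f.FinMeasSupp volume) {c : ℂ}
    (hc : c ≠ 0) (p : ℝ≥0∞) : MemLp (levelInd f c) p volume :=
  memLp_indicator_const p (f.measurableSet_fiber c) 1
    (Or.inr (hf.meas_preimage_singleton_ne_zero hc).ne)

theorem integrable_levelInd {n : ℕ} {f : SimpleFunc (Space n) ℂ} (hf : f.FinMeasSupp volume) {c : ℂ}
    (hc : c ≠ 0) : Integrable (levelInd f c) := memLp_one_iff_integrable.1 (memLp_levelInd hf hc 1)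

theorem fourier_sum_mul {n : ℕ} {ι : Type*} (J : Finset ι) (a : ι → ℂ) {e : ι → Space n → ℂ}
    (he : ∀ c ∈ J, Integrable (e c)) (z : Space n) :
    𝓕 (fun x => ∑ c ∈ J, a c * e c x) z = ∑ c ∈ J, a c * 𝓕 (e c) z := by
  simp only [Real.fourier_eq, Finset.smul_sum]
  rw [integral_finsetSum]
  · refine Finset.sum_congr rfl fun c _ => ?_
    rw [← integral_const_mul]
    refine integral_congr_ae (ae_of_all _ fun x => ?_)
    simp only [Circle.smul_def, smul_eq_mul]; ring
  · intro c hc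
    exact (Real.fourierIntegral_convergent_iff z).2 ((he c hc).const_mul _)

theorem powForm_sum_mul {n : ℕ} {ε : ℝ} (hε : 0 < ε) {s : ℂ} (hs : 0 ≤ s.re) {ι : Type*}
    (J : Finset ι) (a b : ι → ℂ) {e : ι → Space n → ℂ} (he : ∀ c ∈ J, Integrable (e c))
    (he2 : ∀ c ∈ J, MemLp (e c) 2) :
    powForm ε s (fun x => ∑ c ∈ J, a c * e c x) (fun x => ∑ d ∈ J, b d * e d x) =
      ∑ c ∈ J, ∑ d ∈ J, a c * b d * powForm ε s (e c) (e d) := by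
  have hi : ∀ c ∈ J, ∀ d ∈ J, Integrable fun z =>
      a c * b d * (symb ε z ^ (-s) * (𝓕 (e c) z * 𝓕⁻ (e d) z)) := fun c hc d hd =>
    (integrable_symb_cpow_mul hε hs (integrable_fourier_mul_fourierInv (he c hc) (he2 c hc)
      (he d hd) (he2 d hd))).const_mul _
  simp only [powForm]
  calc _ = ∫ z, ∑ c ∈ J, ∑ d ∈ J, a c * b d * (symb ε z ^ (-s) * (𝓕 (e c) z * 𝓕⁻ (e d) z)) := by
        refine integral_congr_ae (ae_of_all _ fun z => ?_)
        simp only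
        rw [fourier_sum_mul J a he, Real.fourierInv_eq_fourier_neg, fourier_sum_mul J b he,
          Finset.sum_mul_sum, Finset.mul_sum]
        refine Finset.sum_congr rfl fun c _ => ?_
        rw [Finset.mul_sum]
        refine Finset.sum_congr rfl fun d _ => ?_
        rw [Real.fourierInv_eq_fourier_neg]; ring
    _ = _ := by
        rw [integral_finsetSum _ fun c hc => integrable_finsetSum _ fun d hd => hi c hc d hd]
        refine Finset.sum_congr rfl fun c hc => ?_
        rw [integral_finsetSum _ fun d hd => hi c hc d hd]
        refine Finset.sum_congr rfl fun d hd => ?_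
        rw [integral_const_mul]

theorem toReal_eLpNorm_two_eq {n : ℕ} {f : Space n → ℂ} (hf : MemLp f 2) :
    (eLpNorm f 2 volume).toReal = (∫ x, ‖f x‖ ^ 2) ^ (1 / 2 : ℝ) := by
  rw [hf.eLpNorm_eq_integral_rpow_norm (by norm_num) (by norm_num),
    ENNReal.toReal_ofReal (by positivity)]
  simp

/-- Stein interpolation between `L² → L²` on `Re s = 0` and `L¹ → L^∞` on `Re s = b`. -/
theorem exists_norm_powForm_two_le_of_simpleFunc {n : ℕ} (hn : 0 < n) {p b : ℝ} (hp1 : 1 < p)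
    (hp2 : p < 2) (hb : b = 2 * p / (2 - p)) (hbn : (n : ℝ) / 2 ≤ b) (hbn' : b ≤ (n + 1 : ℝ) / 2) :
    ∃ C : ℝ, 0 ≤ C ∧ ∀ ε : ℝ, 0 < ε → ε ≤ 1 → ∀ f : SimpleFunc (Space n) ℂ, f.FinMeasSupp volume →
      ‖powForm ε 2 f (fun x => starRingEnd ℂ (f x))‖ ≤ C * (∫ x, ‖f x‖ ^ p) ^ (2 / p) := by
  have h2p : 0 < 2 - p := by linarith
  have hb2 : 2 < b := by rw [hb, lt_div_iff₀ h2p]; linarith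
  have hb0 : 0 < b := by linarith
  have hbC : (b : ℂ) ≠ 0 := by exact_mod_cast hb0.ne'
  -- The real part of the exponent runs from `p/2` on the left edge, where `|f|^(p/2)` is in `L²`,
  -- to `p` on the right edge, where `|f|^p` is in `L¹`; the relation between `b` and `p` makes it
  -- `1` at `s = 2`.
  set α : ℂ → ℂ := fun s => ((p / 2 : ℝ) : ℂ) * (1 + s / b) with hα
  have hαre : ∀ s : ℂ, (α s).re = p / 2 * (1 + s.re / b) := by
    intro s
    simp only [hα]
    rw [Complex.re_ofReal_mul, Complex.add_re, Complex.one_re, Complex.div_ofReal_re]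
  have hα2 : α 2 = 1 := by
    have : p / 2 * (1 + 2 / b) = 1 := by rw [hb]; field_simp; ring
    simp only [hα]
    exact_mod_cast congrArg (fun x : ℝ => (x : ℂ)) this
  have hαdiff : Differentiable ℂ α := by
    simp only [hα]; fun_prop
  set C₀ : ℝ := (1 + b) * Real.exp 16 with hC₀
  set C₁ : ℝ := (1 + b) * (800 * (Real.exp (b ^ 2) * Real.exp 16)) with hC₁
  -- The three-lines theorem at `s = 2` has weight `2/b`; the denominator is the size of
  -- `Γ(s+1)(s-b)exp(s²)` there. Since `p > 1`, the point `2` lies strictly left of `b` and the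
  -- factor does not vanish.
  refine ⟨C₀ ^ (1 - 2 / b) * C₁ ^ (2 / b) / (2 * (b - 2) * Real.exp 4), ?_, ?_⟩
  · have : 0 < b - 2 := by linarith
    positivity
  intro ε hε hε1 f hf
  set N : ℝ := ∫ x, ‖f x‖ ^ p with hN
  have hN0 : 0 ≤ N := integral_nonneg fun x => by positivity
  set J := f.range.filter (· ≠ 0) with hJ
  have hJne : ∀ c ∈ J, c ≠ 0 := fun c hc => (Finset.mem_filter.1 hc).2
  have hE : ∀ c ∈ J, Integrable (levelInd f c) := fun c hc => integrable_levelInd hf (hJne c hc)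
  have hE2 : ∀ c ∈ J, MemLp (levelInd f c) 2 := fun c hc => memLp_levelInd hf (hJne c hc) 2
  -- The power is applied to the conjugate of `f`, not conjugated afterwards: conjugating afterwards
  -- would destroy holomorphy in `s`.
  set Φ : ℂ → ℂ := fun s => ∑ c ∈ J, ∑ d ∈ J, powMap (α s) c * powMap (α s) (starRingEnd ℂ d) *
    powForm ε s (levelInd f c) (levelInd f d) with hΦ
  have hΦeq : ∀ s : ℂ, 0 ≤ s.re → Φ s = powForm ε s (fun x => powMap (α s) (f x))
      (fun x => powMap (α s) (starRingEnd ℂ (f x))) := by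
    intro s hs
    rw [comp_eq_sum_levelInd f (g := fun c => powMap (α s) (starRingEnd ℂ c))
      (by simp [powMap_zero]), comp_eq_sum_levelInd f (powMap_zero (α s)),
      powForm_sum_mul hε hs _ _ _ hE hE2]
  have hexp : ∀ s : ℂ, ‖Complex.exp (s ^ 2)‖ = Real.exp (s.re ^ 2 - s.im ^ 2) := by
    intro s
    rw [Complex.norm_exp]
    congr 1
    simp [pow_two]
  have hsb : ∀ s : ℂ, 0 ≤ s.re → s.re ≤ b → ‖s - b‖ ≤ (1 + b) * (1 + |s.im|) := by
    intro s h0 h1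
    refine (Complex.norm_le_abs_re_add_abs_im _).trans ?_
    simp only [Complex.sub_re, Complex.ofReal_re, Complex.sub_im, Complex.ofReal_im, sub_zero]
    rw [abs_of_nonpos (by linarith)]
    nlinarith [abs_nonneg s.im]
  -- `Γ(s+1)` supplies the factor `Γ(s)` of the kernel estimate without its pole at `0`; `s - b`
  -- supplies the factor `s - n/2`, also when `b = n/2`; `exp(s²)` supplies decay in `Im s`.
  set F : ℂ → ℂ := fun s => Complex.Gamma (s + 1) * (s - b) * Complex.exp (s ^ 2) * Φ s with hF
  have hGdiff : ∀ s : ℂ, 0 ≤ s.re → DifferentiableAt ℂ (fun s => Complex.Gamma (s + 1)) s := by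
    intro s hs
    have : DifferentiableAt ℂ Complex.Gamma (s + 1) := by
      refine Complex.differentiableAt_Gamma _ fun m hm => ?_
      have := congrArg Complex.re hm
      simp at this
      linarith [(Nat.cast_nonneg m : (0 : ℝ) ≤ m)]
    exact this.comp s (differentiableAt_id.add_const 1)
  -- regularity of the family
  have hdiff : DifferentiableOn ℂ F {s | 0 < s.re} := by
    intro s hs
    have hs' : 0 < s.re := hs
    refine DifferentiableWithinAt.mul ?_ ?_
    · exact (((hGdiff s hs'.le).mul (by fun_prop)).mul (by fun_prop)).differentiableWithinAt
    · refine DifferentiableWithinAt.fun_sum fun c hc => DifferentiableWithinAt.fun_sum fun d hd => ?_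
      refine DifferentiableWithinAt.mul (DifferentiableAt.differentiableWithinAt ?_) ?_
      · exact ((differentiable_powMap c).comp hαdiff s).mul ((differentiable_powMap _).comp hαdiff s)
      · exact differentiableOn_integral_symb_cpow hε hε1 (integrable_fourier_mul_fourierInv
          (hE c hc) (hE2 c hc) (hE d hd) (hE2 d hd)) s hs
  have hcont : ContinuousOn F {s | 0 ≤ s.re} := by
    intro s hs
    refine ContinuousWithinAt.mul ?_ ?_
    · exact (((hGdiff s hs).mul (by fun_prop)).mul (by fun_prop)).continuousAt.continuousWithinAt
    · refine tendsto_finsetSum _ fun c hc => tendsto_finsetSum _ fun d hd => ?_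
      refine Tendsto.mul (ContinuousAt.continuousWithinAt ?_).tendsto ?_
      · exact (((differentiable_powMap c).comp hαdiff s).mul
          ((differentiable_powMap _).comp hαdiff s)).continuousAt
      · exact continuousOn_integral_symb_cpow hε hε1 (integrable_fourier_mul_fourierInv
          (hE c hc) (hE2 c hc) (hE d hd) (hE2 d hd)) s hs
  have hdc : DiffContOnCl ℂ F (Complex.HadamardThreeLines.verticalStrip 0 b) := by
    refine ⟨hdiff.mono fun s hs => hs.1, hcont.mono ?_⟩
    refine closure_minimal (fun s hs => le_of_lt hs.1) ?_
    exact isClosed_le continuous_const Complex.continuous_re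
  -- boundedness on the strip
  have hbdd : BddAbove ((norm ∘ F) '' Complex.HadamardThreeLines.verticalClosedStrip 0 b) := by
    obtain ⟨G, hG⟩ := (isCompact_Icc (a := (0 : ℝ)) (b := b)).exists_bound_of_continuousOn
      (f := fun x => Real.Gamma (x + 1)) (fun x hx => by
        have h1 : ContinuousAt Real.Gamma (x + 1) := by
          refine (Real.differentiableAt_Gamma fun m hm => ?_).continuousAt
          linarith [(Nat.cast_nonneg m : (0 : ℝ) ≤ m), hx.1]
        exact (ContinuousAt.comp (f := fun x : ℝ => x + 1) h1 (by fun_prop)).continuousWithinAt)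
    have hG0 : 0 ≤ G := (norm_nonneg _).trans (hG 0 ⟨le_rfl, hb0.le⟩)
    set S : ℝ := ∑ c ∈ J, ∑ d ∈ J, (1 + ‖c‖) ^ p * (1 + ‖d‖) ^ p *
      ((eLpNorm (levelInd f c) 2 volume).toReal * (eLpNorm (levelInd f d) 2 volume).toReal) with hS
    refine ⟨G * (1 + b) * Real.exp (b ^ 2) * ε ^ (-b) * S * Real.exp 16, ?_⟩
    rintro _ ⟨s, ⟨hs0, hsb'⟩, rfl⟩
    simp only [Function.comp]
    have hs0 : 0 ≤ s.re := hs0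
    have hsb' : s.re ≤ b := hsb'
    have hpow : ∀ c : ℂ, ‖powMap (α s) c‖ ≤ (1 + ‖c‖) ^ p := by
      intro c
      have hpos : 0 < (α s).re := by rw [hαre]; positivity
      have hle : (α s).re ≤ p := by
        rw [hαre]
        have : s.re / b ≤ 1 := by rw [div_le_one hb0]; exact hsb'
        nlinarith
      rw [norm_powMap hpos]
      calc ‖c‖ ^ (α s).re ≤ (1 + ‖c‖) ^ (α s).re :=
            Real.rpow_le_rpow (norm_nonneg _) (by linarith) hpos.le
        _ ≤ _ := Real.rpow_le_rpow_of_exponent_le (by linarith [norm_nonneg c]) hle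
    have hΦb : ‖Φ s‖ ≤ ε ^ (-b) * Real.exp (Real.pi * |s.im|) * S := by
      rw [hS, Finset.mul_sum]
      refine (norm_sum_le _ _).trans (Finset.sum_le_sum fun c hc => ?_)
      rw [Finset.mul_sum]
      refine (norm_sum_le _ _).trans (Finset.sum_le_sum fun d hd => ?_)
      rw [norm_mul, norm_mul]
      have h1 := hpow c
      have h2 := hpow (starRingEnd ℂ d)
      rw [RCLike.norm_conj] at h2
      have h3 := norm_powForm_le hε hs0 (hE c hc) (hE2 c hc) (hE d hd) (hE2 d hd)
      have h4 : ε ^ (-s.re) ≤ ε ^ (-b) :=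
        Real.rpow_le_rpow_of_exponent_ge hε hε1 (by linarith)
      calc _ ≤ (1 + ‖c‖) ^ p * (1 + ‖d‖) ^ p * (ε ^ (-b) * Real.exp (Real.pi * |s.im|) *
            ((eLpNorm (levelInd f c) 2 volume).toReal *
              (eLpNorm (levelInd f d) 2 volume).toReal)) := by
            gcongr
            exact h3.trans (by gcongr)
        _ = _ := by ring
    have hGb : ‖Complex.Gamma (s + 1)‖ ≤ G := by
      have hre : (s + 1).re = s.re + 1 := by simp
      refine (norm_Gamma_le_Gamma_re (by rw [hre]; linarith)).trans ?_
      rw [hre]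
      exact (le_abs_self _).trans (hG s.re ⟨hs0, hsb'⟩)
    have hS0 : 0 ≤ S := Finset.sum_nonneg fun c _ => Finset.sum_nonneg fun d _ => by positivity
    have hpe := one_add_pow_mul_exp_le (abs_nonneg s.im) (j := 1) (by norm_num)
    rw [pow_one, sq_abs] at hpe
    have hee : Real.exp (s.re ^ 2 - s.im ^ 2) ≤ Real.exp (b ^ 2) * Real.exp (-s.im ^ 2) := by
      rw [← Real.exp_add]
      apply Real.exp_le_exp.2
      nlinarith
    simp only [hF, norm_mul, hexp]
    calc _ ≤ G * ((1 + b) * (1 + |s.im|)) * (Real.exp (b ^ 2) * Real.exp (-s.im ^ 2)) *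
          (ε ^ (-b) * Real.exp (Real.pi * |s.im|) * S) := by
          gcongr
          exact hsb s hs0 hsb'
      _ = G * (1 + b) * Real.exp (b ^ 2) * ε ^ (-b) * S *
          ((1 + |s.im|) * (Real.exp (Real.pi * |s.im|) * Real.exp (-s.im ^ 2))) := by ring
      _ ≤ _ := by
          rw [← Real.exp_add, ← sub_eq_add_neg]
          gcongr
  have hmem : ∀ s : ℂ, 0 ≤ s.re → ∀ g : ℂ → ℂ, g 0 = 0 → ∀ q : ℝ≥0∞, q ≠ 0 → q ≠ ∞ →
      MemLp (fun x => powMap (α s) (g (f x))) q := by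
    intro s _ g hg q hq hq'
    exact (SimpleFunc.memLp_iff_finMeasSupp (f := f.map fun c => powMap (α s) (g c)) hq hq').2
      (hf.map (by simp [hg, powMap_zero]))
  -- the left edge
  have hleft : ∀ s ∈ Complex.re ⁻¹' {(0 : ℝ)}, ‖F s‖ ≤ C₀ * N := by
    intro s hs
    have hs : s.re = 0 := hs
    have hre : (α s).re = p / 2 := by rw [hαre, hs]; ring
    have hpos : 0 < (α s).re := by rw [hre]; linarith
    have m1 := hmem s hs.ge id rfl 1 (by norm_num) (by norm_num)
    have m2 := hmem s hs.ge id rfl 2 (by norm_num) (by norm_num)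
    have m3 := hmem s hs.ge (starRingEnd ℂ) (by simp) 1 (by norm_num) (by norm_num)
    have m4 := hmem s hs.ge (starRingEnd ℂ) (by simp) 2 (by norm_num) (by norm_num)
    have hb := norm_powForm_le hε hs.ge (memLp_one_iff_integrable.1 m1) m2
      (memLp_one_iff_integrable.1 m3) m4
    simp only [id] at hb
    have hsq : ∀ c : ℂ, ‖powMap (α s) c‖ ^ 2 = ‖c‖ ^ p := by
      intro c
      rw [norm_powMap hpos, hre, ← Real.rpow_natCast, ← Real.rpow_mul (norm_nonneg _)]
      congr 1; push_cast; ring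
    simp only [id] at m2
    rw [toReal_eLpNorm_two_eq m2, toReal_eLpNorm_two_eq m4] at hb
    simp only [hsq, RCLike.norm_conj] at hb
    rw [← hN, ← Real.rpow_add_of_nonneg hN0 (by norm_num) (by norm_num), hs, neg_zero,
      Real.rpow_zero, one_mul] at hb
    norm_num at hb
    have hG1 : ‖Complex.Gamma (s + 1)‖ ≤ 1 := by
      have hre : (s + 1).re = 1 := by simp [hs]
      have := norm_Gamma_le_Gamma_re (s := s + 1) (by rw [hre]; norm_num)
      rwa [hre, Real.Gamma_one] at this
    have hpe := one_add_pow_mul_exp_le (abs_nonneg s.im) (j := 1) (by norm_num)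
    rw [pow_one, sq_abs] at hpe
    simp only [hF, norm_mul, hexp]
    rw [hΦeq s hs.ge]
    calc _ ≤ 1 * ((1 + b) * (1 + |s.im|)) * Real.exp (s.re ^ 2 - s.im ^ 2) *
          (Real.exp (Real.pi * |s.im|) * N) := by
          gcongr
          exact hsb s hs.ge (by linarith)
      _ = (1 + b) * ((1 + |s.im|) * (Real.exp (Real.pi * |s.im|) *
          Real.exp (s.re ^ 2 - s.im ^ 2))) * N := by ring
      _ ≤ C₀ * N := by
          rw [hC₀, ← Real.exp_add, hs, show Real.pi * |s.im| + ((0 : ℝ) ^ 2 - s.im ^ 2) =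
            Real.pi * |s.im| - s.im ^ 2 by ring]
          gcongr
  -- the right edge
  have hright : ∀ s ∈ Complex.re ⁻¹' {b}, ‖F s‖ ≤ C₁ * N ^ 2 := by
    intro s hs
    have hs : s.re = b := hs
    have hs0 : 0 ≤ s.re := by rw [hs]; exact hb0.le
    have hre : (α s).re = p := by rw [hαre, hs]; field_simp; ring
    have hpos : 0 < (α s).re := by rw [hre]; linarith
    have m1 := hmem s hs0 id rfl 1 (by norm_num) (by norm_num)
    have m2 := hmem s hs0 id rfl 2 (by norm_num) (by norm_num)
    have m3 := hmem s hs0 (starRingEnd ℂ) (by simp) 1 (by norm_num) (by norm_num)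
    have m4 := hmem s hs0 (starRingEnd ℂ) (by simp) 2 (by norm_num) (by norm_num)
    have hb := norm_mul_Gamma_mul_powForm_le hn (memLp_one_iff_integrable.1 m1) m2
      (memLp_one_iff_integrable.1 m3) m4 hε hε1 (s := s) (by rw [hs]; exact hbn)
      (by rw [hs]; exact hbn')
    simp only [norm_powMap hpos, hre, id, RCLike.norm_conj] at hb
    rw [← hN, ← pow_two] at hb
    have hsne : s ≠ 0 := by
      rintro rfl
      simp at hs; linarith
    -- On the right edge `s - b` is purely imaginary and has the same imaginary part as `s - n/2`.
    have him : ‖s - b‖ ≤ ‖s - n / 2‖ := by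
      have e1 : s - b = (s.im : ℂ) * Complex.I := by
        apply Complex.ext <;> simp [hs]
      rw [e1, norm_mul, Complex.norm_I, mul_one, Complex.norm_real, Real.norm_eq_abs]
      have := Complex.abs_im_le_norm (s - n / 2)
      simpa using this
    have hw : 1 + ‖s - n / 2‖ ≤ 2 * (1 + |s.im|) := by
      have := Complex.norm_le_abs_re_add_abs_im (s - n / 2)
      have e1 : (s - n / 2).re = b - n / 2 := by simp [hs]
      have e2 : (s - n / 2).im = s.im := by simp
      rw [e1, e2, abs_of_nonneg (by linarith)] at this
      linarith [abs_nonneg s.im]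
    have hsn : ‖s‖ ≤ (1 + b) * (1 + |s.im|) := by
      refine (Complex.norm_le_abs_re_add_abs_im _).trans ?_
      rw [hs, abs_of_pos hb0]
      nlinarith [abs_nonneg s.im]
    have hpe := one_add_pow_mul_exp_le (abs_nonneg s.im) (j := 3) (by norm_num)
    rw [sq_abs] at hpe
    rw [norm_mul] at hb
    simp only [hF, norm_mul, hexp]
    rw [hΦeq s hs0, Complex.Gamma_add_one s hsne, norm_mul]
    calc _ = ‖s‖ * Real.exp (s.re ^ 2 - s.im ^ 2) * (‖s - b‖ * ‖Complex.Gamma s *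
          powForm ε s (fun x => powMap (α s) (f x))
            (fun x => powMap (α s) (starRingEnd ℂ (f x)))‖) := by rw [norm_mul]; ring
      _ ≤ (1 + b) * (1 + |s.im|) * Real.exp (s.re ^ 2 - s.im ^ 2) *
          (200 * (2 * (1 + |s.im|)) ^ 2 * N ^ 2) := by
          refine mul_le_mul (mul_le_mul_of_nonneg_right hsn (Real.exp_pos _).le) ?_
            (by positivity) (by positivity)
          refine (mul_le_mul_of_nonneg_right him (norm_nonneg _)).trans (hb.trans ?_)
          gcongr
      _ = (1 + b) * (800 * ((1 + |s.im|) ^ 3 * Real.exp (s.re ^ 2 - s.im ^ 2))) * N ^ 2 := by ring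
      _ ≤ C₁ * N ^ 2 := by
          rw [hC₁, hs]
          refine mul_le_mul_of_nonneg_right (mul_le_mul_of_nonneg_left
            (mul_le_mul_of_nonneg_left ?_ (by norm_num)) (by positivity)) (by positivity)
          have : (1 + |s.im|) ^ 3 * Real.exp (b ^ 2 - s.im ^ 2) =
              Real.exp (b ^ 2) * ((1 + |s.im|) ^ 3 * Real.exp (-s.im ^ 2)) := by
            rw [sub_eq_add_neg, Real.exp_add]; ring
          rw [this]
          refine mul_le_mul_of_nonneg_left (le_trans ?_ hpe) (Real.exp_pos _).le
          gcongr
          have : 0 ≤ Real.pi * |s.im| := by positivity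
          linarith
  have h2mem : (2 : ℂ) ∈ Complex.HadamardThreeLines.verticalClosedStrip 0 b := by
    simp only [Complex.HadamardThreeLines.verticalClosedStrip, Set.mem_preimage, Set.mem_Icc]
    norm_num
    exact hb2.le
  have key := Complex.HadamardThreeLines.norm_le_interp_of_mem_verticalClosedStrip' hb0 h2mem hdc
    hbdd hleft hright
  have e2 : (2 : ℂ).re = 2 := by norm_num
  rw [e2, sub_zero, sub_zero] at key
  have hC₀0 : 0 ≤ C₀ := by positivity
  have hC₁0 : 0 ≤ C₁ := by positivity
  -- The edges scale like `N` and `N²`; interpolation gives the exponent `1 + 2/b = 2/p`.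
  have hNpow : N ^ (1 - 2 / b) * (N ^ 2) ^ (2 / b) = N ^ (2 / p) := by
    have h1 : (N ^ 2) ^ (2 / b) = N ^ (4 / b) := by
      rw [← Real.rpow_natCast, ← Real.rpow_mul hN0]
      congr 1; push_cast; ring
    have h2 : 1 - 2 / b + 4 / b = 2 / p := by rw [hb]; field_simp; ring
    rw [h1, ← Real.rpow_add' hN0 (by rw [h2]; positivity), h2]
  rw [Real.mul_rpow hC₀0 hN0, Real.mul_rpow hC₁0 (by positivity), mul_mul_mul_comm, hNpow] at key
  have hF2 : ‖F 2‖ = 2 * (b - 2) * Real.exp 4 *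
      ‖powForm ε 2 f (fun x => starRingEnd ℂ (f x))‖ := by
    simp only [hF, norm_mul]
    rw [hΦeq 2 (by norm_num), hα2]
    simp only [powMap_one]
    have g3 : Complex.Gamma (2 + 1) = 2 := by
      have := Complex.Gamma_nat_eq_factorial 2
      simpa using this
    have g4 : ‖(2 : ℂ) - b‖ = b - 2 := by
      have : (2 : ℂ) - b = ((2 - b : ℝ) : ℂ) := by push_cast; rfl
      rw [this, Complex.norm_real, Real.norm_eq_abs, abs_of_neg (by linarith)]; ring
    have g5 : ‖Complex.exp ((2 : ℂ) ^ 2)‖ = Real.exp 4 := by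
      rw [hexp]; norm_num
    rw [g3, g4, g5]
    norm_num
  rw [hF2] at key
  have hpos : 0 < 2 * (b - 2) * Real.exp 4 := by
    have : 0 < b - 2 := by linarith
    positivity
  rw [div_mul_eq_mul_div, le_div_iff₀ hpos, mul_comm]
  exact key

/-! ### The resolvent-square form on Schwartz functions -/

theorem fourierInv_conj {n : ℕ} (f : Space n → ℂ) (z : Space n) :
    𝓕⁻ (fun x => starRingEnd ℂ (f x)) z = starRingEnd ℂ (𝓕 f z) := by
  rw [Real.fourierInv_eq', Real.fourier_eq', ← integral_conj]
  refine integral_congr_ae (ae_of_all _ fun x => ?_)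
  simp only [smul_eq_mul, map_mul, ← Complex.exp_conj, Complex.conj_ofReal, Complex.conj_I]
  congr 2
  push_cast
  ring

theorem fourier_sub_apply {n : ℕ} {f g : Space n → ℂ} (hf : Integrable f) (hg : Integrable g)
    (z : Space n) : 𝓕 (f - g) z = 𝓕 f z - 𝓕 g z := by
  simp only [Real.fourier_eq]
  rw [← integral_sub ((Real.fourierIntegral_convergent_iff z).2 hf)
    ((Real.fourierIntegral_convergent_iff z).2 hg)]
  simp only [Pi.sub_apply, smul_sub]

theorem memLp_conj {n : ℕ} {f : Space n → ℂ} {q : ℝ≥0∞} (hf : MemLp f q) :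
    MemLp (fun x => starRingEnd ℂ (f x)) q :=
  hf.star

theorem eLpNorm_conj {n : ℕ} (f : Space n → ℂ) (q : ℝ≥0∞) :
    eLpNorm (fun x => starRingEnd ℂ (f x)) q volume = eLpNorm f q volume :=
  eLpNorm_congr_norm_ae (ae_of_all _ fun _ => RCLike.norm_conj _)

/-- For fixed `ε` the form is continuous in `L²`. The constant blows up as `ε → 0`, but it only
serves to pass from simple functions to Schwartz functions at that `ε`, after which it disappears.
-/
theorem norm_powForm_conj_sub_le {n : ℕ} {ε : ℝ} (hε : 0 < ε) {f g : Space n → ℂ}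
    (hf : Integrable f) (hf2 : MemLp f 2) (hg : Integrable g) (hg2 : MemLp g 2) :
    ‖powForm ε 2 f (fun x => starRingEnd ℂ (f x)) - powForm ε 2 g (fun x => starRingEnd ℂ (g x))‖ ≤
      ε ^ (-2 : ℝ) * ((eLpNorm (f - g) 2 volume).toReal *
        ((eLpNorm f 2 volume).toReal + (eLpNorm g 2 volume).toReal)) := by
  have hcf := memLp_one_iff_integrable.1 (memLp_conj (memLp_one_iff_integrable.2 hf))
  have hcg := memLp_one_iff_integrable.1 (memLp_conj (memLp_one_iff_integrable.2 hg))
  have hd := hf.sub hg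
  have hd2 := hf2.sub hg2
  have hcd := memLp_one_iff_integrable.1 (memLp_conj (memLp_one_iff_integrable.2 hd))
  have h2 : (0 : ℝ) ≤ (2 : ℂ).re := by norm_num
  have key : powForm ε 2 f (fun x => starRingEnd ℂ (f x)) -
      powForm ε 2 g (fun x => starRingEnd ℂ (g x)) =
      powForm ε 2 (f - g) (fun x => starRingEnd ℂ (f x)) +
        powForm ε 2 g (fun x => starRingEnd ℂ ((f - g) x)) := by
    unfold powForm
    rw [← integral_sub
      (integrable_symb_cpow_mul hε h2 (integrable_fourier_mul_fourierInv hf hf2 hcf (memLp_conj hf2)))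
      (integrable_symb_cpow_mul hε h2 (integrable_fourier_mul_fourierInv hg hg2 hcg (memLp_conj hg2))),
      ← integral_add
      (integrable_symb_cpow_mul hε h2 (integrable_fourier_mul_fourierInv hd hd2 hcf (memLp_conj hf2)))
      (integrable_symb_cpow_mul hε h2 (integrable_fourier_mul_fourierInv hg hg2 hcd (memLp_conj hd2)))]
    refine integral_congr_ae (ae_of_all _ fun z => ?_)
    simp only [fourierInv_conj, fourier_sub_apply hf hg, map_sub]
    ring
  have h1 := norm_powForm_le hε h2 hd hd2 hcf (memLp_conj hf2)
  have h3 := norm_powForm_le hε h2 hg hg2 hcd (memLp_conj hd2)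
  rw [eLpNorm_conj] at h1 h3
  rw [Complex.re_ofNat, Complex.im_ofNat, abs_zero, mul_zero, Real.exp_zero, mul_one] at h1 h3
  rw [key]
  refine (norm_add_le _ _).trans ((add_le_add h1 h3).trans (le_of_eq ?_))
  ring

theorem rpow_integral_norm_rpow_eq {n : ℕ} {p : ℝ} (hp : 0 < p) {f : Space n → ℂ}
    (hf : MemLp f (ENNReal.ofReal p)) :
    (∫ x, ‖f x‖ ^ p) ^ (2 / p) = (eLpNorm f (ENNReal.ofReal p) volume).toReal ^ 2 := by
  have h0 : 0 ≤ ∫ x, ‖f x‖ ^ p := integral_nonneg fun x => by positivity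
  rw [hf.eLpNorm_eq_integral_rpow_norm (by simpa using hp) (by simp),
    ENNReal.toReal_ofReal hp.le, ENNReal.toReal_ofReal (by positivity), ← Real.rpow_natCast,
    ← Real.rpow_mul h0]
  congr 1
  push_cast
  ring

theorem toReal_eLpNorm_le_sub_add {n : ℕ} {f g : Space n → ℂ} {q : ℝ≥0∞} (hq : 1 ≤ q)
    (hf : MemLp f q) (hg : MemLp g q) :
    (eLpNorm f q volume).toReal ≤
      (eLpNorm (f - g) q volume).toReal + (eLpNorm g q volume).toReal := by
  have h := eLpNorm_add_le (hf.sub hg).1 hg.1 hq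
  rw [sub_add_cancel] at h
  rw [← ENNReal.toReal_add (hf.sub hg).2.ne hg.2.ne]
  exact ENNReal.toReal_mono (ENNReal.add_ne_top.2 ⟨(hf.sub hg).2.ne, hg.2.ne⟩) h

theorem exists_norm_powForm_two_le_of_one_lt {n : ℕ} (hn : 0 < n) {p b : ℝ} (hp1 : 1 < p)
    (hp2 : p < 2) (hb : b = 2 * p / (2 - p)) (hbn : (n : ℝ) / 2 ≤ b) (hbn' : b ≤ (n + 1 : ℝ) / 2) :
    ∃ C : ℝ, 0 ≤ C ∧ ∀ ε : ℝ, 0 < ε → ε ≤ 1 → ∀ φ : 𝓢(Space n, ℂ),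
      ‖powForm ε 2 φ (fun x => starRingEnd ℂ (φ x))‖ ≤
        C * (eLpNorm φ (ENNReal.ofReal p) volume).toReal ^ 2 := by
  obtain ⟨C, hC, H⟩ := exists_norm_powForm_two_le_of_simpleFunc hn hp1 hp2 hb hbn hbn'
  refine ⟨C, hC, fun ε hε hε1 φ => ?_⟩
  have hp0 : 0 < p := by linarith
  set P := ENNReal.ofReal p with hP
  have hP1 : 1 ≤ P := by rw [hP]; exact ENNReal.one_le_ofReal.2 hp1.le
  have hP0 : P ≠ 0 := by positivity
  have hPt : P ≠ ∞ := by simp [hP]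
  have hm : ∀ q : ℝ≥0∞, MemLp φ q (volume : Measure (Space n)) := fun q => φ.memLp q volume
  have hmeas : Measurable φ := φ.continuous.measurable
  -- The same approximants converge in `L^p` and in `L²`: the first limit keeps the uniform bound,
  -- the second identifies the form.
  set F : ℕ → SimpleFunc (Space n) ℂ := fun j =>
    SimpleFunc.approxOn φ hmeas (Set.range φ ∪ {0}) 0 (by simp) j with hF
  have hFm : ∀ j (q : ℝ≥0∞), MemLp (F j) q (volume : Measure (Space n)) := fun j q =>
    SimpleFunc.memLp_approxOn_range hmeas (hm q) j
  have hlim : ∀ q : ℝ≥0∞, q ≠ ∞ →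
      Tendsto (fun j => (eLpNorm (⇑(F j) - ⇑φ) q volume).toReal) atTop (𝓝 0) := fun q hq => by
    have := SimpleFunc.tendsto_approxOn_range_Lp_eLpNorm hq hmeas (hm q).2
    exact (ENNReal.tendsto_toReal ENNReal.zero_ne_top).comp this
  have hφ1 := memLp_one_iff_integrable.1 (hm 1)
  have hbound : ∀ j, ‖powForm ε 2 φ (fun x => starRingEnd ℂ (φ x))‖ ≤
      C * ((eLpNorm (⇑(F j) - ⇑φ) P volume).toReal + (eLpNorm φ P volume).toReal) ^ 2 +
      ε ^ (-2 : ℝ) * ((eLpNorm (⇑(F j) - ⇑φ) 2 volume).toReal *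
        (((eLpNorm (⇑(F j) - ⇑φ) 2 volume).toReal + (eLpNorm φ 2 volume).toReal)
          + (eLpNorm φ 2 volume).toReal)) := by
    intro j
    have hFj1 := memLp_one_iff_integrable.1 (hFm j 1)
    have h1 := H ε hε hε1 (F j)
      ((SimpleFunc.memLp_iff_finMeasSupp (by norm_num) (by norm_num)).1 (hFm j 2))
    rw [rpow_integral_norm_rpow_eq hp0 (hFm j P)] at h1
    have h2 := norm_powForm_conj_sub_le hε hFj1 (hFm j 2) hφ1 (hm 2)
    have h3 := toReal_eLpNorm_le_sub_add hP1 (hFm j P) (hm P)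
    have h4 := toReal_eLpNorm_le_sub_add (by norm_num) (hFm j 2) (hm 2)
    have h5 := norm_le_norm_add_norm_sub'
      (powForm ε 2 φ (fun x => starRingEnd ℂ (φ x)))
      (powForm ε 2 (F j) (fun x => starRingEnd ℂ (F j x)))
    rw [norm_sub_rev] at h5
    refine h5.trans (add_le_add (h1.trans ?_) (h2.trans ?_)) <;> gcongr
  have hT : Tendsto (fun j =>
      C * ((eLpNorm (⇑(F j) - ⇑φ) P volume).toReal + (eLpNorm φ P volume).toReal) ^ 2 +
      ε ^ (-2 : ℝ) * ((eLpNorm (⇑(F j) - ⇑φ) 2 volume).toReal *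
        (((eLpNorm (⇑(F j) - ⇑φ) 2 volume).toReal + (eLpNorm φ 2 volume).toReal)
          + (eLpNorm φ 2 volume).toReal))) atTop
      (𝓝 (C * (0 + (eLpNorm φ P volume).toReal) ^ 2 + ε ^ (-2 : ℝ) * (0 *
        ((0 + (eLpNorm φ 2 volume).toReal) + (eLpNorm φ 2 volume).toReal)))) := by
    have a := hlim P hPt
    have c := hlim 2 (by norm_num)
    exact (((a.add_const _).pow 2).const_mul C).add
      ((c.mul ((c.add_const _).add_const _)).const_mul _)
  have := ge_of_tendsto' hT hbound
  simpa using this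

/-- The lower and upper limits on `p` become `n/2 ≤ b` and `b ≤ (n+1)/2`. At `p = 1` one has `b =
2`, so `s = 2` sits on the right edge and the kernel bound is used directly, without interpolation.
-/
theorem exists_norm_powForm_two_le {n : ℕ} (hn : 3 ≤ n) {p : ℝ} (hp1 : 1 ≤ p)
    (hpl : 2 * n / (n + 4) ≤ p) (hpu : p ≤ (2 * n + 2) / (n + 5)) (hnp : ¬ (n = 4 ∧ p = 1)) :
    ∃ C : ℝ, 0 ≤ C ∧ ∀ ε : ℝ, 0 < ε → ε ≤ 1 → ∀ φ : 𝓢(Space n, ℂ),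
      ‖powForm ε 2 φ (fun x => starRingEnd ℂ (φ x))‖ ≤
        C * (eLpNorm φ (ENNReal.ofReal p) volume).toReal ^ 2 := by
  have hn' : (3 : ℝ) ≤ n := by exact_mod_cast hn
  rw [div_le_iff₀ (by linarith)] at hpl
  rw [le_div_iff₀ (by linarith)] at hpu
  have hp2 : p < 2 := by nlinarith
  have hbn : (n : ℝ) / 2 ≤ 2 * p / (2 - p) := by
    rw [le_div_iff₀ (by linarith)]; nlinarith
  have hbn' : 2 * p / (2 - p) ≤ (n + 1 : ℝ) / 2 := by
    rw [div_le_iff₀ (by linarith)]; nlinarith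
  rcases hp1.lt_or_eq with h | rfl
  · exact exists_norm_powForm_two_le_of_one_lt (by omega) h hp2 rfl hbn hbn'
  -- At `p = 1` the lower limit forces `n ≤ 4`. For `n = 4` the kernel bound carries the factor `s -
  -- n/2 = 0` and says nothing; for `n = 3` that factor is `1/2`, which accounts for the `2` in the
  -- constant.
  have hn3 : n = 3 := by
    have : n ≤ 4 := by
      have : (n : ℝ) ≤ 4 := by linarith
      exact_mod_cast this
    have h4 : n ≠ 4 := fun h => hnp ⟨h, rfl⟩
    omega
  subst hn3
  refine ⟨2 * (200 * (1 + 1 / 2) ^ 2), by norm_num, fun ε hε hε1 φ => ?_⟩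
  have h1 : MemLp φ 1 (volume : Measure (Space 3)) := φ.memLp 1 volume
  have h2 : MemLp φ 2 (volume : Measure (Space 3)) := φ.memLp 2 volume
  have := norm_mul_Gamma_mul_powForm_le (by norm_num : 0 < 3) (memLp_one_iff_integrable.1 h1) h2
    (memLp_one_iff_integrable.1 (memLp_conj h1)) (memLp_conj h2) hε hε1 (s := 2)
    (by norm_num) (by norm_num)
  have e1 : (eLpNorm φ (ENNReal.ofReal 1) (volume : Measure (Space 3))).toReal = ∫ x, ‖φ x‖ := by
    rw [ENNReal.ofReal_one, eLpNorm_one_eq_lintegral_enorm,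
      integral_norm_eq_lintegral_enorm h1.1]
  have e2 : ‖(2 : ℂ) - (3 : ℕ) / 2‖ = 1 / 2 := by norm_num
  have e3 : Complex.Gamma 2 = 1 := by norm_num
  rw [norm_mul, e2, e3, one_mul] at this
  simp only [RCLike.norm_conj] at this
  rw [e1]
  linarith

theorem powForm_conj_eq {n : ℕ} (ε : ℝ) (φ : 𝓢(Space n, ℂ)) :
    powForm ε 2 φ (fun x => starRingEnd ℂ (φ x)) =
      ∫ z, (symb ε z ^ 2)⁻¹ * ((‖𝓕 φ z‖ ^ 2 : ℝ) : ℂ) := by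
  unfold powForm
  refine integral_congr_ae (ae_of_all _ fun z => ?_)
  simp only [fourierInv_conj]
  rw [Complex.mul_conj, Complex.normSq_eq_norm_sq, Complex.cpow_neg, SchwartzMap.fourier_coe]
  norm_num

/-! ### Polar coordinates and the limit of the Poisson kernel on the sphere -/

theorem integral_polar {n : ℕ} (hn : 0 < n) {F : Space n → ℝ} (hF : Integrable F) :
    Integrable (fun ω : UnitSphere n => ∫ r in Set.Ioi (0 : ℝ), r ^ (n - 1) * F (r • (ω : Space n)))
      (surfaceMeasure n) ∧
    ∫ z, F z = ∫ ω : UnitSphere n, (∫ r in Set.Ioi (0 : ℝ), r ^ (n - 1) * F (r • (ω : Space n)))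
      ∂surfaceMeasure n := by
  have : Nonempty (Fin n) := ⟨⟨0, hn⟩⟩
  have hdim : Module.finrank ℝ (Space n) = n := by simp
  set μ : Measure (Space n) := volume
  have hmp := μ.measurePreserving_homeomorphUnitSphereProd
  rw [hdim] at hmp
  have hemb := (homeomorphUnitSphereProd (Space n)).measurableEmbedding
  set H : UnitSphere n × Set.Ioi (0 : ℝ) → ℝ := fun q => F ((q.2 : ℝ) • (q.1 : Space n)) with hH
  have hcomp : ∀ x : ({0}ᶜ : Set (Space n)), H (homeomorphUnitSphereProd (Space n) x) = F x := by
    intro x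
    have := homeomorphUnitSphereProd_symm_apply_coe (Space n) (homeomorphUnitSphereProd (Space n) x)
    rw [Homeomorph.symm_apply_apply] at this
    rw [hH]
    exact congrArg F this.symm
  have hms : MeasurableSet ({0}ᶜ : Set (Space n)) := (measurableSet_singleton _).compl
  have hint : Integrable H (μ.toSphere.prod (.volumeIoiPow (n - 1))) := by
    rw [← hmp.integrable_comp_emb hemb]
    have h1 : IntegrableOn F ({0}ᶜ : Set (Space n)) μ := hF.integrableOn
    rw [integrableOn_iff_comap_subtypeVal hms] at h1
    exact h1.congr (ae_of_all _ fun x => (hcomp x).symm)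
  have hval : ∫ z, F z ∂μ = ∫ q, H q ∂(μ.toSphere.prod (.volumeIoiPow (n - 1))) := by
    rw [← hmp.integral_comp hemb]
    simp only [hcomp]
    rw [integral_subtype_comap hms, restrict_compl_singleton]
  have hinner : ∀ ω : UnitSphere n, ∫ r, H (ω, r) ∂(Measure.volumeIoiPow (n - 1)) =
      ∫ r in Set.Ioi (0 : ℝ), r ^ (n - 1) * F (r • (ω : Space n)) := by
    intro ω
    simp only [Measure.volumeIoiPow, ENNReal.ofReal]
    rw [integral_withDensity_eq_integral_smul (by fun_prop),
      integral_subtype_comap measurableSet_Ioi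
        fun r : ℝ => Real.toNNReal (r ^ (n - 1)) • F (r • (ω : Space n))]
    refine setIntegral_congr_fun measurableSet_Ioi fun r hr => ?_
    simp only [NNReal.smul_def, smul_eq_mul]
    rw [Real.coe_toNNReal _ (pow_nonneg (le_of_lt hr) _)]
  constructor
  · exact hint.integral_prod_left.congr (ae_of_all _ fun ω => hinner ω)
  · rw [hval, integral_prod _ hint]
    simp only [hinner]
    rfl

/-- The Poisson kernel `ε / (λ² + ε²)` at `λ = 4π²r² - 1`. -/
def poisson (ε r : ℝ) : ℝ := ε / ((4 * Real.pi ^ 2 * r ^ 2 - 1) ^ 2 + ε ^ 2)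

/-- The substitution `r = (1 + εt)/(2π)` centres the kernel at the radius of the sphere and removes
the concentration as `ε → 0`. -/
theorem poisson_rescale {ε : ℝ} (hε : 0 < ε) (t : ℝ) :
    ε / (2 * Real.pi) * poisson ε (ε / (2 * Real.pi) * t + 1 / (2 * Real.pi)) =
      1 / (2 * Real.pi) * (1 + t ^ 2 * (2 + ε * t) ^ 2)⁻¹ := by
  have hπ := Real.pi_pos
  have h1 : 4 * Real.pi ^ 2 * (ε / (2 * Real.pi) * t + 1 / (2 * Real.pi)) ^ 2 - 1 =
      ε * t * (2 + ε * t) := by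
    field_simp; ring
  have h2 : (0 : ℝ) < 1 + t ^ 2 * (2 + ε * t) ^ 2 := by positivity
  rw [poisson, h1, show (ε * t * (2 + ε * t)) ^ 2 + ε ^ 2 =
    ε ^ 2 * (1 + t ^ 2 * (2 + ε * t) ^ 2) by ring]
  field_simp

/-- The rescaled integrand of the Poisson integral. -/
def poissonIntegrand (q : ℝ → ℝ) (ε t : ℝ) : ℝ :=
  1 / (2 * Real.pi) * (1 + t ^ 2 * (2 + ε * t) ^ 2)⁻¹ *
    (Set.Ioi (0 : ℝ)).indicator q (ε / (2 * Real.pi) * t + 1 / (2 * Real.pi))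

theorem integral_Ioi_mul_poisson {ε : ℝ} (hε : 0 < ε) (q : ℝ → ℝ) :
    ∫ r in Set.Ioi (0 : ℝ), q r * poisson ε r = ∫ t, poissonIntegrand q ε t := by
  have hπ := Real.pi_pos
  have ha : 0 < ε / (2 * Real.pi) := by positivity
  rw [← integral_indicator measurableSet_Ioi,
    ← integral_add_right_eq_self _ (1 / (2 * Real.pi))]
  have := Measure.integral_comp_mul_left (fun r => (Set.Ioi (0 : ℝ)).indicator
    (fun r => q r * poisson ε r) (r + 1 / (2 * Real.pi))) (ε / (2 * Real.pi))
  rw [abs_of_pos (inv_pos.2 ha), smul_eq_mul, eq_comm, inv_mul_eq_iff_eq_mul₀ ha.ne'] at this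
  rw [this, ← integral_const_mul]
  refine integral_congr_ae (ae_of_all _ fun t => ?_)
  simp only [poissonIntegrand, ← poisson_rescale hε t]
  by_cases h : ε / (2 * Real.pi) * t + 1 / (2 * Real.pi) ∈ Set.Ioi (0 : ℝ)
  · rw [Set.indicator_of_mem h, Set.indicator_of_mem h]; ring
  · rw [Set.indicator_of_notMem h, Set.indicator_of_notMem h]; ring

theorem norm_poissonIntegrand_le (ε : ℝ) {M : ℝ} {q : ℝ → ℝ}
    (hq : ∀ r, 0 < r → |q r| ≤ M) (t : ℝ) :
    ‖poissonIntegrand q ε t‖ ≤ M * (1 + t ^ 2)⁻¹ := by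
  have hπ := Real.pi_pos
  have hM : 0 ≤ M := (abs_nonneg _).trans (hq 1 one_pos)
  unfold poissonIntegrand
  by_cases h : ε / (2 * Real.pi) * t + 1 / (2 * Real.pi) ∈ Set.Ioi (0 : ℝ)
  · rw [Set.indicator_of_mem h, norm_mul, norm_mul, Real.norm_of_nonneg (by positivity),
      Real.norm_of_nonneg (by positivity), mul_comm, Real.norm_eq_abs]
    have h0 : 0 < 1 + ε * t := by
      have h' : 0 < ε / (2 * Real.pi) * t + 1 / (2 * Real.pi) := h
      have e : ε / (2 * Real.pi) * t + 1 / (2 * Real.pi) = (1 + ε * t) / (2 * Real.pi) := by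
        field_simp; ring
      rw [e] at h'
      exact (div_pos_iff_of_pos_right (by positivity)).1 h'
    -- Positivity of the radius means `1 + εt > 0`, hence `(2 + εt)² ≥ 1`. This gives the majorant
    -- `1/(1 + t²)`, independent of `ε`.
    have h1 : 1 + t ^ 2 ≤ 1 + t ^ 2 * (2 + ε * t) ^ 2 := by
      have : 1 ≤ (2 + ε * t) ^ 2 := by nlinarith
      nlinarith [sq_nonneg t]
    have h2 : 1 / (2 * Real.pi) ≤ 1 := by
      rw [div_le_one (by positivity)]; linarith [Real.pi_gt_three]
    calc _ ≤ M * (1 * (1 + t ^ 2)⁻¹) := by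
          gcongr
          exact hq _ h
      _ = _ := by ring
  · rw [Set.indicator_of_notMem h, mul_zero, norm_zero]; positivity

theorem tendsto_poissonIntegrand {q : ℝ → ℝ} (hq : Continuous q) (t : ℝ) :
    Tendsto (fun ε => poissonIntegrand q ε t) (𝓝[>] 0)
      (𝓝 (1 / (2 * Real.pi) * (1 + t ^ 2 * (2 + 0 * t) ^ 2)⁻¹ * q (1 / (2 * Real.pi)))) := by
  have hπ := Real.pi_pos
  have hr : Tendsto (fun ε : ℝ => ε / (2 * Real.pi) * t + 1 / (2 * Real.pi)) (𝓝[>] 0)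
      (𝓝 (1 / (2 * Real.pi))) := by
    have : Continuous fun ε : ℝ => ε / (2 * Real.pi) * t + 1 / (2 * Real.pi) := by fun_prop
    have := this.tendsto 0
    simp only [zero_div, zero_mul, zero_add] at this
    exact this.mono_left nhdsWithin_le_nhds
  have h1 : Tendsto (fun ε : ℝ => 1 / (2 * Real.pi) * (1 + t ^ 2 * (2 + ε * t) ^ 2)⁻¹ *
      q (ε / (2 * Real.pi) * t + 1 / (2 * Real.pi))) (𝓝[>] 0)
      (𝓝 (1 / (2 * Real.pi) * (1 + t ^ 2 * (2 + 0 * t) ^ 2)⁻¹ * q (1 / (2 * Real.pi)))) := by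
    refine Tendsto.mul ?_ ((hq.tendsto _).comp hr)
    have : Continuous fun ε : ℝ => 1 / (2 * Real.pi) * (1 + t ^ 2 * (2 + ε * t) ^ 2)⁻¹ := by
      refine continuous_const.mul (Continuous.inv₀ (by fun_prop) fun ε => ?_)
      positivity
    exact (this.tendsto 0).mono_left nhdsWithin_le_nhds
  refine h1.congr' ?_
  filter_upwards [hr.eventually (lt_mem_nhds (by positivity : (0 : ℝ) < 1 / (2 * Real.pi)))]
    with ε hε
  rw [poissonIntegrand, Set.indicator_of_mem (show _ ∈ Set.Ioi (0 : ℝ) from hε)]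

theorem measurable_poissonIntegrand {q : ℝ → ℝ} (hq : Continuous q) (ε : ℝ) :
    Measurable (poissonIntegrand q ε) := by
  unfold poissonIntegrand
  have h1 : Measurable ((Set.Ioi (0 : ℝ)).indicator q) := hq.measurable.indicator measurableSet_Ioi
  refine Measurable.mul (by fun_prop) (h1.comp (by fun_prop))

theorem abs_integral_Ioi_mul_poisson_le {ε M : ℝ} (hε : 0 < ε) {q : ℝ → ℝ}
    (hM : ∀ r, 0 < r → |q r| ≤ M) : |∫ r in Set.Ioi (0 : ℝ), q r * poisson ε r| ≤ M * Real.pi := by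
  rw [integral_Ioi_mul_poisson hε, ← integral_univ_inv_one_add_sq, ← integral_const_mul,
    ← Real.norm_eq_abs]
  exact norm_integral_le_of_norm_le (integrable_inv_one_add_sq.const_mul M)
    (ae_of_all _ (norm_poissonIntegrand_le _ hM))

theorem tendsto_integral_Ioi_mul_poisson {M : ℝ} {q : ℝ → ℝ} (hq : Continuous q)
    (hM : ∀ r, 0 < r → |q r| ≤ M) :
    Tendsto (fun ε => ∫ r in Set.Ioi (0 : ℝ), q r * poisson ε r) (𝓝[>] 0)
      (𝓝 ((∫ t : ℝ, 1 / (2 * Real.pi) * (1 + t ^ 2 * (2 + 0 * t) ^ 2)⁻¹) *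
        q (1 / (2 * Real.pi)))) := by
  rw [← integral_mul_const]
  have : Tendsto (fun ε => ∫ t, poissonIntegrand q ε t) (𝓝[>] 0)
      (𝓝 (∫ t : ℝ, 1 / (2 * Real.pi) * (1 + t ^ 2 * (2 + 0 * t) ^ 2)⁻¹ *
        q (1 / (2 * Real.pi)))) := by
    refine tendsto_integral_filter_of_dominated_convergence (fun t => M * (1 + t ^ 2)⁻¹)
      (Eventually.of_forall fun ε => (measurable_poissonIntegrand hq ε).aestronglyMeasurable) ?_
      (integrable_inv_one_add_sq.const_mul M) (ae_of_all _ fun t => tendsto_poissonIntegrand hq t)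
    exact Eventually.of_forall fun ε => ae_of_all _ (norm_poissonIntegrand_le _ hM)
  refine this.congr' ?_
  filter_upwards [self_mem_nhdsWithin] with ε hε
  exact (integral_Ioi_mul_poisson hε q).symm

/-- A continuous integrable density `g` with `‖z‖ⁿ⁻¹ g(z)` bounded, integrated against the Poisson
kernel, converges to a multiple of its integral over the sphere of radius `1 / 2π`. -/
theorem exists_tendsto_integral_mul_poisson {n : ℕ} (hn : 0 < n) {M : ℝ} {g : Space n → ℝ}
    (hg : Continuous g) (hgi : Integrable g) (hg0 : ∀ z, 0 ≤ g z)
    (hM : ∀ z, ‖z‖ ^ (n - 1) * g z ≤ M) :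
    ∃ L : ℝ, L ≤ Real.pi * (∫ ω : UnitSphere n, g ((1 / (2 * Real.pi)) • (ω : Space n))
        ∂surfaceMeasure n) ∧
      Tendsto (fun ε => ∫ z, g z * poisson ε ‖z‖) (𝓝[>] 0) (𝓝 L) := by
  have hπ := Real.pi_pos
  set r₀ : ℝ := 1 / (2 * Real.pi) with hr₀
  have hr₀1 : r₀ ≤ 1 := by
    rw [hr₀, div_le_one (by positivity)]; linarith [Real.pi_gt_three]
  have hr₀0 : 0 < r₀ := by positivity
  -- The exact value of this constant is irrelevant; `c ≤ π` and `r₀ ≤ 1` suffice for the upper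
  -- bound on the limit.
  set c : ℝ := ∫ t : ℝ, 1 / (2 * Real.pi) * (1 + t ^ 2 * (2 + 0 * t) ^ 2)⁻¹ with hc
  have hc0 : 0 ≤ c := integral_nonneg fun t => by positivity
  have hcπ : c ≤ Real.pi := by
    refine le_of_le_of_eq (b := ∫ t : ℝ, (1 + t ^ 2)⁻¹) ?_ integral_univ_inv_one_add_sq
    refine integral_mono_of_nonneg (ae_of_all _ fun t => by positivity) integrable_inv_one_add_sq
      (ae_of_all _ fun t => ?_)
    simp only
    calc _ ≤ 1 * (1 + t ^ 2)⁻¹ := by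
          gcongr
          nlinarith [sq_nonneg t]
      _ = _ := one_mul _
  have hq : ∀ ω : UnitSphere n, Continuous fun r : ℝ => r ^ (n - 1) * g (r • (ω : Space n)) := by
    intro ω; fun_prop
  have hqM : ∀ (ω : UnitSphere n) (r : ℝ), 0 < r → |r ^ (n - 1) * g (r • (ω : Space n))| ≤ M := by
    intro ω r hr
    rw [abs_of_nonneg (mul_nonneg (by positivity) (hg0 _))]
    have := hM (r • (ω : Space n))
    rwa [norm_smul, norm_eq_of_mem_sphere, mul_one, Real.norm_of_nonneg hr.le] at this
  have hpm : ∀ ε : ℝ, 0 < ε → Integrable fun z : Space n => g z * poisson ε ‖z‖ := by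
    intro ε hε
    have hcont : Continuous fun z : Space n => poisson ε ‖z‖ := by
      unfold poisson
      refine continuous_const.div (by fun_prop) fun z => ?_
      positivity
    refine (hgi.mul_const (1 / ε)).mono' (hg.mul hcont).aestronglyMeasurable
      (ae_of_all _ fun z => ?_)
    rw [norm_mul, Real.norm_of_nonneg (hg0 z), Real.norm_of_nonneg (by unfold poisson; positivity)]
    refine mul_le_mul_of_nonneg_left ?_ (hg0 z)
    rw [poisson, div_le_div_iff₀ (by positivity) hε]
    nlinarith [sq_nonneg (4 * Real.pi ^ 2 * ‖z‖ ^ 2 - 1)]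
  have hpolar : ∀ ε : ℝ, 0 < ε → _ := fun ε hε => integral_polar hn (hpm ε hε)
  have hin : ∀ (ε : ℝ) (ω : UnitSphere n), (∫ r in Set.Ioi (0 : ℝ), r ^ (n - 1) *
      (g (r • (ω : Space n)) * poisson ε ‖r • (ω : Space n)‖)) =
      ∫ r in Set.Ioi (0 : ℝ), (r ^ (n - 1) * g (r • (ω : Space n))) * poisson ε r := by
    intro ε ω
    refine setIntegral_congr_fun measurableSet_Ioi fun r hr => ?_
    have hr : 0 < r := hr
    simp only [norm_smul, norm_eq_of_mem_sphere, mul_one, Real.norm_of_nonneg hr.le, mul_assoc]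
  simp only [hin] at hpolar
  refine ⟨∫ ω : UnitSphere n, c * (r₀ ^ (n - 1) * g (r₀ • (ω : Space n))) ∂surfaceMeasure n, ?_, ?_⟩
  · rw [← integral_const_mul]
    have hcg : Continuous fun ω : UnitSphere n => g (r₀ • (ω : Space n)) := by fun_prop
    refine integral_mono_of_nonneg (ae_of_all _ fun ω => ?_) ?_ (ae_of_all _ fun ω => ?_)
    · have := hg0 (r₀ • (ω : Space n)); positivity
    · exact (hcg.const_mul _).integrable_of_hasCompactSupport (HasCompactSupport.of_compactSpace _)
    · have h := hg0 (r₀ • (ω : Space n))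
      have h2 : r₀ ^ (n - 1) ≤ 1 := pow_le_one₀ hr₀0.le hr₀1
      simp only
      gcongr
      nlinarith
  · have : Tendsto (fun ε => ∫ ω : UnitSphere n, (∫ r in Set.Ioi (0 : ℝ),
        (r ^ (n - 1) * g (r • (ω : Space n))) * poisson ε r) ∂surfaceMeasure n) (𝓝[>] 0)
        (𝓝 (∫ ω : UnitSphere n, c * (r₀ ^ (n - 1) * g (r₀ • (ω : Space n))) ∂surfaceMeasure n)) := by
      refine tendsto_integral_filter_of_dominated_convergence (fun _ => M * Real.pi) ?_ ?_
        (integrable_const _)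
        (ae_of_all _ fun ω => tendsto_integral_Ioi_mul_poisson (hq ω) (hqM ω))
      · filter_upwards [self_mem_nhdsWithin] with ε hε
        exact (hpolar ε hε).1.aestronglyMeasurable
      · filter_upwards [self_mem_nhdsWithin] with ε hε
        exact ae_of_all _ fun ω => abs_integral_Ioi_mul_poisson_le hε (hqM ω)
    refine this.congr' ?_
    filter_upwards [self_mem_nhdsWithin] with ε hε
    exact (hpolar ε hε).2.symm

/-! ### The a priori estimate for Schwartz functions -/

theorem fourier_eq_fourier_smul {n : ℕ} (φ : 𝓢(Space n, ℂ)) (ξ : Space n) :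
    fourier φ ξ = 𝓕 φ ((1 / (2 * Real.pi)) • ξ) := by
  have hπ := Real.pi_pos
  rw [SchwartzMap.fourier_coe, Real.fourier_eq', fourier]
  refine integral_congr_ae (ae_of_all _ fun x => ?_)
  simp only [smul_eq_mul, inner_smul_right, real_inner_comm ξ x]
  congr 2
  have : -2 * Real.pi * (1 / (2 * Real.pi) * inner ℝ ξ x) = -inner ℝ ξ x := by field_simp
  rw [this]
  push_cast
  ring

theorem integrable_norm_fourier_sq {n : ℕ} (φ : 𝓢(Space n, ℂ)) :
    Integrable fun z => ‖𝓕 φ z‖ ^ 2 :=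
  ((𝓕 φ).memLp 2 volume).integrable_norm_pow (by norm_num)

theorem exists_norm_pow_mul_norm_fourier_sq_le {n : ℕ} (φ : 𝓢(Space n, ℂ)) :
    ∃ M, ∀ z, ‖z‖ ^ (n - 1) * ‖𝓕 φ z‖ ^ 2 ≤ M := by
  refine ⟨SchwartzMap.seminorm ℝ (n - 1) 0 (𝓕 φ) * SchwartzMap.seminorm ℝ 0 0 (𝓕 φ), fun z => ?_⟩
  have h1 := SchwartzMap.norm_pow_mul_le_seminorm ℝ (𝓕 φ) (n - 1) z
  have h2 := SchwartzMap.norm_le_seminorm ℝ (𝓕 φ) z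
  rw [pow_two, ← mul_assoc]
  exact mul_le_mul h1 h2 (norm_nonneg _) (apply_nonneg _ _)

theorem norm_sq_symb {n : ℕ} (ε : ℝ) (z : Space n) :
    ‖symb ε z‖ ^ 2 = (4 * Real.pi ^ 2 * ‖z‖ ^ 2 - 1) ^ 2 + ε ^ 2 := by
  rw [← Complex.normSq_eq_norm_sq, Complex.normSq_apply, symb_re, symb_im]
  ring

/-- The quadratic form of the resolvent. -/
def resolventForm {n : ℕ} (φ : 𝓢(Space n, ℂ)) (ε : ℝ) : ℂ :=
  ∫ z, (symb ε z)⁻¹ * ((‖𝓕 φ z‖ ^ 2 : ℝ) : ℂ)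

theorem norm_inv_symb_le {n : ℕ} {ε : ℝ} (hε : 0 < ε) (z : Space n) : ‖(symb ε z)⁻¹‖ ≤ ε⁻¹ := by
  rw [norm_inv]
  exact inv_anti₀ hε (norm_symb_ge ε z)

theorem continuous_inv_symb {n : ℕ} {ε : ℝ} (hε : 0 < ε) :
    Continuous fun z : Space n => (symb ε z)⁻¹ :=
  (continuous_symb ε).inv₀ fun z => symb_ne_zero hε z

theorem integrable_inv_symb_mul {n : ℕ} (φ : 𝓢(Space n, ℂ)) {ε : ℝ} (hε : 0 < ε) :
    Integrable fun z => (symb ε z)⁻¹ * ((‖𝓕 φ z‖ ^ 2 : ℝ) : ℂ) :=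
  (integrable_norm_fourier_sq φ).ofReal.bdd_mul (continuous_inv_symb hε).aestronglyMeasurable
    (ae_of_all _ (norm_inv_symb_le hε))

theorem re_resolventForm {n : ℕ} (φ : 𝓢(Space n, ℂ)) {ε : ℝ} (hε : 0 < ε) :
    (resolventForm φ ε).re = ∫ z, ‖𝓕 φ z‖ ^ 2 * poisson ε ‖z‖ := by
  have h := integral_re (integrable_inv_symb_mul φ hε)
  simp only [RCLike.re_to_complex] at h
  rw [resolventForm, ← h]
  refine integral_congr_ae (ae_of_all _ fun z => ?_)
  simp only [Complex.re_mul_ofReal, Complex.inv_re, symb_re, Complex.normSq_eq_norm_sq,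
    norm_sq_symb, poisson]
  ring

/-- This links the oscillating form bounded by interpolation to the resolvent: differentiating
`symb⁻¹` in `ε` gives `-symb⁻²`. -/
theorem hasDerivAt_resolventForm {n : ℕ} (φ : 𝓢(Space n, ℂ)) {ε : ℝ} (hε : 0 < ε) :
    HasDerivAt (resolventForm φ) (-powForm ε 2 φ (fun x => starRingEnd ℂ (φ x))) ε := by
  have hcont : Continuous fun z => ((‖𝓕 φ z‖ ^ 2 : ℝ) : ℂ) :=
    Complex.continuous_ofReal.comp ((𝓕 φ).continuous.norm.pow 2)
  have hpos : ∀ x ∈ Metric.ball ε (ε / 2), ε / 2 < x := by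
    intro x hx
    rw [Metric.mem_ball, Real.dist_eq, abs_lt] at hx
    linarith [hx.1]
  have h := (hasDerivAt_integral_of_dominated_loc_of_deriv_le (μ := volume)
    (F := fun (x : ℝ) z => (symb x z)⁻¹ * ((‖𝓕 φ z‖ ^ 2 : ℝ) : ℂ))
    (F' := fun (x : ℝ) z => -((symb x z ^ 2)⁻¹ * ((‖𝓕 φ z‖ ^ 2 : ℝ) : ℂ)))
    (bound := fun z => ((ε / 2) ^ 2)⁻¹ * ‖𝓕 φ z‖ ^ 2) (x₀ := ε)
    (Metric.ball_mem_nhds ε (half_pos hε)) ?_ (integrable_inv_symb_mul φ hε) ?_ ?_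
    ((integrable_norm_fourier_sq φ).const_mul _) ?_).2
  · rw [integral_neg, ← powForm_conj_eq] at h
    exact h
  · filter_upwards [lt_mem_nhds hε] with x hx
    exact (integrable_inv_symb_mul φ hx).aestronglyMeasurable
  · exact ((((continuous_symb ε).pow 2).inv₀ fun z => pow_ne_zero 2 (symb_ne_zero hε z)).mul
      hcont).neg.aestronglyMeasurable
  · refine ae_of_all _ fun z x hx => ?_
    rw [norm_neg, norm_mul, norm_inv, norm_pow, Complex.norm_real,
      Real.norm_of_nonneg (by positivity)]
    have h1 := (hpos x hx).le.trans (norm_symb_ge x z)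
    gcongr
  · refine ae_of_all _ fun z x hx => ?_
    have hx0 : 0 < x := (half_pos hε).trans (hpos x hx)
    have h1 : HasDerivAt (fun x : ℝ => symb x z) 1 x := by
      unfold symb
      exact (HasDerivAt.ofReal_comp (hasDerivAt_id x)).add_const _
    have h2 := (h1.inv (symb_ne_zero hx0 z)).mul_const ((‖𝓕 φ z‖ ^ 2 : ℝ) : ℂ)
    have e : -((symb x z ^ 2)⁻¹ * ((‖𝓕 φ z‖ ^ 2 : ℝ) : ℂ)) =
        -1 / symb x z ^ 2 * ((‖𝓕 φ z‖ ^ 2 : ℝ) : ℂ) := by rw [div_eq_mul_inv]; ring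
    rw [e]
    exact h2

theorem toReal_eLpNorm_fourier_sphere_sq {n : ℕ} (φ : 𝓢(Space n, ℂ)) :
    ∫ ω : UnitSphere n, ‖𝓕 φ ((1 / (2 * Real.pi)) • (ω : Space n))‖ ^ 2 ∂surfaceMeasure n =
      (eLpNorm (fun ω : UnitSphere n => fourier φ (ω : Space n)) 2 (surfaceMeasure n)).toReal ^ 2 := by
  have hc : Continuous fun ω : UnitSphere n => fourier φ (ω : Space n) := by
    simp only [fourier_eq_fourier_smul]
    exact (𝓕 φ).continuous.comp (by fun_prop)
  have hm : MemLp (fun ω : UnitSphere n => fourier φ (ω : Space n)) 2 (surfaceMeasure n) :=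
    hc.memLp_of_hasCompactSupport (HasCompactSupport.of_compactSpace _)
  have h0 : 0 ≤ ∫ ω : UnitSphere n, ‖fourier φ (ω : Space n)‖ ^ 2 ∂surfaceMeasure n :=
    integral_nonneg fun ω => by positivity
  rw [hm.eLpNorm_eq_integral_rpow_norm (by norm_num) (by norm_num)]
  simp only [ENNReal.toReal_ofNat, Real.rpow_two]
  rw [ENNReal.toReal_ofReal (by positivity), ← Real.rpow_natCast, ← Real.rpow_mul h0]
  simp only [← fourier_eq_fourier_smul]
  norm_num

/-- The real part of the resolvent form changes by at most `Aε` between `0` and `ε`, and its limit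
at `0` is at most `π` times the squared trace norm. The form at `ε` equals `ε` times the integral to
be bounded, so dividing by `ε` leaves `A` without any loss. -/
theorem integral_norm_fourier_sq_div_le {n : ℕ} (hn : 0 < n) {A : ℝ} (φ : 𝓢(Space n, ℂ))
    (hA : ∀ ε : ℝ, 0 < ε → ε ≤ 1 → ‖powForm ε 2 φ (fun x => starRingEnd ℂ (φ x))‖ ≤ A)
    {ε : ℝ} (hε : 0 < ε) (hε1 : ε ≤ 1) :
    ∫ z, ‖𝓕 φ z‖ ^ 2 / ‖symb ε z‖ ^ 2 ≤ A + Real.pi / ε *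
      (eLpNorm (fun ω : UnitSphere n => fourier φ (ω : Space n)) 2 (surfaceMeasure n)).toReal ^ 2 := by
  have hA0 : 0 ≤ A := (norm_nonneg _).trans (hA ε hε hε1)
  obtain ⟨M, hM⟩ := exists_norm_pow_mul_norm_fourier_sq_le φ
  obtain ⟨L, hL, hT⟩ := exists_tendsto_integral_mul_poisson hn (g := fun z => ‖𝓕 φ z‖ ^ 2)
    ((𝓕 φ).continuous.norm.pow 2) (integrable_norm_fourier_sq φ) (fun z => by positivity) hM
  rw [toReal_eLpNorm_fourier_sphere_sq] at hL
  have hlip : ∀ η : ℝ, 0 < η → η ≤ ε →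
      (resolventForm φ ε).re ≤ (∫ z, ‖𝓕 φ z‖ ^ 2 * poisson η ‖z‖) + A * ε := by
    intro η hη hηε
    -- The mean value inequality is applied on `[η, ε]` with `η > 0`, as the derivative is known
    -- only for positive parameters; `η → 0` follows.
    have h := (convex_Icc η ε).norm_image_sub_le_of_norm_hasDerivWithin_le
      (f := resolventForm φ) (C := A)
      (fun x hx => (hasDerivAt_resolventForm φ (hη.trans_le hx.1)).hasDerivWithinAt)
      (fun x hx => by rw [norm_neg]; exact hA x (hη.trans_le hx.1) (hx.2.trans hε1))
      (Set.left_mem_Icc.2 hηε) (Set.right_mem_Icc.2 hηε)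
    rw [← re_resolventForm φ hη]
    have h1 := (Complex.re_le_norm _).trans h
    rw [Complex.sub_re, Real.norm_of_nonneg (by linarith)] at h1
    nlinarith
  have hlim : (resolventForm φ ε).re ≤ L + A * ε := by
    refine ge_of_tendsto (hT.add_const (A * ε)) ?_
    filter_upwards [Ioc_mem_nhdsGT hε] with η hη
    exact hlip η hη.1 hη.2
  rw [re_resolventForm φ hε] at hlim
  have e : ∫ z, ‖𝓕 φ z‖ ^ 2 * poisson ε ‖z‖ = ε * ∫ z, ‖𝓕 φ z‖ ^ 2 / ‖symb ε z‖ ^ 2 := by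
    rw [← integral_const_mul]
    refine integral_congr_ae (ae_of_all _ fun z => ?_)
    simp only [norm_sq_symb, poisson]
    ring
  rw [e] at hlim
  have := hlim.trans (add_le_add_left hL _)
  rw [← mul_le_mul_iff_right₀ hε]
  refine this.trans (le_of_eq ?_)
  field_simp
  ring

/-! ### The Helmholtz operator on Schwartz functions -/

/-- The Helmholtz operator `-Δ - 1` on Schwartz functions. -/
def helmholtz (n : ℕ) : 𝓢(Space n, ℂ) →ₗ[ℂ] 𝓢(Space n, ℂ) :=
  -((LineDeriv.laplacianCLM ℂ (Space n) 𝓢(Space n, ℂ)).toLinearMap) - LinearMap.id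

theorem helmholtz_apply {n : ℕ} (ψ : 𝓢(Space n, ℂ)) : helmholtz n ψ = -(Δ ψ) - ψ := by
  simp [helmholtz, SchwartzMap.laplacianCLM_eq]

theorem fourier_helmholtz {n : ℕ} (ψ : 𝓢(Space n, ℂ)) (z : Space n) :
    𝓕 (helmholtz n ψ) z = ((4 * Real.pi ^ 2 * ‖z‖ ^ 2 - 1 : ℝ) : ℂ) * 𝓕 ψ z := by
  have hg : Function.HasTemperateGrowth fun x : Space n => ‖x‖ ^ 2 := by fun_prop
  have e : helmholtz n ψ = (((2 * Real.pi) ^ 2 : ℝ) : ℂ) •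
      𝓕⁻ (SchwartzMap.smulLeftCLM ℂ (fun x : Space n => ‖x‖ ^ 2) (𝓕 ψ)) - ψ := by
    rw [helmholtz_apply, SchwartzMap.laplacian_eq_fourierMultiplierCLM,
      SchwartzMap.fourierMultiplierCLM_apply, neg_smul, neg_neg, Complex.coe_smul]
  have e2 : 𝓕 (helmholtz n ψ) = (((2 * Real.pi) ^ 2 : ℝ) : ℂ) •
      SchwartzMap.smulLeftCLM ℂ (fun x : Space n => ‖x‖ ^ 2) (𝓕 ψ) - 𝓕 ψ := by
    rw [e, ← fourierCLM_apply (R := ℂ), map_sub, map_smul, fourierCLM_apply, fourierCLM_apply,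
      fourier_fourierInv_eq]
  rw [e2, sub_apply, smul_apply, SchwartzMap.smulLeftCLM_apply_apply hg]
  simp only [smul_eq_mul, Complex.real_smul]
  push_cast
  ring

theorem fourierInv_eq_fourier_neg {n : ℕ} (ψ : 𝓢(Space n, ℂ)) (z : Space n) :
    𝓕⁻ ψ z = 𝓕 ψ (-z) := by
  rw [SchwartzMap.fourierInv_coe, SchwartzMap.fourier_coe, Real.fourierInv_eq_fourier_neg]

theorem fourierInv_helmholtz {n : ℕ} (ψ : 𝓢(Space n, ℂ)) (z : Space n) :
    𝓕⁻ (helmholtz n ψ) z = ((4 * Real.pi ^ 2 * ‖z‖ ^ 2 - 1 : ℝ) : ℂ) * 𝓕⁻ ψ z := by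
  rw [fourierInv_eq_fourier_neg, fourierInv_eq_fourier_neg, fourier_helmholtz, norm_neg]

theorem norm_toLp_two_sq {n : ℕ} (ψ : 𝓢(Space n, ℂ)) : ‖ψ.toLp 2‖ ^ 2 = ∫ x, ‖ψ x‖ ^ 2 := by
  have h0 : 0 ≤ ∫ x, ‖ψ x‖ ^ 2 := integral_nonneg fun x => by positivity
  rw [SchwartzMap.norm_toLp, toReal_eLpNorm_two_eq (ψ.memLp 2 volume), ← Real.rpow_natCast,
    ← Real.rpow_mul h0]
  norm_num

theorem integral_norm_sq_fourierInv {n : ℕ} (ψ : 𝓢(Space n, ℂ)) :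
    ∫ z, ‖𝓕⁻ ψ z‖ ^ 2 = ‖ψ.toLp 2‖ ^ 2 := by
  rw [norm_toLp_two_sq, ← SchwartzMap.integral_norm_sq_fourier (𝓕⁻ ψ),
    FourierTransform.fourier_fourierInv_eq]

theorem integral_norm_sq_symb_mul_fourierInv {n : ℕ} (ε : ℝ) (ψ : 𝓢(Space n, ℂ)) :
    ∫ z, (‖symb ε z‖ * ‖𝓕⁻ ψ z‖) ^ 2 =
      ‖(helmholtz n ψ).toLp 2‖ ^ 2 + ε ^ 2 * ‖ψ.toLp 2‖ ^ 2 := by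
  have hi : ∀ χ : 𝓢(Space n, ℂ), Integrable fun z => ‖χ z‖ ^ 2 := fun χ =>
    (χ.memLp 2 volume).integrable_norm_pow (by norm_num)
  rw [← integral_norm_sq_fourierInv, ← integral_norm_sq_fourierInv, ← integral_const_mul,
    ← integral_add (hi _) ((hi _).const_mul _)]
  refine integral_congr_ae (ae_of_all _ fun z => ?_)
  simp only [fourierInv_helmholtz, norm_mul, mul_pow, norm_sq_symb, Complex.norm_real,
    Real.norm_eq_abs, sq_abs]
  ring

theorem integral_mul_eq_integral_fourier {n : ℕ} (φ ψ : 𝓢(Space n, ℂ)) :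
    ∫ x, ψ x * φ x = ∫ z, 𝓕 φ z * 𝓕⁻ ψ z := by
  rw [SchwartzMap.integral_fourier_mul_eq, FourierTransform.fourier_fourierInv_eq]
  simp only [mul_comm]

/-- Cauchy-Schwarz after dividing `𝓕 φ` and multiplying `𝓕⁻ ψ` by `|symb|`. Since `|symb|²` is the
square of the Helmholtz symbol plus `ε²`, Plancherel evaluates the second factor. -/
theorem norm_integral_mul_sq_le {n : ℕ} {ε : ℝ} (hε : 0 < ε) (φ ψ : 𝓢(Space n, ℂ)) :
    ‖∫ x, ψ x * φ x‖ ^ 2 ≤ (∫ z, ‖𝓕 φ z‖ ^ 2 / ‖symb ε z‖ ^ 2) *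
      (‖(helmholtz n ψ).toLp 2‖ ^ 2 + ε ^ 2 * ‖ψ.toLp 2‖ ^ 2) := by
  have hpos : ∀ z : Space n, 0 < ‖symb ε z‖ := fun z => norm_pos_iff.2 (symb_ne_zero hε z)
  have hc1 : Continuous fun z => ‖𝓕 φ z‖ / ‖symb ε z‖ :=
    (𝓕 φ).continuous.norm.div (continuous_symb ε).norm fun z => (hpos z).ne'
  have hc2 : Continuous fun z => ‖symb ε z‖ * ‖𝓕⁻ ψ z‖ :=
    (continuous_symb ε).norm.mul (𝓕⁻ ψ).continuous.norm
  have hi : ∀ χ : 𝓢(Space n, ℂ), Integrable fun z => ‖χ z‖ ^ 2 := fun χ =>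
    (χ.memLp 2 volume).integrable_norm_pow (by norm_num)
  have hm1 : MemLp (fun z => ‖𝓕 φ z‖ / ‖symb ε z‖) 2 volume := by
    rw [memLp_two_iff_integrable_sq hc1.aestronglyMeasurable]
    refine ((hi (𝓕 φ)).mul_const (ε ^ 2)⁻¹).mono' (hc1.pow 2).aestronglyMeasurable
      (ae_of_all _ fun z => ?_)
    rw [Real.norm_of_nonneg (by positivity), div_pow, div_eq_mul_inv]
    have := norm_symb_ge ε z
    gcongr
  have hm2 : MemLp (fun z => ‖symb ε z‖ * ‖𝓕⁻ ψ z‖) 2 volume := by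
    rw [memLp_two_iff_integrable_sq hc2.aestronglyMeasurable]
    refine ((hi (𝓕⁻ (helmholtz n ψ))).add ((hi (𝓕⁻ ψ)).const_mul (ε ^ 2))).congr
      (ae_of_all _ fun z => ?_)
    simp only [Pi.add_apply, fourierInv_helmholtz, norm_mul, mul_pow, norm_sq_symb,
      Complex.norm_real, Real.norm_eq_abs, sq_abs]
    ring
  have hcs := integral_mul_le_Lp_mul_Lq_of_nonneg (μ := volume) Real.HolderConjugate.two_two
    (f := fun z => ‖𝓕 φ z‖ / ‖symb ε z‖) (g := fun z => ‖symb ε z‖ * ‖𝓕⁻ ψ z‖)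
    (ae_of_all _ fun z => by positivity) (ae_of_all _ fun z => by positivity)
    (by simpa using hm1) (by simpa using hm2)
  simp only [Real.rpow_two] at hcs
  rw [integral_norm_sq_symb_mul_fourierInv] at hcs
  simp only [div_pow] at hcs
  have h1 : ‖∫ x, ψ x * φ x‖ ≤ ∫ z, ‖𝓕 φ z‖ / ‖symb ε z‖ * (‖symb ε z‖ * ‖𝓕⁻ ψ z‖) := by
    rw [integral_mul_eq_integral_fourier]
    refine (norm_integral_le_integral_norm _).trans (le_of_eq ?_)
    refine integral_congr_ae (ae_of_all _ fun z => ?_)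
    have := (hpos z).ne'
    simp only [norm_mul]
    field_simp
  have h0 : 0 ≤ ∫ z, ‖𝓕 φ z‖ ^ 2 / ‖symb ε z‖ ^ 2 := integral_nonneg fun z => by positivity
  refine (pow_le_pow_left₀ (norm_nonneg _) (h1.trans hcs) 2).trans (le_of_eq ?_)
  rw [mul_pow, ← Real.rpow_natCast, ← Real.rpow_natCast, ← Real.rpow_mul h0,
    ← Real.rpow_mul (by positivity)]
  norm_num

/-! ### The bound on the right-hand side -/

theorem continuous_toTemperedDistribution_apply {n : ℕ} {p : ℝ≥0∞} [Fact (1 ≤ p)]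
    (ψ : 𝓢(Space n, ℂ)) :
    Continuous fun f : Lp ℂ p (volume : Measure (Space n)) => Lp.toTemperedDistribution f ψ :=
  (PointwiseConvergenceCLM.evalCLM (RingHom.id ℂ) ℂ ψ).continuous.comp
    (Lp.toTemperedDistributionCLM ℂ volume p).continuous

theorem toTemperedDistribution_toLp_apply {n : ℕ} {p : ℝ≥0∞} [Fact (1 ≤ p)]
    (φ ψ : 𝓢(Space n, ℂ)) :
    Lp.toTemperedDistribution (φ.toLp p (volume : Measure (Space n))) ψ = ∫ x, ψ x * φ x := by
  rw [Lp.toTemperedDistribution_toLp_eq]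
  exact SchwartzMap.toTemperedDistributionCLM_apply_apply volume φ ψ

theorem norm_toTemperedDistribution_le {n : ℕ} (hn : 0 < n) {p : ℝ≥0∞} [Fact (1 ≤ p)] {A : ℝ}
    (hA : ∀ ε : ℝ, 0 < ε → ε ≤ 1 → ∀ φ : 𝓢(Space n, ℂ),
      ‖powForm ε 2 φ (fun x => starRingEnd ℂ (φ x))‖ ≤ A * ‖φ.toLp p (volume : Measure (Space n))‖ ^ 2)
    {f : Lp ℂ p (volume : Measure (Space n))} (hf : FourierVanishesOnSphere f)
    (ψ : 𝓢(Space n, ℂ)) :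
    ‖Lp.toTemperedDistribution f ψ‖ ≤ Real.sqrt A * ‖f‖ * ‖(helmholtz n ψ).toLp 2‖ := by
  obtain ⟨-, φ, hφ, htr⟩ := hf
  simp only [sub_zero] at htr
  set T : ℕ → ℝ := fun k => (eLpNorm (fun ω : UnitSphere n => fourier (φ k) (ω : Space n)) 2
    (surfaceMeasure n)).toReal with hT
  have hT0 : Tendsto T atTop (𝓝 0) := (ENNReal.tendsto_toReal ENNReal.zero_ne_top).comp htr
  have hlim : Tendsto (fun k => ‖∫ x, ψ x * φ k x‖ ^ 2) atTop
      (𝓝 (‖Lp.toTemperedDistribution f ψ‖ ^ 2)) := by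
    have := ((continuous_toTemperedDistribution_apply ψ).tendsto f).comp hφ
    refine ((this.norm).pow 2).congr fun k => ?_
    simp only [Function.comp_apply, toTemperedDistribution_toLp_apply]
  have hε : ∀ ε : ℝ, 0 < ε → ε ≤ 1 → ‖Lp.toTemperedDistribution f ψ‖ ^ 2 ≤
      (A * ‖f‖ ^ 2 + Real.pi / ε * 0 ^ 2) *
        (‖(helmholtz n ψ).toLp 2‖ ^ 2 + ε ^ 2 * ‖ψ.toLp 2‖ ^ 2) := by
    intro ε hε hε1
    -- The sequence must converge while `ε` is fixed, because the trace term carries the factor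
    -- `π/ε`.
    refine le_of_tendsto_of_tendsto' hlim
      ((((hφ.norm.pow 2).const_mul A).add ((hT0.pow 2).const_mul (Real.pi / ε))).mul_const _)
      fun k => (norm_integral_mul_sq_le hε (φ k) ψ).trans ?_
    refine mul_le_mul_of_nonneg_right ?_ (by positivity)
    exact integral_norm_fourier_sq_div_le hn (φ k) (fun ε h h' => hA ε h h' (φ k)) hε hε1
  have h0 : ‖Lp.toTemperedDistribution f ψ‖ ^ 2 ≤
      A * ‖f‖ ^ 2 * (‖(helmholtz n ψ).toLp 2‖ ^ 2 + 0 ^ 2 * ‖ψ.toLp 2‖ ^ 2) := by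
    have hc : Continuous fun ε : ℝ =>
        A * ‖f‖ ^ 2 * (‖(helmholtz n ψ).toLp 2‖ ^ 2 + ε ^ 2 * ‖ψ.toLp 2‖ ^ 2) := by fun_prop
    -- Now `ε → 0` removes the remaining term `ε² ‖ψ‖₂²`.
    refine ge_of_tendsto ((hc.tendsto 0).mono_left nhdsWithin_le_nhds) (?_ : ∀ᶠ ε in 𝓝[>] (0 : ℝ), _)
    filter_upwards [Ioc_mem_nhdsGT (zero_lt_one' ℝ)] with ε h
    simpa using hε ε h.1 h.2
  have := Real.sqrt_le_sqrt (h0.trans_eq (show _ = A * (‖f‖ * ‖(helmholtz n ψ).toLp 2‖) ^ 2 by ring))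
  rw [Real.sqrt_sq (norm_nonneg _), Real.sqrt_mul' _ (by positivity), Real.sqrt_sq (by positivity)]
    at this
  rwa [mul_assoc]

/-! ### Density of the range of the Helmholtz operator, existence and uniqueness -/

/-- The Helmholtz operator on Schwartz functions, with values in `L²`. -/
def helmholtzL2 (n : ℕ) : 𝓢(Space n, ℂ) →ₗ[ℂ] Lp ℂ 2 (volume : Measure (Space n)) :=
  (SchwartzMap.toLpCLM ℂ ℂ 2 (volume : Measure (Space n))).toLinearMap ∘ₗ helmholtz n

theorem helmholtzL2_apply {n : ℕ} (ψ : 𝓢(Space n, ℂ)) :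
    helmholtzL2 n ψ = (helmholtz n ψ).toLp 2 := rfl

theorem ae_four_pi_sq_mul_norm_sq_sub_one_ne_zero (n : ℕ) :
    ∀ᵐ z : Space n, 4 * Real.pi ^ 2 * ‖z‖ ^ 2 - 1 ≠ 0 := by
  have hπ := Real.pi_pos
  have h := Measure.addHaar_sphere_of_ne_zero (volume : Measure (Space n)) 0
    (show 1 / (2 * Real.pi) ≠ 0 by positivity)
  refine measure_mono_null (fun z hz => ?_) h
  have hz : 4 * Real.pi ^ 2 * ‖z‖ ^ 2 - 1 = 0 := not_not.1 hz
  rw [mem_sphere_zero_iff_norm, eq_div_iff (by positivity)]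
  have h1 : (‖z‖ * (2 * Real.pi)) ^ 2 = 1 := by linarith
  exact (pow_eq_one_iff_of_nonneg (by positivity) two_ne_zero).1 h1

/-- On the Fourier side, orthogonality to the range says that `(4π²|z|² - 1) 𝓕 v` vanishes almost
everywhere, and the zero set of the symbol is a sphere, hence null. This gives both density of the
range and uniqueness of the solution. -/
theorem eq_zero_of_inner_helmholtzL2 {n : ℕ} {v : Lp ℂ 2 (volume : Measure (Space n))}
    (hv : ∀ ψ, inner ℂ (helmholtzL2 n ψ) v = 0) : v = 0 := by
  set w := 𝓕 v with hw
  have hloc : LocallyIntegrable (fun z => (4 * Real.pi ^ 2 * ‖z‖ ^ 2 - 1) • w z)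
      (volume : Measure (Space n)) :=
    ((Lp.memLp w).locallyIntegrable (by norm_num)).continuous_smul (by fun_prop)
  have hz : ∀ᵐ z, (4 * Real.pi ^ 2 * ‖z‖ ^ 2 - 1) • w z = 0 := by
    refine ae_eq_zero_of_integral_contDiff_smul_eq_zero hloc fun g hg hgc => ?_
    have hg₁ : HasCompactSupport (Complex.ofRealCLM ∘ g) := hgc.comp_left rfl
    have hg₂ : ContDiff ℝ (⊤ : ℕ∞) (Complex.ofRealCLM ∘ g) := by fun_prop
    set G : 𝓢(Space n, ℂ) := hg₁.toSchwartzMap hg₂ with hG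
    have h := hv (𝓕⁻ G)
    rw [← Lp.inner_fourier_eq, helmholtzL2_apply, SchwartzMap.toLp_fourier_eq, L2.inner_def] at h
    rw [← h]
    refine integral_congr_ae ?_
    filter_upwards [(𝓕 (helmholtz n (𝓕⁻ G))).coeFn_toLp 2 volume] with z hz
    rw [hz, fourier_helmholtz, fourier_fourierInv_eq]
    have hGz : G z = (g z : ℂ) := rfl
    rw [hGz, ← Complex.ofReal_mul]
    simp only [RCLike.inner_apply, Complex.conj_ofReal, Complex.real_smul, ← hw]
    push_cast
    ring
  have hw0 : w = 0 := by
    rw [Lp.eq_zero_iff_ae_eq_zero]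
    filter_upwards [hz, ae_four_pi_sq_mul_norm_sq_sub_one_ne_zero n] with z h1 h2
    exact (smul_eq_zero.1 h1).resolve_left h2
  rw [← norm_eq_zero, ← Lp.norm_fourier_eq, ← hw, hw0, norm_zero]

theorem denseRange_helmholtzL2 (n : ℕ) : DenseRange (helmholtzL2 n) := by
  have h : (LinearMap.range (helmholtzL2 n)).topologicalClosure = ⊤ := by
    rw [Submodule.topologicalClosure_eq_top_iff, Submodule.eq_bot_iff]
    intro v hv
    exact eq_zero_of_inner_helmholtzL2 fun ψ => hv _ (LinearMap.mem_range_self _ ψ)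
  have := Submodule.dense_iff_topologicalClosure_eq_top.2 h
  rwa [LinearMap.coe_range] at this

/-- Distributional pairing is bilinear while the `L²` inner product is conjugate-linear in its first
slot, hence the `star`. -/
theorem toTemperedDistribution_eq_inner_star {n : ℕ} (u : Lp ℂ 2 (volume : Measure (Space n)))
    (χ : 𝓢(Space n, ℂ)) : Lp.toTemperedDistribution u χ = inner ℂ (star u) (χ.toLp 2) := by
  rw [Lp.toTemperedDistribution_apply, L2.inner_def]
  refine integral_congr_ae ?_
  filter_upwards [χ.coeFn_toLp 2 volume, Lp.coeFn_star u] with x h1 h2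
  rw [h1, h2]
  simp [RCLike.inner_apply, mul_comm]

theorem isSolution_iff {n : ℕ} {p : ℝ≥0∞} [Fact (1 ≤ p)]
    {u : Lp ℂ 2 (volume : Measure (Space n))} {f : Lp ℂ p (volume : Measure (Space n))} :
    IsSolution u f ↔
      ∀ ψ, inner ℂ (star u) (helmholtzL2 n ψ) = Lp.toTemperedDistribution f ψ := by
  have key : ∀ ψ : 𝓢(Space n, ℂ), (-(Δ (Lp.toTemperedDistribution u)) -
      Lp.toTemperedDistribution u) ψ = inner ℂ (star u) (helmholtzL2 n ψ) := by
    intro ψ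
    rw [helmholtzL2_apply, ← toTemperedDistribution_eq_inner_star, helmholtz_apply, map_sub, map_neg,
      ← TemperedDistribution.laplacian_apply_apply]
    rfl
  constructor
  · intro h ψ
    rw [← key, h]
  · intro h
    unfold IsSolution
    ext ψ
    rw [key, h]

/-- The hypothesis makes `(-Δ-1)ψ ↦ f(ψ)` a well-defined bounded functional on a dense subspace of
`L²`. Its Riesz representative, conjugated, is the solution, and the operator norm gives the bound.
-/
theorem existsUnique_isSolution_of_norm_le {n : ℕ} {p : ℝ≥0∞} [Fact (1 ≤ p)]
    {f : Lp ℂ p (volume : Measure (Space n))} {C : ℝ} (hC : 0 ≤ C)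
    (hf : ∀ ψ, ‖Lp.toTemperedDistribution f ψ‖ ≤ C * ‖helmholtzL2 n ψ‖) :
    (∃! u : Lp ℂ 2 (volume : Measure (Space n)), IsSolution u f) ∧
      ∀ u : Lp ℂ 2 (volume : Measure (Space n)), IsSolution u f → ‖u‖ ≤ C := by
  set F : 𝓢(Space n, ℂ) →ₗ[ℂ] ℂ := (Lp.toTemperedDistribution f).toLinearMap with hF
  have hd := denseRange_helmholtzL2 n
  set Λ := F.extendOfNorm (helmholtzL2 n) with hΛ
  have hΛn : ‖Λ‖ ≤ C := LinearMap.opNorm_extendOfNorm_le hd hC hf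
  set v := (InnerProductSpace.toDual ℂ (Lp ℂ 2 (volume : Measure (Space n)))).symm Λ with hv
  have hu : IsSolution (star v) f := by
    rw [isSolution_iff]
    intro ψ
    rw [star_star, hv, InnerProductSpace.toDual_symm_apply, hΛ,
      LinearMap.extendOfNorm_eq hd ⟨C, hf⟩]
    rfl
  have huniq : ∀ u : Lp ℂ 2 (volume : Measure (Space n)), IsSolution u f → u = star v := by
    intro u h
    rw [isSolution_iff] at h hu
    rw [← star_inj]
    exact hd.eq_of_inner_left ℂ fun ψ => (h ψ).trans (hu ψ).symm
  refine ⟨⟨star v, hu, huniq⟩, fun u h => ?_⟩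
  rw [huniq u h]
  have hs : ‖star v‖ = ‖v‖ := by
    rw [Lp.norm_def, Lp.norm_def]
    congr 1
    exact (eLpNorm_congr_ae (Lp.coeFn_star v)).trans eLpNorm_star
  rw [hs, hv, LinearIsometryEquiv.norm_map]
  exact hΛn

end Helmholtz

end

/-! ### The theorem: passage from extended to real exponents, and assembly -/

theorem mainTheorem1 (n : ℕ) (hn : 3 ≤ n) (p : ℝ≥0∞) [Fact (1 ≤ p)]
    (hp_lower : max 1 ((2 * n : ℝ≥0∞) / (n + 4)) ≤ p)
    (hp_upper : p ≤ (2 * n + 2 : ℝ≥0∞) / (n + 5))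
    (hnp : (n, p) ≠ (4, 1)) :
    ∃ C : ℝ, ∀ f : Lp ℂ p (volume : Measure (Helmholtz.Space n)),
      Helmholtz.FourierVanishesOnSphere f →
        (∃! u : Lp ℂ 2 (volume : Measure (Helmholtz.Space n)), Helmholtz.IsSolution u f) ∧
        ∀ u : Lp ℂ 2 (volume : Measure (Helmholtz.Space n)),
          Helmholtz.IsSolution u f → ‖u‖ ≤ C * ‖f‖ := by
  have htop : (2 * n + 2 : ℝ≥0∞) / (n + 5) ≠ ∞ := by
    refine (ENNReal.div_lt_top ?_ ?_).ne
    · exact_mod_cast ENNReal.natCast_ne_top (2 * n + 2)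
    · positivity
  have hpt : p ≠ ∞ := ne_top_of_le_ne_top htop hp_upper
  have hofReal : ENNReal.ofReal p.toReal = p := ENNReal.ofReal_toReal hpt
  have h1 : 1 ≤ p.toReal := by
    have := ENNReal.toReal_mono hpt ((le_max_left _ _).trans hp_lower)
    simpa using this
  have hl : 2 * (n : ℝ) / (n + 4) ≤ p.toReal := by
    have := ENNReal.toReal_mono hpt ((le_max_right _ _).trans hp_lower)
    rwa [ENNReal.toReal_div, ENNReal.toReal_mul, ENNReal.toReal_add (by simp) (by simp),
      ENNReal.toReal_natCast, ENNReal.toReal_ofNat, ENNReal.toReal_ofNat] at this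
  have hu : p.toReal ≤ (2 * (n : ℝ) + 2) / (n + 5) := by
    have := ENNReal.toReal_mono htop hp_upper
    rwa [ENNReal.toReal_div, ENNReal.toReal_add (by finiteness) (by simp), ENNReal.toReal_mul,
      ENNReal.toReal_add (by simp) (by simp),
      ENNReal.toReal_natCast, ENNReal.toReal_ofNat, ENNReal.toReal_ofNat] at this
  have hnp' : ¬ (n = 4 ∧ p.toReal = 1) := by
    rintro ⟨rfl, h⟩
    refine hnp ?_
    rw [← hofReal, h, ENNReal.ofReal_one]
  obtain ⟨A, hA0, hA⟩ := Helmholtz.exists_norm_powForm_two_le hn h1 hl hu hnp'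
  rw [hofReal] at hA
  refine ⟨Real.sqrt A, fun f hf =>
    Helmholtz.existsUnique_isSolution_of_norm_le (by positivity) fun ψ => ?_⟩
  refine Helmholtz.norm_toTemperedDistribution_le (by omega) (fun ε hε hε1 φ => ?_) hf ψ
  rw [SchwartzMap.norm_toLp]
  exact hA ε hε hε1 φ
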